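/- Let $b:\mathbb R\times[0,\infty)\to\mathbb R$ be continuously differentiable and bounded, let $1\le p_0<\infty$ and $u_0\in L^{p_0}(\mathbb R)\cap L^\infty(\mathbb R)$. For $0<T_*\le\infty$, a solution on $[0,T_*)$ of the problem $$u_t+(b(x,t)\,u)_x=u_{xx},\quad x\in\mathbb R,\ t>0,\qquad u(\cdot,0)=u_0,$$ is a function $u:\mathbb R\times[0,T_*)\to\mathbb R$ with $u(\cdot,0)=u_0$ a.e. that is bounded on each strip $\mathbb R\times[0,S]$, $0<S<T_*$, is $C^2$ in $x$ and $C^1$ in $t$ (with $u,u_t,u_x,u_{xx}$ continuous in $(x,t)$) and satisfies the equation pointwise on $\mathbb R\times(0,T_*)$, and satisfies $u(\cdot,t)\to u_0$ in $L^1_{\rm loc}(\mathbb R)$ as $t\to0^+$. Put $B(t)=\tfrac12\bigl(\sup_{x}b(x,t)-\inf_{x}b(x,t)\bigr)$ and, for $0\le t_0\le t<T_*$, $$\mathbb B(t_0;t)=\sup_{t_0\le\tau\le t}B(\tau),\qquad \mathbb U_p(t_0;t)=\sup_{t_0\le\tau\le t}\|u(\cdot,\tau)\|_{L^p(\mathbb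 R)}.$$ **Theorem 2.4.** Let $u$ be a solution on $[0,T_*)$, $0<T_*\le\infty$, and let $p_0\le p<\infty$, $0\le t_0<T_*$. Then, for every $t_0\le t<T_*$, $\mathbb U_p(t_0;t)$ is finite and $$\|u(\cdot,t)\|_{L^\infty(\mathbb R)}\le(2p)^{1/p}\max\Bigl\{\|u(\cdot,t_0)\|_{L^\infty(\mathbb R)},\ \mathbb B(t_0;t)^{1/p}\,\mathbb U_p(t_0;t)\Bigr\}.$$ Moreover, solutions are global: every solution on $[0,T_*)$ is the restriction of a solution on $[0,\infty)$, and for each such $u_0$ the problem has a solution on $[0,\infty)$. -/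

import Mathlib

open MeasureTheory Set Filter Topology

noncomputable section

/-- Admissible advection fields `b = b(x,t)`: continuously differentiable (jointly in `(x,t)`) and
bounded on the closed half plane `ℝ × [0,∞)`. -/
structure IsAdvectionField (b : ℝ → ℝ → ℝ) : Prop where
  contDiffOn : ContDiffOn ℝ 1 (fun z : ℝ × ℝ => b z.1 z.2) (univ ×ˢ Ici (0 : ℝ))
  bounded : ∃ M : ℝ, ∀ x t : ℝ, 0 ≤ t → |b x t| ≤ M

/-- The open strip `ℝ × (0,T)`, where `0 < T ≤ ∞`. -/
def openStrip (T : EReal) : Set (ℝ × ℝ) := {z | 0 < z.2 ∧ (z.2 : EReal) < T}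

/-- `u` is of class `C²` in `x` and `C¹` in `t` on `ℝ × (0,T)`: the derivatives `u_t`, `u_x`, `u_xx`
exist there, and `u`, `u_t`, `u_x`, `u_xx` are continuous functions of `(x,t)`. -/
structure IsC21 (T : EReal) (u : ℝ → ℝ → ℝ) : Prop where
  differentiableAt_t : ∀ z ∈ openStrip T, DifferentiableAt ℝ (fun s => u z.1 s) z.2
  differentiableAt_x : ∀ z ∈ openStrip T, DifferentiableAt ℝ (fun y => u y z.2) z.1
  differentiableAt_xx : ∀ z ∈ openStrip T, DifferentiableAt ℝ (deriv fun y => u y z.2) z.1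
  continuousOn : ContinuousOn (fun z : ℝ × ℝ => u z.1 z.2) (openStrip T)
  continuousOn_t : ContinuousOn (fun z : ℝ × ℝ => deriv (fun s => u z.1 s) z.2) (openStrip T)
  continuousOn_x : ContinuousOn (fun z : ℝ × ℝ => deriv (fun y => u y z.2) z.1) (openStrip T)
  continuousOn_xx :
    ContinuousOn (fun z : ℝ × ℝ => deriv (deriv fun y => u y z.2) z.1) (openStrip T)

/-- `u` is a solution on `[0,T)`, `0 < T ≤ ∞`, of the initial value problem
`u_t + (b(x,t) u)_x = u_xx`, `u(·,0) = u₀`: it is bounded on each strip `ℝ × [0,S]`, `0 < S < T`,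
solves the equation classically on `ℝ × (0,T)`, and `u(·,t) → u₀` in `L¹_loc(ℝ)` as `t → 0`.
Values `u x t` with `t` outside `[0,T)` are irrelevant. -/
structure IsSolution (b : ℝ → ℝ → ℝ) (u₀ : ℝ → ℝ) (T : EReal) (u : ℝ → ℝ → ℝ) : Prop where
  bounded : ∀ S : ℝ, 0 < S → (S : EReal) < T → ∃ M : ℝ, ∀ x, ∀ t ∈ Icc (0 : ℝ) S, |u x t| ≤ M
  isC21 : IsC21 T u
  equation : ∀ x t : ℝ, 0 < t → (t : EReal) < T →
    deriv (fun s => u x s) t + deriv (fun y => b y t * u y t) x = deriv (deriv fun y => u y t) x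
  initial_value : (fun x => u x 0) =ᵐ[volume] u₀
  initial_limit : ∀ K : Set ℝ, IsCompact K →
    Tendsto (fun t : ℝ => eLpNorm (fun x => u x t - u₀ x) 1 (volume.restrict K))
      (𝓝[>] (0 : ℝ)) (𝓝 0)

/-- Half the oscillation of the advection field at time `t`:
`B(t) = (sup_x b(x,t) - inf_x b(x,t)) / 2`. -/
def halfOsc (b : ℝ → ℝ → ℝ) (t : ℝ) : ℝ := ((⨆ x : ℝ, b x t) - ⨅ x : ℝ, b x t) / 2

/-- `𝔹(t₀;t) = sup {B(τ) : t₀ ≤ τ ≤ t}`. -/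
def supHalfOsc (b : ℝ → ℝ → ℝ) (t₀ t : ℝ) : ℝ := sSup (halfOsc b '' Icc t₀ t)

/-- `𝕌_p(t₀;t) = sup {‖u(·,τ)‖_{L^p(ℝ)} : t₀ ≤ τ ≤ t}`, as an element of `[0,∞]`. -/
def supLpNorm (u : ℝ → ℝ → ℝ) (p t₀ t : ℝ) : ENNReal :=
  ⨆ τ ∈ Icc t₀ t, eLpNorm (fun x => u x τ) (ENNReal.ofReal p) volume

end

/-!
Existence comes from the integral equation `u = P_t u₀ - ∂_z G ** (b u)`, where `G` is the heat
kernel, `P_t` the heat semigroup and `**` convolution in space and time. Its Picard series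
(`picardSum`) converges in sup norms weighted by `e^{-λt}`, because the weighted space-time `L¹` norm
of `∂_z G` is `O(λ^{-1/2})`. The same kernel bound with Minkowski's inequality controls the `L^p`
norms, with constants `1 + O(√t)` (`exists_isSolution`). Since `b` is only `C¹`, the regularity of the
sum is obtained from the time derivative: the part of the Duhamel integral near a point is
differentiated in `t` after the dilation `s = t r`, which moves the derivative onto `b u`, and
the part far from it is smooth (`TimeRegular.duhamel_step`). The bound is local in space because
`b_t` need not be bounded. Once the Duhamel integral `V = ∂_z G ** F` has a continuous time
derivative, integrating the heat equation in space expresses `V_x` and `V_xx` through `V_t` and `F`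
(`hasDerivAt_kernelConv_x`, `hasDerivAt_deriv_kernelConv_x`).

Both the estimate and uniqueness come from the energy identity for `∫ φ² |u|^q` with a cutoff `φ`
(`energy_inequality`). For a constant `β` the equation reads `u_t + β u_x = (u_x - (b - β) u)_x`, and
the transport by `β` contributes only cutoff errors; taking for `β` the midpoint of the range of
`b(·,t)`, only the half oscillation `B` of the drift enters. For `q = 2` and a difference of two
solutions Gronwall's inequality gives uniqueness (`IsSolution.unique`), hence the extension of any
solution to all times. For general `q ≥ 2`, Nash's inequality `‖v‖₂³ ≤ ‖v‖₁² ‖v'‖₂` for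
`v = φ |u|^{q/2-1} u` shows that `∫ |u|^q` decreases whenever it exceeds `(q B / 2) (∫ |u|^{q/2})²`
(`IsClassicalSolution.lintegral_rpow_le`). Iterating along `q = 2^k p` produces the constants
`∏ (2^{k-1} p)^{1/(2^k p)} = (2p)^{1/p}`, and `k → ∞` gives the sup norm
(`IsClassicalSolution.abs_le`). Initial time `t₀ = 0` is reached as a limit of positive times, using
that the global solution satisfies `‖u(·,s)‖_∞ ≤ (1 + C √s) ‖u₀‖_∞`.
-/

/-! ### The heat kernel and its derivatives -/

/-- The heat kernel `G(z,t) = (4πt)^{-1/2} exp(-z²/(4t))`. It vanishes for `t ≤ 0`, since then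
`√(4πt) = 0` and `0⁻¹ = 0`; this is the causal extension needed for space-time convolutions. -/
noncomputable def heatKernel (z t : ℝ) : ℝ := (√(4 * Real.pi * t))⁻¹ * Real.exp (-z ^ 2 / (4 * t))

/-- The space derivative `∂_z G` of the heat kernel. -/
noncomputable def heatKernelX (z t : ℝ) : ℝ := -(z / (2 * t)) * heatKernel z t

/-- The time derivative `∂_t G = ∂_z² G` of the heat kernel. -/
noncomputable def heatKernelT (z t : ℝ) : ℝ := (z ^ 2 / (4 * t ^ 2) - 1 / (2 * t)) * heatKernel z t

/-- The mixed derivative `∂_t ∂_z G` of the heat kernel. -/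
noncomputable def heatKernelXT (z t : ℝ) : ℝ := (z ^ 2 / (4 * t ^ 2) - 3 / (2 * t)) * heatKernelX z t

/-- The function `τ^{-1/2} G(z,2τ)`, which dominates `|∂_z G|` and `τ |∂_t ∂_z G|` up to
constants. -/
noncomputable def kernelMajorant (z t : ℝ) : ℝ := (√t)⁻¹ * heatKernel z (2 * t)

lemma heatKernel_nonneg (z t : ℝ) : 0 ≤ heatKernel z t := by
  unfold heatKernel; positivity

lemma heatKernel_of_nonpos {t : ℝ} (ht : t ≤ 0) (z : ℝ) : heatKernel z t = 0 := by
  have : √(4 * Real.pi * t) = 0 :=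
    Real.sqrt_eq_zero_of_nonpos (mul_nonpos_of_nonneg_of_nonpos (by positivity) ht)
  simp [heatKernel, this]

lemma heatKernelX_of_nonpos {t : ℝ} (ht : t ≤ 0) (z : ℝ) : heatKernelX z t = 0 := by
  simp [heatKernelX, heatKernel_of_nonpos ht]

lemma heatKernelXT_of_nonpos {t : ℝ} (ht : t ≤ 0) (z : ℝ) : heatKernelXT z t = 0 := by
  simp [heatKernelXT, heatKernelX_of_nonpos ht]

lemma kernelMajorant_nonneg (z t : ℝ) : 0 ≤ kernelMajorant z t :=
  mul_nonneg (by positivity) (heatKernel_nonneg _ _)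

lemma kernelMajorant_of_nonpos {t : ℝ} (ht : t ≤ 0) (z : ℝ) : kernelMajorant z t = 0 := by
  simp [kernelMajorant, heatKernel_of_nonpos (by linarith : 2 * t ≤ 0)]

lemma hasDerivAt_heatKernel_x (z t : ℝ) :
    HasDerivAt (fun y => heatKernel y t) (heatKernelX z t) z := by
  have h : HasDerivAt (fun y : ℝ => -y ^ 2 / (4 * t)) (-(2 * z) / (4 * t)) z := by
    simpa using ((hasDerivAt_pow 2 z).neg.div_const (4 * t))
  refine (h.exp.const_mul _).congr_deriv ?_
  unfold heatKernelX heatKernel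
  rw [show -(2 * z) / (4 * t) = -(z / (2 * t)) by
    rw [show 4 * t = 2 * (2 * t) by ring, ← mul_neg, mul_div_mul_left _ _ two_ne_zero, neg_div]]
  ring

lemma hasDerivAt_heatKernelX_x (z t : ℝ) :
    HasDerivAt (fun y => heatKernelX y t) (heatKernelT z t) z := by
  have h : HasDerivAt (fun y : ℝ => -(y / (2 * t))) (-(1 / (2 * t))) z :=
    ((hasDerivAt_id z).div_const (2 * t)).neg
  refine (h.mul (hasDerivAt_heatKernel_x z t)).congr_deriv ?_
  unfold heatKernelT heatKernelX
  ring

lemma hasDerivAt_heatKernel_t (z : ℝ) {t : ℝ} (ht : 0 < t) :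
    HasDerivAt (fun s => heatKernel z s) (heatKernelT z t) t := by
  have h1 : HasDerivAt (fun s : ℝ => 4 * Real.pi * s) (4 * Real.pi) t := by
    simpa using (hasDerivAt_id t).const_mul (4 * Real.pi)
  have hp : 0 < 4 * Real.pi * t := by positivity
  have h2 := (h1.sqrt hp.ne').inv (Real.sqrt_pos.2 hp).ne'
  have h3 : HasDerivAt (fun s : ℝ => -z ^ 2 / (4 * s)) (z ^ 2 / (4 * t ^ 2)) t := by
    have h4 : HasDerivAt (fun s : ℝ => 4 * s) 4 t := by
      simpa using (hasDerivAt_id t).const_mul (4 : ℝ)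
    refine ((hasDerivAt_const t (-z ^ 2)).div h4 (by positivity)).congr_deriv ?_
    field_simp
    ring
  refine (h2.mul h3.exp).congr_deriv ?_
  unfold heatKernelT heatKernel
  have hs : √(4 * Real.pi * t) ^ 2 = 4 * Real.pi * t := Real.sq_sqrt hp.le
  have hs0 : √(4 * Real.pi * t) ≠ 0 := (Real.sqrt_pos.2 hp).ne'
  have : -(4 * Real.pi / (2 * √(4 * Real.pi * t))) / √(4 * Real.pi * t) ^ 2
      = -(1 / (2 * t)) * (√(4 * Real.pi * t))⁻¹ := by
    rw [hs]; field_simp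
  simp only [Pi.inv_apply]
  rw [this]
  ring

lemma hasDerivAt_heatKernelX_t_of_pos (z : ℝ) {t : ℝ} (ht : 0 < t) :
    HasDerivAt (fun s => heatKernelX z s) (heatKernelXT z t) t := by
  have h4 : HasDerivAt (fun s : ℝ => 2 * s) 2 t := by
    simpa using (hasDerivAt_id t).const_mul (2 : ℝ)
  have h := ((hasDerivAt_const t z).div h4 (by positivity)).neg
  refine (h.mul (hasDerivAt_heatKernel_t z ht)).congr_deriv ?_
  unfold heatKernelXT heatKernelT heatKernelX
  simp only [Pi.neg_apply, Pi.div_apply]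
  field_simp
  ring

/-- The kernels in terms of the similarity variable `a = |z| / (2√t)`. -/
lemma exists_similarity (z : ℝ) {t : ℝ} (ht : 0 < t) :
    ∃ a : ℝ, 0 ≤ a ∧ z ^ 2 = 4 * t * a ^ 2 ∧ |z| = 2 * a * √t ∧
      heatKernel z t = (√(4 * Real.pi))⁻¹ * (√t)⁻¹ * Real.exp (-a ^ 2) := by
  have hs : 0 < √t := Real.sqrt_pos.2 ht
  have hs2 : √t ^ 2 = t := Real.sq_sqrt ht.le
  refine ⟨|z| / (2 * √t), by positivity, ?_, by field_simp, ?_⟩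
  · rw [div_pow, mul_pow, hs2, sq_abs]; field_simp; norm_num
  · unfold heatKernel
    rw [Real.sqrt_mul (by positivity), mul_inv, div_pow, mul_pow, hs2, sq_abs]
    norm_num [neg_div]

lemma inv_sqrt_four_pi_le : (√(4 * Real.pi))⁻¹ ≤ 1 := by
  apply inv_le_one_of_one_le₀
  rw [Real.one_le_sqrt]
  nlinarith [Real.pi_gt_three]

lemma abs_heatKernelX_eq (z : ℝ) {t a : ℝ} (ht : 0 < t) (hz : |z| = 2 * a * √t) :
    |heatKernelX z t| = a * (√t)⁻¹ * heatKernel z t := by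
  have hs : 0 < √t := Real.sqrt_pos.2 ht
  have hs2 : √t * √t = t := Real.mul_self_sqrt ht.le
  unfold heatKernelX
  rw [abs_mul, abs_neg, abs_div, abs_of_nonneg (heatKernel_nonneg _ _), hz,
    abs_of_pos (by positivity : 0 < 2 * t)]
  congr 1
  rw [div_eq_iff (by positivity)]
  nth_rewrite 3 [← hs2]
  field_simp

lemma abs_heatKernelXT_eq (z : ℝ) {t a : ℝ} (ht : 0 < t) (hz : z ^ 2 = 4 * t * a ^ 2) :
    |heatKernelXT z t| = |a ^ 2 - 3 / 2| * t⁻¹ * |heatKernelX z t| := by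
  unfold heatKernelXT
  rw [abs_mul, hz]
  congr 1
  rw [← abs_of_pos (inv_pos.2 ht), ← abs_mul]
  congr 1
  field_simp

lemma heatKernel_eq_majorant (z : ℝ) {t a : ℝ} (ht : 0 < t) (hz : z ^ 2 = 4 * t * a ^ 2) :
    (√t)⁻¹ * heatKernel z t = √2 * Real.exp (-(a ^ 2 / 2)) * kernelMajorant z t := by
  have hs : 0 < √t := Real.sqrt_pos.2 ht
  have h2 : 0 < √2 := by positivity
  unfold kernelMajorant heatKernel
  rw [show 4 * Real.pi * (2 * t) = 2 * (4 * Real.pi * t) by ring,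
    Real.sqrt_mul (by norm_num : (0:ℝ) ≤ 2), mul_inv,
    show -z ^ 2 / (4 * t) = -(a ^ 2 / 2) + -z ^ 2 / (4 * (2 * t)) by rw [hz]; field_simp; ring,
    Real.exp_add]
  field_simp

lemma abs_heatKernelX_le (z t : ℝ) : |heatKernelX z t| ≤ 2 * kernelMajorant z t := by
  rcases le_or_gt t 0 with ht | ht
  · simp [heatKernelX_of_nonpos ht, kernelMajorant_of_nonpos ht]
  obtain ⟨a, ha, hz, hz', -⟩ := exists_similarity z ht
  have hk := kernelMajorant_nonneg z t
  rw [abs_heatKernelX_eq z ht hz', mul_assoc, heatKernel_eq_majorant z ht hz, ← mul_assoc]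
  refine mul_le_mul_of_nonneg_right ?_ hk
  have h1 : a ≤ Real.exp (a ^ 2 / 2) := by
    nlinarith [Real.add_one_le_exp (a ^ 2 / 2), sq_nonneg (a - 1)]
  have h2 : a * Real.exp (-(a ^ 2 / 2)) ≤ 1 := by
    rw [Real.exp_neg, ← div_eq_mul_inv, div_le_one (Real.exp_pos _)]; exact h1
  have h3 : √2 ≤ 2 := by rw [Real.sqrt_le_left (by norm_num)]; norm_num
  calc a * (√2 * Real.exp (-(a ^ 2 / 2))) = √2 * (a * Real.exp (-(a ^ 2 / 2))) := by ring
    _ ≤ √2 * 1 := by gcongr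
    _ ≤ 2 := by linarith

lemma abs_mul_heatKernelXT_le (z t : ℝ) : |t * heatKernelXT z t| ≤ 16 * kernelMajorant z t := by
  rcases le_or_gt t 0 with ht | ht
  · simp [heatKernelXT_of_nonpos ht, kernelMajorant_of_nonpos ht]
  obtain ⟨a, ha, hz, hz', -⟩ := exists_similarity z ht
  have hk := kernelMajorant_nonneg z t
  have : |t * heatKernelXT z t| = |a ^ 2 - 3 / 2| * a * ((√t)⁻¹ * heatKernel z t) := by
    rw [abs_mul, abs_heatKernelXT_eq z ht hz, abs_heatKernelX_eq z ht hz', abs_of_pos ht]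
    field_simp
  rw [this, heatKernel_eq_majorant z ht hz, ← mul_assoc]
  refine mul_le_mul_of_nonneg_right ?_ hk
  have h1 : |a ^ 2 - 3 / 2| * a ≤ 8 * Real.exp (a ^ 2 / 2) := by
    have h := Real.quadratic_le_exp_of_nonneg (by positivity : 0 ≤ a ^ 2 / 2)
    have h' : |a ^ 2 - 3 / 2| ≤ a ^ 2 + 3 / 2 := by
      rw [abs_le]; constructor <;> nlinarith [sq_nonneg a]
    have := mul_le_mul_of_nonneg_right h' ha
    nlinarith [sq_nonneg (a ^ 2 - a), sq_nonneg (a - 1), sq_nonneg a]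
  have h2 : |a ^ 2 - 3 / 2| * a * Real.exp (-(a ^ 2 / 2)) ≤ 8 := by
    rw [Real.exp_neg, ← div_eq_mul_inv, div_le_iff₀ (Real.exp_pos _)]; exact h1
  have h3 : √2 ≤ 2 := by rw [Real.sqrt_le_left (by norm_num)]; norm_num
  calc |a ^ 2 - 3 / 2| * a * (√2 * Real.exp (-(a ^ 2 / 2)))
      = √2 * (|a ^ 2 - 3 / 2| * a * Real.exp (-(a ^ 2 / 2))) := by ring
    _ ≤ √2 * 8 := by gcongr
    _ ≤ 16 := by linarith

lemma pow_seven_mul_exp_le {a : ℝ} (ha : 0 ≤ a) : a ^ 7 * Real.exp (-a ^ 2) ≤ 25 := by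
  have h4 := Real.pow_div_factorial_le_exp (a ^ 2) (by positivity) 4
  have h0 := Real.one_le_exp (by positivity : 0 ≤ a ^ 2)
  norm_num [Nat.factorial] at h4
  rw [Real.exp_neg, ← div_eq_mul_inv, div_le_iff₀ (Real.exp_pos _)]
  have : a ^ 7 ≤ 1 + a ^ 8 := by
    rcases le_total a 1 with h | h
    · have := pow_le_one₀ ha h (n := 7); have : 0 ≤ a ^ 8 := by positivity
      linarith
    · nlinarith [pow_le_pow_right₀ h (by norm_num : 7 ≤ 8)]
  nlinarith [this]

lemma pow_five_mul_exp_le {a : ℝ} (ha : 0 ≤ a) : a ^ 5 * Real.exp (-a ^ 2) ≤ 7 := by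
  have h4 := Real.pow_div_factorial_le_exp (a ^ 2) (by positivity) 3
  have h0 := Real.one_le_exp (by positivity : 0 ≤ a ^ 2)
  norm_num [Nat.factorial] at h4
  rw [Real.exp_neg, ← div_eq_mul_inv, div_le_iff₀ (Real.exp_pos _)]
  have : a ^ 5 ≤ 1 + a ^ 6 := by
    rcases le_total a 1 with h | h
    · have := pow_le_one₀ ha h (n := 5); have : 0 ≤ a ^ 6 := by positivity
      linarith
    · nlinarith [pow_le_pow_right₀ h (by norm_num : 5 ≤ 6)]
  nlinarith [this]

/-- The mixed derivative has parabolic degree `-4`, so it is dominated by `z⁻⁴` uniformly in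
time. -/
lemma pow_four_mul_abs_heatKernelXT_le (z t : ℝ) : z ^ 4 * |heatKernelXT z t| ≤ 576 := by
  rcases le_or_gt t 0 with ht | ht
  · simp [heatKernelXT_of_nonpos ht]
  obtain ⟨a, ha, hz, hz', hG⟩ := exists_similarity z ht
  have hs : 0 < √t := Real.sqrt_pos.2 ht
  have hs2 : (√t)⁻¹ * (√t)⁻¹ = t⁻¹ := by rw [← mul_inv, Real.mul_self_sqrt ht.le]
  have h' : |a ^ 2 - 3 / 2| ≤ a ^ 2 + 3 / 2 := by
    rw [abs_le]; constructor <;> nlinarith [sq_nonneg a]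
  have h5 := pow_five_mul_exp_le ha
  have h7 := pow_seven_mul_exp_le ha
  calc z ^ 4 * |heatKernelXT z t|
      = 16 * (√(4 * Real.pi))⁻¹ * (|a ^ 2 - 3 / 2| * a ^ 5 * Real.exp (-a ^ 2)) := by
        rw [abs_heatKernelXT_eq z ht hz, abs_heatKernelX_eq z ht hz', hG,
          show z ^ 4 = (z ^ 2) ^ 2 by ring, hz]
        calc _ = 16 * (√(4 * Real.pi))⁻¹ * (|a ^ 2 - 3 / 2| * a ^ 5 * Real.exp (-a ^ 2))
                * (t ^ 2 * t⁻¹ * ((√t)⁻¹ * (√t)⁻¹)) := by ring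
          _ = _ := by rw [hs2]; field_simp
    _ ≤ 16 * 1 * ((a ^ 2 + 3 / 2) * a ^ 5 * Real.exp (-a ^ 2)) := by
        gcongr; exact inv_sqrt_four_pi_le
    _ ≤ 576 := by nlinarith

lemma pow_six_mul_abs_heatKernelX_le (z t : ℝ) : z ^ 6 * |heatKernelX z t| ≤ 1600 * t ^ 2 := by
  rcases le_or_gt t 0 with ht | ht
  · simp [heatKernelX_of_nonpos ht]; positivity
  obtain ⟨a, ha, hz, hz', hG⟩ := exists_similarity z ht
  have hs : 0 < √t := Real.sqrt_pos.2 ht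
  have hs2 : (√t)⁻¹ * (√t)⁻¹ = t⁻¹ := by rw [← mul_inv, Real.mul_self_sqrt ht.le]
  have h7 := pow_seven_mul_exp_le ha
  calc z ^ 6 * |heatKernelX z t|
      = 64 * t ^ 2 * (√(4 * Real.pi))⁻¹ * (a ^ 7 * Real.exp (-a ^ 2)) := by
        rw [abs_heatKernelX_eq z ht hz', hG, show z ^ 6 = (z ^ 2) ^ 3 by ring, hz]
        calc _ = 64 * (√(4 * Real.pi))⁻¹ * (a ^ 7 * Real.exp (-a ^ 2))
                * (t ^ 3 * ((√t)⁻¹ * (√t)⁻¹)) := by ring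
          _ = _ := by rw [hs2]; field_simp
    _ ≤ 64 * t ^ 2 * 1 * 25 := by gcongr; exact inv_sqrt_four_pi_le
    _ = _ := by ring

/-- Away from `z = 0` the causal extension of `∂_z G` is differentiable at all times,
`t = 0` included. -/
lemma hasDerivAt_heatKernelX_t {z : ℝ} (hz : z ≠ 0) (t : ℝ) :
    HasDerivAt (fun s => heatKernelX z s) (heatKernelXT z t) t := by
  rcases lt_trichotomy t 0 with ht | ht | ht
  · rw [heatKernelXT_of_nonpos ht.le]
    refine (hasDerivAt_const t (0 : ℝ)).congr_of_eventuallyEq ?_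
    filter_upwards [Iio_mem_nhds ht] with s hs using heatKernelX_of_nonpos (le_of_lt hs) z
  · subst ht
    rw [heatKernelXT_of_nonpos le_rfl]
    have hO : (fun s => heatKernelX z s) =O[𝓝 0] fun s => ‖s - 0‖ ^ 2 := by
      refine Asymptotics.IsBigO.of_bound (1600 / z ^ 6) (Eventually.of_forall fun s => ?_)
      have h6 : 0 < z ^ 6 := by positivity
      rw [Real.norm_eq_abs, sub_zero, norm_pow, norm_norm, Real.norm_eq_abs, sq_abs,
        div_mul_eq_mul_div, le_div_iff₀ h6]
      linarith [pow_six_mul_abs_heatKernelX_le z s]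
    have := (hO.hasFDerivAt (by norm_num)).hasDerivAt
    simpa using this
  · exact hasDerivAt_heatKernelX_t_of_pos z ht

lemma integral_heatKernel {t : ℝ} (ht : 0 < t) : ∫ z, heatKernel z t = 1 := by
  unfold heatKernel
  have : ∀ z : ℝ, -z ^ 2 / (4 * t) = -(1 / (4 * t)) * z ^ 2 := fun z => by ring
  simp_rw [this]
  rw [integral_const_mul, integral_gaussian]
  have : Real.pi / (1 / (4 * t)) = 4 * Real.pi * t := by field_simp
  rw [this]
  exact inv_mul_cancel₀ (Real.sqrt_pos.2 (by positivity)).ne'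

lemma integrable_heatKernel (t : ℝ) : Integrable fun z => heatKernel z t := by
  rcases le_or_gt t 0 with ht | ht
  · simp [heatKernel_of_nonpos ht]
  · exact Integrable.of_integral_ne_zero (by rw [integral_heatKernel ht]; norm_num)

lemma measurable_heatKernel : Measurable fun q : ℝ × ℝ => heatKernel q.1 q.2 := by
  unfold heatKernel; fun_prop

lemma measurable_heatKernelX : Measurable fun q : ℝ × ℝ => heatKernelX q.1 q.2 := by
  unfold heatKernelX heatKernel; fun_prop

lemma measurable_heatKernelXT : Measurable fun q : ℝ × ℝ => heatKernelXT q.1 q.2 := by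
  unfold heatKernelXT heatKernelX heatKernel; fun_prop

lemma measurable_kernelMajorant : Measurable fun q : ℝ × ℝ => kernelMajorant q.1 q.2 := by
  unfold kernelMajorant heatKernel; fun_prop

lemma continuousOn_heatKernel :
    ContinuousOn (fun q : ℝ × ℝ => heatKernel q.1 q.2) {q | 0 < q.2} := by
  unfold heatKernel
  have h : ∀ q ∈ {q : ℝ × ℝ | 0 < q.2}, √(4 * Real.pi * q.2) ≠ 0 := fun q (hq : 0 < q.2) =>
    (Real.sqrt_pos.2 (by positivity)).ne'
  have h' : ∀ q ∈ {q : ℝ × ℝ | 0 < q.2}, 4 * q.2 ≠ 0 := fun q (hq : 0 < q.2) => by positivity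
  refine ContinuousOn.mul (ContinuousOn.inv₀ (by fun_prop) h) ?_
  exact (ContinuousOn.div (by fun_prop) (by fun_prop) h').rexp

lemma continuousOn_heatKernelX :
    ContinuousOn (fun q : ℝ × ℝ => heatKernelX q.1 q.2) {q | 0 < q.2} := by
  have h' : ∀ q ∈ {q : ℝ × ℝ | 0 < q.2}, 2 * q.2 ≠ 0 := fun q (hq : 0 < q.2) => by positivity
  exact (ContinuousOn.div (by fun_prop) (by fun_prop) h').neg.mul continuousOn_heatKernel

lemma continuousOn_heatKernelT :
    ContinuousOn (fun q : ℝ × ℝ => heatKernelT q.1 q.2) {q | 0 < q.2} := by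
  have h' : ∀ q ∈ {q : ℝ × ℝ | 0 < q.2}, 2 * q.2 ≠ 0 := fun q (hq : 0 < q.2) => by positivity
  have h'' : ∀ q ∈ {q : ℝ × ℝ | 0 < q.2}, 4 * q.2 ^ 2 ≠ 0 :=
    fun q (hq : 0 < q.2) => by positivity
  exact ((ContinuousOn.div (by fun_prop) (by fun_prop) h'').sub
    (ContinuousOn.div (by fun_prop) (by fun_prop) h')).mul continuousOn_heatKernel

lemma integral_kernelMajorant {t : ℝ} (ht : 0 < t) : ∫ z, kernelMajorant z t = (√t)⁻¹ := by
  unfold kernelMajorant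
  rw [integral_const_mul, integral_heatKernel (by positivity), mul_one]

/-- The weighted space-time norm `∬ e^{-λτ} τ^{-1/2} G(z,2τ) dz dτ` is `√(π/λ)`. -/
lemma integrable_exp_mul_kernelMajorant {lam : ℝ} (hl : 0 < lam) :
    Integrable (fun q : ℝ × ℝ => Real.exp (-lam * q.2) * kernelMajorant q.1 q.2) ∧
      ∫ q : ℝ × ℝ, Real.exp (-lam * q.2) * kernelMajorant q.1 q.2 = √(Real.pi / lam) := by
  have hslice : ∀ t : ℝ, ∫ z, Real.exp (-lam * t) * kernelMajorant z t
      = (Ioi (0 : ℝ)).indicator (fun t => t ^ ((1 / 2 : ℝ) - 1) * Real.exp (-(lam * t))) t := by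
    intro t
    rw [integral_const_mul]
    by_cases ht : 0 < t
    · rw [integral_kernelMajorant ht, indicator_of_mem (mem_Ioi.2 ht), mul_comm, Real.sqrt_eq_rpow,
        ← Real.rpow_neg ht.le]
      norm_num
    · simp [kernelMajorant_of_nonpos (not_lt.1 ht), ht]
  have hval := Real.integral_rpow_mul_exp_neg_mul_Ioi (a := 1 / 2) (by norm_num) hl
  have hpos : (1 / lam) ^ (1 / 2 : ℝ) * Real.Gamma (1 / 2) = √(Real.pi / lam) := by
    rw [← Real.sqrt_eq_rpow, Real.Gamma_one_half_eq, ← Real.sqrt_mul (by positivity)]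
    congr 1; ring
  have hint : Integrable fun t : ℝ => ∫ z, Real.exp (-lam * t) * kernelMajorant z t := by
    simp_rw [hslice]
    rw [integrable_indicator_iff measurableSet_Ioi]
    refine Integrable.of_integral_ne_zero ?_
    rw [hval, hpos]
    exact (Real.sqrt_pos.2 (by positivity)).ne'
  have hm : Measurable fun q : ℝ × ℝ => Real.exp (-lam * q.2) * kernelMajorant q.1 q.2 :=
    (by fun_prop : Measurable fun q : ℝ × ℝ => Real.exp (-lam * q.2)).mul
      measurable_kernelMajorant
  have hI : Integrable (fun q : ℝ × ℝ => Real.exp (-lam * q.2) * kernelMajorant q.1 q.2) := by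
    rw [Measure.volume_eq_prod, integrable_prod_iff' hm.aestronglyMeasurable]
    refine ⟨Eventually.of_forall fun t => ?_, ?_⟩
    · exact ((integrable_heatKernel (2 * t)).const_mul (√t)⁻¹).const_mul (Real.exp (-lam * t))
    · refine hint.congr (Eventually.of_forall fun t => integral_congr_ae ?_)
      refine Eventually.of_forall fun z => ?_
      exact (Real.norm_of_nonneg (mul_nonneg (Real.exp_pos _).le
        (kernelMajorant_nonneg _ _))).symm
  refine ⟨hI, ?_⟩
  rw [Measure.volume_eq_prod, integral_prod_symm _ (by rwa [← Measure.volume_eq_prod])]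
  simp_rw [hslice]
  rw [integral_indicator measurableSet_Ioi, hval, hpos]

/-! ### Causal space-time convolutions -/

/-- The space-time convolution `(k ** f)(x,t) = ∬ k(z,τ) f(x-z,t-τ) dz dτ`. For kernels and
functions that vanish for nonpositive times only `0 < τ < t` contributes. -/
noncomputable def kernelConv (k f : ℝ → ℝ → ℝ) (x t : ℝ) : ℝ :=
  ∫ q : ℝ × ℝ, k q.1 q.2 * f (x - q.1) (t - q.2)

/-- Causal kernels whose `e^{-λτ}`-weighted space-time norm is finite. -/
structure IsCausalKernel (lam : ℝ) (k : ℝ → ℝ → ℝ) : Prop where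
  measurable : Measurable fun q : ℝ × ℝ => k q.1 q.2
  causal : ∀ z t, t ≤ 0 → k z t = 0
  integrable : Integrable fun q : ℝ × ℝ => Real.exp (-lam * q.2) * k q.1 q.2

/-- The weighted norm `∬ e^{-λτ} |k(z,τ)| dz dτ`. -/
noncomputable def kernelNorm (lam : ℝ) (k : ℝ → ℝ → ℝ) : ℝ :=
  ∫ q : ℝ × ℝ, |Real.exp (-lam * q.2) * k q.1 q.2|

/-- Jointly measurable functions that vanish for nonpositive times. -/
structure IsCausal (f : ℝ → ℝ → ℝ) : Prop where
  measurable : Measurable fun q : ℝ × ℝ => f q.1 q.2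
  causal : ∀ y s, s ≤ 0 → f y s = 0

lemma kernelNorm_nonneg (lam : ℝ) (k : ℝ → ℝ → ℝ) : 0 ≤ kernelNorm lam k :=
  integral_nonneg fun _ => abs_nonneg _

section Kernels

variable {lam : ℝ}

lemma IsCausalKernel.of_majorant (hl : 0 < lam) {k : ℝ → ℝ → ℝ} {C : ℝ}
    (hm : Measurable fun q : ℝ × ℝ => k q.1 q.2)
    (hk : ∀ z t, |k z t| ≤ C * kernelMajorant z t) :
    IsCausalKernel lam k ∧ kernelNorm lam k ≤ C * √(Real.pi / lam) := by
  obtain ⟨hI, hv⟩ := integrable_exp_mul_kernelMajorant hl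
  have hle : ∀ q : ℝ × ℝ, |Real.exp (-lam * q.2) * k q.1 q.2|
      ≤ C * (Real.exp (-lam * q.2) * kernelMajorant q.1 q.2) := fun q => by
    rw [abs_mul, abs_of_pos (Real.exp_pos _)]
    calc _ ≤ Real.exp (-lam * q.2) * (C * kernelMajorant q.1 q.2) := by gcongr; exact hk _ _
      _ = _ := by ring
  have hm' : Measurable fun q : ℝ × ℝ => Real.exp (-lam * q.2) * k q.1 q.2 :=
    (by fun_prop : Measurable fun q : ℝ × ℝ => Real.exp (-lam * q.2)).mul hm
  have hint : Integrable fun q : ℝ × ℝ => Real.exp (-lam * q.2) * k q.1 q.2 :=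
    (hI.const_mul C).mono' hm'.aestronglyMeasurable (Eventually.of_forall hle)
  refine ⟨⟨hm, fun z t ht => ?_, hint⟩, ?_⟩
  · have := hk z t
    rw [kernelMajorant_of_nonpos ht, mul_zero] at this
    exact abs_nonpos_iff.1 this
  · rw [← hv, ← integral_const_mul]
    exact integral_mono hint.abs (hI.const_mul C) hle

lemma isCausalKernel_heatKernelX (hl : 0 < lam) :
    IsCausalKernel lam heatKernelX ∧ kernelNorm lam heatKernelX ≤ 2 * √(Real.pi / lam) :=
  IsCausalKernel.of_majorant hl measurable_heatKernelX abs_heatKernelX_le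

lemma measurable_mul_heatKernelXT :
    Measurable fun q : ℝ × ℝ => q.2 * heatKernelXT q.1 q.2 :=
  measurable_snd.mul measurable_heatKernelXT

lemma isCausalKernel_mul_heatKernelXT (hl : 0 < lam) :
    IsCausalKernel lam (fun z t => t * heatKernelXT z t) ∧
      kernelNorm lam (fun z t => t * heatKernelXT z t) ≤ 16 * √(Real.pi / lam) :=
  IsCausalKernel.of_majorant hl measurable_mul_heatKernelXT abs_mul_heatKernelXT_le

lemma isCausalKernel_heatKernel (hl : 0 < lam) : IsCausalKernel lam heatKernel := by
  have hm : Measurable fun q : ℝ × ℝ => Real.exp (-lam * q.2) * heatKernel q.1 q.2 :=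
    (by fun_prop : Measurable fun q : ℝ × ℝ => Real.exp (-lam * q.2)).mul measurable_heatKernel
  refine ⟨measurable_heatKernel, fun z t ht => heatKernel_of_nonpos ht z, ?_⟩
  rw [Measure.volume_eq_prod, integrable_prod_iff' hm.aestronglyMeasurable]
  refine ⟨Eventually.of_forall fun t =>
    (integrable_heatKernel t).const_mul (Real.exp (-lam * t)), ?_⟩
  have hslice : ∀ t : ℝ, ∫ z, ‖Real.exp (-lam * t) * heatKernel z t‖
      = (Ioi (0 : ℝ)).indicator (fun t => Real.exp (-lam * t)) t := by
    intro t
    have : ∀ z, ‖Real.exp (-lam * t) * heatKernel z t‖ = Real.exp (-lam * t) * heatKernel z t :=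
      fun z => Real.norm_of_nonneg (mul_nonneg (Real.exp_pos _).le (heatKernel_nonneg _ _))
    simp_rw [this]
    rw [integral_const_mul]
    by_cases ht : 0 < t
    · rw [integral_heatKernel ht, indicator_of_mem (mem_Ioi.2 ht), mul_one]
    · simp [heatKernel_of_nonpos (not_lt.1 ht), ht]
  simp_rw [hslice]
  rw [integrable_indicator_iff measurableSet_Ioi]
  exact integrableOn_exp_mul_Ioi (by linarith) 0

end Kernels

section Conv

variable {lam : ℝ} {k f : ℝ → ℝ → ℝ}

lemma measurable_conv_integrand (hk : Measurable fun q : ℝ × ℝ => k q.1 q.2)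
    (hf : Measurable fun q : ℝ × ℝ => f q.1 q.2) (x t : ℝ) :
    Measurable fun q : ℝ × ℝ => k q.1 q.2 * f (x - q.1) (t - q.2) := by
  have : Measurable fun q : ℝ × ℝ => f (x - q.1) (t - q.2) :=
    hf.comp (by fun_prop : Measurable fun q : ℝ × ℝ => ((x - q.1, t - q.2) : ℝ × ℝ))
  exact hk.mul this

lemma abs_conv_integrand_le (hk : IsCausalKernel lam k) {M x t : ℝ}
    (hM : ∀ y s, s < t → |f y s| ≤ M * Real.exp (lam * s)) (q : ℝ × ℝ) :
    |k q.1 q.2 * f (x - q.1) (t - q.2)|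
      ≤ M * Real.exp (lam * t) * |Real.exp (-lam * q.2) * k q.1 q.2| := by
  rcases le_or_gt q.2 0 with h | h
  · simp [hk.causal _ _ h]
  · rw [abs_mul, abs_mul, abs_of_pos (Real.exp_pos _)]
    have := hM (x - q.1) (t - q.2) (by linarith)
    calc |k q.1 q.2| * |f (x - q.1) (t - q.2)|
        ≤ |k q.1 q.2| * (M * Real.exp (lam * (t - q.2))) := by gcongr
      _ = _ := by rw [show lam * (t - q.2) = lam * t + -lam * q.2 by ring, Real.exp_add]; ring

lemma integrable_conv (hk : IsCausalKernel lam k) (hf : Measurable fun q : ℝ × ℝ => f q.1 q.2)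
    {M t : ℝ} (x : ℝ) (hM : ∀ y s, s < t → |f y s| ≤ M * Real.exp (lam * s)) :
    Integrable fun q : ℝ × ℝ => k q.1 q.2 * f (x - q.1) (t - q.2) :=
  (hk.integrable.abs.const_mul (M * Real.exp (lam * t))).mono'
    (measurable_conv_integrand hk.measurable hf x t).aestronglyMeasurable
    (Eventually.of_forall fun q => abs_conv_integrand_le hk hM q)

lemma abs_kernelConv_le (hk : IsCausalKernel lam k) {M t : ℝ} (x : ℝ)
    (hM : ∀ y s, s < t → |f y s| ≤ M * Real.exp (lam * s)) :
    |kernelConv k f x t| ≤ M * Real.exp (lam * t) * kernelNorm lam k := by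
  unfold kernelConv kernelNorm
  rw [← integral_const_mul, ← Real.norm_eq_abs]
  exact norm_integral_le_of_norm_le (hk.integrable.abs.const_mul _)
    (Eventually.of_forall fun q => abs_conv_integrand_le hk hM q)

lemma kernelConv_of_nonpos (hk : ∀ z t, t ≤ 0 → k z t = 0) (hf : ∀ y s, s ≤ 0 → f y s = 0)
    {t : ℝ} (ht : t ≤ 0) (x : ℝ) : kernelConv k f x t = 0 := by
  unfold kernelConv
  rw [← integral_zero (ℝ × ℝ) ℝ]
  congr 1; ext q
  rcases le_or_gt q.2 0 with h | h
  · rw [hk _ _ h, zero_mul]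
  · rw [hf _ _ (by linarith), mul_zero]

lemma kernelConv_eq_integral_sub (k f : ℝ → ℝ → ℝ) (x t : ℝ) :
    kernelConv k f x t = ∫ q : ℝ × ℝ, k (x - q.1) (t - q.2) * f q.1 q.2 := by
  unfold kernelConv
  rw [← integral_sub_left_eq_self (fun q : ℝ × ℝ => k q.1 q.2 * f (x - q.1) (t - q.2))
    volume ((x, t) : ℝ × ℝ)]
  simp

lemma measurable_kernelConv (hk : Measurable fun q : ℝ × ℝ => k q.1 q.2)
    (hf : Measurable fun q : ℝ × ℝ => f q.1 q.2) :
    Measurable fun q : ℝ × ℝ => kernelConv k f q.1 q.2 := by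
  unfold kernelConv
  have h : Measurable fun r : (ℝ × ℝ) × (ℝ × ℝ) =>
      k r.2.1 r.2.2 * f (r.1.1 - r.2.1) (r.1.2 - r.2.2) := by
    refine (hk.comp measurable_snd).mul ?_
    exact hf.comp (by fun_prop : Measurable fun r : (ℝ × ℝ) × (ℝ × ℝ) =>
      ((r.1.1 - r.2.1, r.1.2 - r.2.2) : ℝ × ℝ))
  exact (h.stronglyMeasurable.integral_prod_right (ν := (volume : Measure (ℝ × ℝ)))).measurable

lemma IsCausal.kernelConv (hk : IsCausalKernel lam k) (hf : IsCausal f) :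
    IsCausal (kernelConv k f) :=
  ⟨measurable_kernelConv hk.measurable hf.measurable,
    fun y _ hs => kernelConv_of_nonpos hk.causal hf.causal hs y⟩

lemma ae_snd_ne (t : ℝ) : ∀ᵐ q : ℝ × ℝ, q.2 ≠ t := by
  rw [Measure.volume_eq_prod]
  exact Measure.quasiMeasurePreserving_snd.ae (p := fun s : ℝ => s ≠ t) (by simp [ae_iff])

lemma ae_fst_ne (x : ℝ) : ∀ᵐ q : ℝ × ℝ, q.1 ≠ x := by
  rw [Measure.volume_eq_prod]
  exact Measure.quasiMeasurePreserving_fst.ae (p := fun s : ℝ => s ≠ x) (by simp [ae_iff])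

lemma continuousAt_kernelConv (hk : IsCausalKernel lam k)
    (hf : Measurable fun q : ℝ × ℝ => f q.1 q.2) {M T x t : ℝ} (hl : 0 ≤ lam) (htT : t < T)
    (hM : ∀ y s, s < T → |f y s| ≤ M * Real.exp (lam * s))
    (hc : ∀ᵐ q : ℝ × ℝ, 0 < q.2 →
      ContinuousAt (fun r : ℝ × ℝ => f r.1 r.2) (x - q.1, t - q.2)) :
    ContinuousAt (fun r : ℝ × ℝ => kernelConv k f r.1 r.2) (x, t) := by
  unfold kernelConv
  have hM0 : 0 ≤ M := by
    by_contra! h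
    have := (abs_nonneg _).trans (hM 0 (T - 1) (by linarith))
    nlinarith [Real.exp_pos (lam * (T - 1))]
  refine continuousAt_of_dominated
    (bound := fun q => M * Real.exp (lam * T) * |Real.exp (-lam * q.2) * k q.1 q.2|)
    (Eventually.of_forall fun r =>
      (measurable_conv_integrand hk.measurable hf r.1 r.2).aestronglyMeasurable) ?_
    (hk.integrable.abs.const_mul _) ?_
  · have : ∀ᶠ r : ℝ × ℝ in 𝓝 (x, t), r.2 < T := continuous_snd.continuousAt.eventually_lt_const htT
    filter_upwards [this] with r hr
    refine Eventually.of_forall fun q => ?_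
    refine (abs_conv_integrand_le hk (fun y s hs => hM y s (hs.trans hr)) q).trans ?_
    gcongr
  · filter_upwards [hc] with q hq
    rcases le_or_gt q.2 0 with h0 | h0
    · simpa [hk.causal _ _ h0] using continuousAt_const
    replace hq := hq h0
    refine ContinuousAt.mul continuousAt_const ?_
    have h2 : ContinuousAt (fun r : ℝ × ℝ => ((r.1 - q.1, r.2 - q.2) : ℝ × ℝ)) (x, t) := by
      fun_prop
    exact ContinuousAt.comp (g := fun r : ℝ × ℝ => f r.1 r.2)
      (f := fun r : ℝ × ℝ => ((r.1 - q.1, r.2 - q.2) : ℝ × ℝ)) (x := (x, t)) hq h2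

/-- A function that is continuous for positive times and vanishes for nonpositive times is
continuous off the line `s = 0`. -/
lemma IsCausal.continuousAt (hf : IsCausal f)
    (hc : ContinuousOn (fun r : ℝ × ℝ => f r.1 r.2) {r | 0 < r.2}) {y s : ℝ} (hs : s ≠ 0) :
    ContinuousAt (fun r : ℝ × ℝ => f r.1 r.2) (y, s) := by
  rcases lt_or_gt_of_ne hs with h | h
  · have : (fun r : ℝ × ℝ => f r.1 r.2) =ᶠ[𝓝 (y, s)] fun _ => 0 := by
      have : ∀ᶠ r : ℝ × ℝ in 𝓝 (y, s), r.2 < 0 := continuous_snd.continuousAt.eventually_lt_const h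
      filter_upwards [this] with r hr using hf.causal _ _ hr.le
    exact (continuousAt_const).congr this.symm
  · exact hc.continuousAt ((isOpen_lt continuous_const continuous_snd).mem_nhds h)

lemma continuousOn_kernelConv (hk : IsCausalKernel lam k) (hf : IsCausal f) (hl : 0 ≤ lam)
    {M : ℝ} (hM : ∀ y s, |f y s| ≤ M * Real.exp (lam * s))
    (hc : ContinuousOn (fun r : ℝ × ℝ => f r.1 r.2) {r | 0 < r.2}) :
    Continuous (fun r : ℝ × ℝ => kernelConv k f r.1 r.2) := by
  rw [continuous_iff_continuousAt]
  rintro ⟨x, t⟩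
  refine continuousAt_kernelConv hk hf.measurable hl (lt_add_one t) (fun y s _ => hM y s) ?_
  filter_upwards [ae_snd_ne t] with q hq _
  exact hf.continuousAt hc (sub_ne_zero.2 hq.symm)

end Conv

/-! ### `L^p` bounds for averages -/

section Minkowski

variable {α Q : Type*} [MeasurableSpace α] [MeasurableSpace Q] {μ : Measure α} {ν : Measure Q}

lemma rpow_lintegral_mul_le {p : ℝ} (hp : 1 ≤ p) {k g : Q → ENNReal} (hk : AEMeasurable k ν)
    (hg : AEMeasurable g ν) :
    (∫⁻ q, k q * g q ∂ν) ^ p ≤ (∫⁻ q, k q ∂ν) ^ (p - 1) * ∫⁻ q, k q * g q ^ p ∂ν := by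
  have hp0 : 0 < p := by linarith
  have h := ENNReal.lintegral_mul_norm_pow_le (μ := ν) (f := k) (g := fun q => k q * g q ^ p)
    hk (hk.mul (hg.pow_const p)) (p := 1 - 1 / p) (q := 1 / p)
    (by rw [sub_nonneg, div_le_one hp0]; exact hp) (by positivity) (by ring)
  have he : ∀ q, k q ^ (1 - 1 / p) * (k q * g q ^ p) ^ (1 / p) = k q * g q := by
    intro q
    rw [ENNReal.mul_rpow_of_nonneg _ _ (by positivity), ← ENNReal.rpow_mul,
      mul_one_div_cancel hp0.ne', ENNReal.rpow_one, ← mul_assoc]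
    congr 1
    rw [← ENNReal.rpow_add_of_nonneg _ _ (by rw [sub_nonneg, div_le_one hp0]; exact hp)
      (by positivity), sub_add_cancel, ENNReal.rpow_one]
  simp_rw [he] at h
  calc (∫⁻ q, k q * g q ∂ν) ^ p
      ≤ ((∫⁻ q, k q ∂ν) ^ (1 - 1 / p) * (∫⁻ q, k q * g q ^ p ∂ν) ^ (1 / p)) ^ p := by gcongr
    _ = _ := by
      rw [ENNReal.mul_rpow_of_nonneg _ _ hp0.le, ← ENNReal.rpow_mul, ← ENNReal.rpow_mul,
        one_div_mul_cancel hp0.ne', ENNReal.rpow_one]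
      congr 2; field_simp

/-- Minkowski's integral inequality: an average `∫ k(q) g(q,·) dν(q)` has `L^p` norm at most
`‖k‖₁ sup_q ‖g(q,·)‖_p`. -/
lemma eLpNorm_integral_kernel_le [SFinite μ] [SFinite ν] {p : ℝ} (hp : 1 ≤ p) {k : Q → ℝ}
    {g : α → Q → ℝ}
    (hk : Measurable k) (hg : Measurable (Function.uncurry g)) {D : ENNReal}
    (hD : ∀ q, k q ≠ 0 → eLpNorm (fun x => g x q) (ENNReal.ofReal p) μ ≤ D) :
    eLpNorm (fun x => ∫ q, k q * g x q ∂ν) (ENNReal.ofReal p) μ ≤ (∫⁻ q, ‖k q‖ₑ ∂ν) * D := by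
  have hp0 : 0 < p := by linarith
  have hpe : ENNReal.ofReal p ≠ 0 := by simpa using hp0
  have hpt : ENNReal.ofReal p ≠ ⊤ := ENNReal.ofReal_ne_top
  have htr : (ENNReal.ofReal p).toReal = p := ENNReal.toReal_ofReal hp0.le
  rw [eLpNorm_eq_lintegral_rpow_enorm_toReal hpe hpt, htr]
  rw [one_div, ENNReal.rpow_inv_le_iff hp0]
  have hpt1 : ∀ x, ‖∫ q, k q * g x q ∂ν‖ₑ ^ p
      ≤ (∫⁻ q, ‖k q‖ₑ ∂ν) ^ (p - 1) * ∫⁻ q, ‖k q‖ₑ * ‖g x q‖ₑ ^ p ∂ν := by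
    intro x
    have hgx : Measurable (g x) := hg.comp measurable_prodMk_left
    refine le_trans ?_ (rpow_lintegral_mul_le hp hk.enorm.aemeasurable hgx.enorm.aemeasurable)
    gcongr
    refine (enorm_integral_le_lintegral_enorm _).trans_eq ?_
    simp_rw [enorm_mul]
  have hDp : ∀ q, k q ≠ 0 → ∫⁻ x, ‖g x q‖ₑ ^ p ∂μ ≤ D ^ p := by
    intro q hq
    have := hD q hq
    rw [eLpNorm_eq_lintegral_rpow_enorm_toReal hpe hpt, htr] at this
    calc _ = ((∫⁻ x, ‖g x q‖ₑ ^ p ∂μ) ^ (1 / p)) ^ p := by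
          rw [← ENNReal.rpow_mul, one_div_mul_cancel hp0.ne', ENNReal.rpow_one]
      _ ≤ _ := by gcongr
  have hm : Measurable fun r : α × Q => ‖k r.2‖ₑ * ‖g r.1 r.2‖ₑ ^ p :=
    (hk.comp measurable_snd).enorm.mul (hg.enorm.pow_const p)
  calc ∫⁻ x, ‖∫ q, k q * g x q ∂ν‖ₑ ^ p ∂μ
      ≤ ∫⁻ x, (∫⁻ q, ‖k q‖ₑ ∂ν) ^ (p - 1) * ∫⁻ q, ‖k q‖ₑ * ‖g x q‖ₑ ^ p ∂ν ∂μ :=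
        lintegral_mono hpt1
    _ = (∫⁻ q, ‖k q‖ₑ ∂ν) ^ (p - 1) * ∫⁻ x, ∫⁻ q, ‖k q‖ₑ * ‖g x q‖ₑ ^ p ∂ν ∂μ := by
        rw [lintegral_const_mul]; exact hm.lintegral_prod_right'
    _ = (∫⁻ q, ‖k q‖ₑ ∂ν) ^ (p - 1) * ∫⁻ q, ∫⁻ x, ‖k q‖ₑ * ‖g x q‖ₑ ^ p ∂μ ∂ν := by
        rw [lintegral_lintegral_swap hm.aemeasurable]
    _ ≤ (∫⁻ q, ‖k q‖ₑ ∂ν) ^ (p - 1) * ∫⁻ q, ‖k q‖ₑ * D ^ p ∂ν := by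
        gcongr with q
        have hgq : Measurable fun x => g x q := hg.comp measurable_prodMk_right
        rw [lintegral_const_mul _ (hgq.enorm.pow_const p)]
        by_cases hq : k q = 0
        · simp [hq]
        · gcongr; exact hDp q hq
    _ = ((∫⁻ q, ‖k q‖ₑ ∂ν) * D) ^ p := by
        rw [lintegral_mul_const _ hk.enorm, ENNReal.mul_rpow_of_nonneg _ _ hp0.le, ← mul_assoc]
        congr 1
        nth_rewrite 2 [← ENNReal.rpow_one (∫⁻ q, ‖k q‖ₑ ∂ν)]
        rw [← ENNReal.rpow_add_of_nonneg _ _ (by linarith) zero_le_one, sub_add_cancel]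

end Minkowski

/-! ### Time derivatives of the Duhamel integral -/

section Scaling

/-- The anisotropic dilation `(z,r) ↦ (z,tr)` of space-time. -/
noncomputable def dilateSnd {t : ℝ} (ht : t ≠ 0) : ℝ × ℝ ≃ᵐ ℝ × ℝ :=
  (MeasurableEquiv.refl ℝ).prodCongr (MeasurableEquiv.mulLeft₀ t ht)

lemma dilateSnd_apply {t : ℝ} (ht : t ≠ 0) (q : ℝ × ℝ) : dilateSnd ht q = (q.1, t * q.2) := rfl

lemma map_dilateSnd {t : ℝ} (ht : t ≠ 0) :
    Measure.map (dilateSnd ht) (volume : Measure (ℝ × ℝ))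
      = ENNReal.ofReal |t⁻¹| • (volume : Measure (ℝ × ℝ)) := by
  have h : (dilateSnd ht : ℝ × ℝ → ℝ × ℝ) = Prod.map id (fun x => t * x) := rfl
  rw [h, Measure.volume_eq_prod, ← Measure.map_prod_map _ _ measurable_id (by fun_prop),
    Measure.map_id, Real.map_volume_mul_left ht, Measure.prod_smul_right]

lemma integral_comp_dilate {t : ℝ} (ht : 0 < t) (F : ℝ × ℝ → ℝ) :
    t * ∫ q : ℝ × ℝ, F (q.1, t * q.2) = ∫ q, F q := by
  have h := integral_map_equiv (μ := (volume : Measure (ℝ × ℝ))) (dilateSnd ht.ne') F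
  rw [map_dilateSnd, integral_smul_measure, ENNReal.toReal_ofReal (abs_nonneg _),
    abs_of_pos (inv_pos.2 ht)] at h
  simp_rw [dilateSnd_apply] at h
  rw [← h, smul_eq_mul, mul_inv_cancel_left₀ ht.ne']

lemma integrable_comp_dilate {t : ℝ} (ht : 0 < t) {F : ℝ × ℝ → ℝ} (hF : Integrable F) :
    Integrable fun q : ℝ × ℝ => F (q.1, t * q.2) := by
  have h := integrable_map_equiv (μ := (volume : Measure (ℝ × ℝ))) (dilateSnd ht.ne') F
  rw [map_dilateSnd] at h
  exact h.1 (hF.smul_measure ENNReal.ofReal_ne_top)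

lemma kernelConv_eq_dilate (k f : ℝ → ℝ → ℝ) (x : ℝ) {t : ℝ} (ht : 0 < t) :
    kernelConv k f x t = t * ∫ q : ℝ × ℝ, k q.1 (t * q.2) * f (x - q.1) (t - t * q.2) := by
  rw [integral_comp_dilate ht fun q : ℝ × ℝ => k q.1 q.2 * f (x - q.1) (t - q.2)]
  rfl

lemma kernelMajorant_le {τ σ : ℝ} (hτ : 0 < τ) (h1 : τ ≤ σ) (h2 : σ ≤ 4 * τ) (z : ℝ) :
    kernelMajorant z τ ≤ 4 * kernelMajorant z σ := by
  have hσ : 0 < σ := hτ.trans_le h1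
  unfold kernelMajorant heatKernel
  have hs : ∀ c : ℝ, 0 < c → (√(c * τ))⁻¹ ≤ 2 * (√(c * σ))⁻¹ := by
    intro c hc
    have : √(c * σ) ≤ 2 * √(c * τ) := by
      rw [Real.sqrt_le_left (by positivity), mul_pow, Real.sq_sqrt (by positivity)]
      nlinarith
    have h3 : 0 < √(c * τ) := Real.sqrt_pos.2 (by positivity)
    have h4 : 0 < √(c * σ) := Real.sqrt_pos.2 (by positivity)
    rw [← div_eq_mul_inv, le_div_iff₀ h4, inv_mul_le_iff₀ h3]
    linarith
  have ha := hs 1 one_pos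
  have hb := hs (4 * Real.pi * 2) (by positivity)
  simp only [one_mul] at ha
  rw [← mul_assoc (4 * Real.pi) 2 τ, ← mul_assoc (4 * Real.pi) 2 σ]
  have he : Real.exp (-z ^ 2 / (4 * (2 * τ))) ≤ Real.exp (-z ^ 2 / (4 * (2 * σ))) := by
    apply Real.exp_le_exp.2
    rw [neg_div, neg_div, neg_le_neg_iff]
    gcongr
  calc _ ≤ (2 * (√σ)⁻¹) * ((2 * (√(4 * Real.pi * 2 * σ))⁻¹)
        * Real.exp (-z ^ 2 / (4 * (2 * σ)))) := by gcongr
    _ = _ := by ring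

end Scaling

section NearPart

variable {lam M N T : ℝ} {f f' : ℝ → ℝ → ℝ}

/-- If the source is differentiable in time, with `s ∂_s f(y,s)` bounded, so is its Duhamel
integral: in the dilated variable `r = τ/t` the time derivative can be taken under the integral
sign, and it produces `t ∂_t V = ∂_z G ** f + (τ ∂_τ ∂_z G) ** f + ∂_z G ** (s ∂_s f)`. -/
lemma hasDerivAt_kernelConv_near (hl : 0 < lam) (hf : IsCausal f) (hf' : IsCausal f')
    (hd : ∀ y s, 0 < s → s < T → HasDerivAt (f y) (f' y s) s)
    (hM : ∀ y s, s < T → |f y s| ≤ M * Real.exp (lam * s))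
    (hN : ∀ y s, s < T → |s * f' y s| ≤ N * Real.exp (lam * s)) (x : ℝ) {t : ℝ}
    (ht : 0 < t) (htT : t < T) :
    HasDerivAt (kernelConv heatKernelX f x)
      (t⁻¹ * (kernelConv heatKernelX f x t + kernelConv (fun z τ => τ * heatKernelXT z τ) f x t
        + kernelConv heatKernelX (fun y s => s * f' y s) x t)) t := by
  have hM0 : 0 ≤ M := by
    have := (abs_nonneg _).trans (hM 0 t htT)
    exact le_of_mul_le_mul_right (by simpa using this) (Real.exp_pos (lam * t))
  have hN0 : 0 ≤ N := by
    have := (abs_nonneg _).trans (hN 0 t htT)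
    exact le_of_mul_le_mul_right (by simpa using this) (Real.exp_pos (lam * t))
  have hg : Measurable fun q : ℝ × ℝ => q.2 * f' q.1 q.2 := measurable_snd.mul hf'.measurable
  obtain ⟨hK, -⟩ := isCausalKernel_heatKernelX hl
  obtain ⟨hK', -⟩ := isCausalKernel_mul_heatKernelXT hl
  set A : ℝ → ℝ × ℝ → ℝ := fun s q => heatKernelX q.1 (s * q.2) * f (x - q.1) (s - s * q.2)
    with hA
  set A' : ℝ → ℝ × ℝ → ℝ := fun s q =>
    q.2 * heatKernelXT q.1 (s * q.2) * f (x - q.1) (s - s * q.2)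
      + heatKernelX q.1 (s * q.2) * ((1 - q.2) * f' (x - q.1) (s - s * q.2)) with hA'
  have hmA : ∀ s, Measurable (A s) := fun s =>
    (measurable_heatKernelX.comp
      (by fun_prop : Measurable fun q : ℝ × ℝ => ((q.1, s * q.2) : ℝ × ℝ))).mul
    (hf.measurable.comp
      (by fun_prop : Measurable fun q : ℝ × ℝ => ((x - q.1, s - s * q.2) : ℝ × ℝ)))
  have hmA' : ∀ s, Measurable (A' s) := fun s =>
    ((measurable_snd.mul (measurable_heatKernelXT.comp
      (by fun_prop : Measurable fun q : ℝ × ℝ => ((q.1, s * q.2) : ℝ × ℝ)))).mul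
    (hf.measurable.comp
      (by fun_prop : Measurable fun q : ℝ × ℝ => ((x - q.1, s - s * q.2) : ℝ × ℝ)))).add
    ((measurable_heatKernelX.comp
      (by fun_prop : Measurable fun q : ℝ × ℝ => ((q.1, s * q.2) : ℝ × ℝ))).mul
    ((measurable_const.sub measurable_snd).mul (hf'.measurable.comp
      (by fun_prop : Measurable fun q : ℝ × ℝ => ((x - q.1, s - s * q.2) : ℝ × ℝ)))))
  have hAint : Integrable (A t) := by
    have := integrable_conv hK hf.measurable x (t := t) fun y s hs => hM y s (hs.trans htT)
    exact integrable_comp_dilate ht this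
  set bd : ℝ × ℝ → ℝ := fun q => 2 / t * ((16 * M + 2 * N) * Real.exp (lam * T)) * 4
    * Real.exp (lam * (2 * t)) * (Real.exp (-lam * (2 * t * q.2)) * kernelMajorant q.1 (2 * t * q.2))
    with hbd
  have hbdint : Integrable bd :=
    (integrable_comp_dilate (by positivity : 0 < 2 * t)
      (integrable_exp_mul_kernelMajorant hl).1).const_mul _
  have hbd0 : ∀ q, 0 ≤ bd q := fun q =>
    mul_nonneg (by positivity) (mul_nonneg (Real.exp_pos _).le (kernelMajorant_nonneg _ _))
  have hS : Ioo (t / 2) (min T (2 * t)) ∈ 𝓝 t :=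
    Ioo_mem_nhds (by linarith) (lt_min htT (by linarith))
  have hbound : ∀ q, ∀ s ∈ Ioo (t / 2) (min T (2 * t)), ‖A' s q‖ ≤ bd q := by
    rintro q s ⟨hs1, hs2⟩
    have hsT := hs2.trans_le (min_le_left _ _)
    have hs2t := hs2.trans_le (min_le_right _ _)
    have hs : 0 < s := by linarith
    rcases le_or_gt q.2 0 with hq | hq
    · have h0 : s * q.2 ≤ 0 := mul_nonpos_of_nonneg_of_nonpos hs.le hq
      have : A' s q = 0 := by simp [hA', heatKernelX_of_nonpos h0, heatKernelXT_of_nonpos h0]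
      rw [this, norm_zero]; exact hbd0 q
    rcases le_or_gt 1 q.2 with hq1 | hq1
    · have h0 : s - s * q.2 ≤ 0 := by nlinarith
      have : A' s q = 0 := by simp [hA', hf.causal _ _ h0, hf'.causal _ _ h0]
      rw [this, norm_zero]; exact hbd0 q
    have hsq : 0 < s * q.2 := by positivity
    have hlt : s - s * q.2 < T := by linarith
    have e1 : Real.exp (lam * (s - s * q.2)) ≤ Real.exp (lam * T) := by gcongr
    have h1 : |f (x - q.1) (s - s * q.2)| ≤ M * Real.exp (lam * T) :=
      (hM _ _ hlt).trans (by gcongr)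
    have h2 : |(s - s * q.2) * f' (x - q.1) (s - s * q.2)| ≤ N * Real.exp (lam * T) :=
      (hN _ _ hlt).trans (by gcongr)
    have h3 := abs_mul_heatKernelXT_le q.1 (s * q.2)
    have h4 := abs_heatKernelX_le q.1 (s * q.2)
    have hk := kernelMajorant_nonneg q.1 (s * q.2)
    have h5 : kernelMajorant q.1 (s * q.2) ≤ 4 * kernelMajorant q.1 (2 * t * q.2) :=
      kernelMajorant_le hsq (by nlinarith) (by nlinarith) _
    have h6 : 1 ≤ Real.exp (lam * (2 * t)) * Real.exp (-lam * (2 * t * q.2)) := by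
      rw [← Real.exp_add]; apply Real.one_le_exp
      have : 0 < lam * (2 * t) * (1 - q.2) := mul_pos (by positivity) (by linarith)
      nlinarith
    have hsA : s * A' s q = s * q.2 * heatKernelXT q.1 (s * q.2) * f (x - q.1) (s - s * q.2)
      + heatKernelX q.1 (s * q.2) * ((s - s * q.2) * f' (x - q.1) (s - s * q.2)) := by
      simp only [hA']; ring
    have h7 : |s * A' s q| ≤ (16 * M + 2 * N) * Real.exp (lam * T)
        * kernelMajorant q.1 (s * q.2) := by
      rw [hsA]
      refine (abs_add_le _ _).trans ?_
      rw [abs_mul, abs_mul (heatKernelX _ _)]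
      calc _ ≤ 16 * kernelMajorant q.1 (s * q.2) * (M * Real.exp (lam * T))
            + 2 * kernelMajorant q.1 (s * q.2) * (N * Real.exp (lam * T)) := by gcongr
        _ = _ := by ring
    rw [abs_mul, abs_of_pos hs] at h7
    rw [Real.norm_eq_abs]
    have h8 : |A' s q| ≤ 2 / t * ((16 * M + 2 * N) * Real.exp (lam * T)
        * kernelMajorant q.1 (s * q.2)) := by
      have : |A' s q| * (t / 2) ≤ (16 * M + 2 * N) * Real.exp (lam * T)
        * kernelMajorant q.1 (s * q.2) := by
        refine le_trans ?_ h7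
        rw [mul_comm]; gcongr
      rw [div_mul_eq_mul_div, le_div_iff₀ ht]; linarith
    refine h8.trans ?_
    have hk2 := kernelMajorant_nonneg q.1 (2 * t * q.2)
    calc _ ≤ 2 / t * ((16 * M + 2 * N) * Real.exp (lam * T)
        * (4 * kernelMajorant q.1 (2 * t * q.2))) := by gcongr
      _ = 2 / t * ((16 * M + 2 * N) * Real.exp (lam * T)) * 4
          * (1 * kernelMajorant q.1 (2 * t * q.2)) := by ring
      _ ≤ 2 / t * ((16 * M + 2 * N) * Real.exp (lam * T)) * 4
          * (Real.exp (lam * (2 * t)) * Real.exp (-lam * (2 * t * q.2))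
            * kernelMajorant q.1 (2 * t * q.2)) := by gcongr
      _ = _ := by simp only [hbd]; ring
  have hderiv : ∀ q, ∀ s ∈ Ioo (t / 2) (min T (2 * t)),
      HasDerivAt (fun s => A s q) (A' s q) s := by
    rintro q s ⟨hs1, hs2⟩
    have hsT := hs2.trans_le (min_le_left _ _)
    have hs : 0 < s := by linarith
    rcases le_or_gt q.2 0 with hq | hq
    · have h0 : ∀ s, 0 < s → s * q.2 ≤ 0 := fun s hs => mul_nonpos_of_nonneg_of_nonpos hs.le hq
      have : A' s q = 0 := by
        simp [hA', heatKernelX_of_nonpos (h0 s hs), heatKernelXT_of_nonpos (h0 s hs)]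
      rw [this]
      refine (hasDerivAt_const s (0 : ℝ)).congr_of_eventuallyEq ?_
      filter_upwards [Ioi_mem_nhds hs] with s' hs'
      simp [hA, heatKernelX_of_nonpos (h0 s' hs')]
    rcases le_or_gt 1 q.2 with hq1 | hq1
    · have h0 : ∀ s, 0 < s → s - s * q.2 ≤ 0 := fun s hs => by nlinarith
      have : A' s q = 0 := by simp [hA', hf.causal _ _ (h0 s hs), hf'.causal _ _ (h0 s hs)]
      rw [this]
      refine (hasDerivAt_const s (0 : ℝ)).congr_of_eventuallyEq ?_
      filter_upwards [Ioi_mem_nhds hs] with s' hs'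
      simp [hA, hf.causal _ _ (h0 s' hs')]
    have hsq : 0 < s * q.2 := by positivity
    have h1 : HasDerivAt (fun s => s * q.2) q.2 s := by simpa using (hasDerivAt_id s).mul_const q.2
    have h2 : HasDerivAt (fun s => s - s * q.2) (1 - q.2) s := (hasDerivAt_id s).sub h1
    have h3 := (hasDerivAt_heatKernelX_t_of_pos q.1 hsq).comp s h1
    have h4 := (hd (x - q.1) (s - s * q.2) (by nlinarith) (by linarith)).comp s h2
    refine (h3.mul h4).congr_deriv ?_
    simp only [hA', Function.comp_def]; ring
  obtain ⟨hA'int, hmain⟩ := hasDerivAt_integral_of_dominated_loc_of_deriv_le hS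
    (Eventually.of_forall fun s => (hmA s).aestronglyMeasurable) hAint
    (hmA' t).aestronglyMeasurable (Eventually.of_forall hbound) hbdint
    (Eventually.of_forall hderiv)
  have hV : kernelConv heatKernelX f x =ᶠ[𝓝 t] fun s => s * ∫ q, A s q := by
    filter_upwards [Ioi_mem_nhds ht] with s hs using kernelConv_eq_dilate _ _ x hs
  refine (((hasDerivAt_id t).mul hmain).congr_of_eventuallyEq hV).congr_deriv ?_
  have hM' : ∀ y s, s < t → |f y s| ≤ M * Real.exp (lam * s) := fun y s hs => hM y s (hs.trans htT)
  have hN' : ∀ y s, s < t → |s * f' y s| ≤ N * Real.exp (lam * s) :=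
    fun y s hs => hN y s (hs.trans htT)
  have hsum : t * (t * ∫ q, A' t q) = kernelConv (fun z τ => τ * heatKernelXT z τ) f x t
        + kernelConv heatKernelX (fun y s => s * f' y s) x t := by
    unfold kernelConv
    rw [← integral_add (integrable_conv hK' hf.measurable x hM') (integrable_conv hK hg x hN'),
      ← integral_comp_dilate ht fun a : ℝ × ℝ =>
        a.2 * heatKernelXT a.1 a.2 * f (x - a.1) (t - a.2)
          + heatKernelX a.1 a.2 * ((t - a.2) * f' (x - a.1) (t - a.2)), ← integral_const_mul]
    refine congrArg (t * ·) (integral_congr_ae (Eventually.of_forall fun q => ?_))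
    simp only [hA']; ring
  have hV' : kernelConv heatKernelX f x t = t * ∫ q, A t q := kernelConv_eq_dilate _ f x ht
  rw [add_assoc, ← hsum, hV', ← mul_add, inv_mul_cancel_left₀ ht.ne', id, one_mul]

end NearPart

section FarPart

variable {lam M : ℝ} {f : ℝ → ℝ → ℝ}

/-- The kernel `∂_t ∂_z G` cut off to `|z| ≥ ρ`, where it is integrable. -/
noncomputable def farKernel (ρ z t : ℝ) : ℝ := if ρ ≤ |z| then heatKernelXT z t else 0

/-- An integrable profile dominating `z⁻⁴` on `|z| ≥ ρ`. -/
noncomputable def farProfile (ρ z : ℝ) : ℝ := 2304 * ρ⁻¹ ^ 4 * (1 + (z / ρ) ^ 2)⁻¹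

lemma integrable_farProfile {ρ : ℝ} (hρ : 0 < ρ) : Integrable (farProfile ρ) :=
  (integrable_inv_one_add_sq.comp_div hρ.ne').const_mul _

lemma farProfile_nonneg (ρ z : ℝ) : 0 ≤ farProfile ρ z := by
  unfold farProfile
  have : 0 ≤ ρ⁻¹ ^ 4 := by positivity
  positivity

lemma integral_farProfile {ρ : ℝ} (hρ : 0 < ρ) :
    ∫ z, farProfile ρ z = 2304 * Real.pi * ρ⁻¹ ^ 3 := by
  unfold farProfile
  rw [integral_const_mul, Measure.integral_comp_div (fun w : ℝ => (1 + w ^ 2)⁻¹),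
    integral_univ_inv_one_add_sq, abs_of_pos hρ, smul_eq_mul]
  field_simp

lemma abs_heatKernelXT_le_farProfile {ρ z : ℝ} (hρ : 0 < ρ) (hz : ρ ≤ |z|) (t : ℝ) :
    |heatKernelXT z t| ≤ farProfile ρ z := by
  have h := pow_four_mul_abs_heatKernelXT_le z t
  have hz2 : ρ ^ 2 ≤ z ^ 2 := by rw [← sq_abs z]; gcongr
  have hz4 : 0 < z ^ 4 := by
    have : 0 < z ^ 2 := lt_of_lt_of_le (by positivity) hz2
    nlinarith
  have h1 : |heatKernelXT z t| ≤ 576 / z ^ 4 := by rw [le_div_iff₀ hz4]; linarith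
  refine h1.trans ?_
  have e : farProfile ρ z = 2304 / (ρ ^ 2 * (ρ ^ 2 + z ^ 2)) := by
    unfold farProfile; field_simp
  rw [e, div_le_div_iff₀ hz4 (by positivity)]
  have h3 : ρ ^ 2 * ρ ^ 2 ≤ z ^ 2 * z ^ 2 := by gcongr
  have h4 : ρ ^ 2 * z ^ 2 ≤ z ^ 2 * z ^ 2 := by gcongr
  nlinarith

lemma measurable_farKernel (ρ : ℝ) : Measurable fun q : ℝ × ℝ => farKernel ρ q.1 q.2 :=
  Measurable.ite (measurableSet_le measurable_const (by fun_prop)) measurable_heatKernelXT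
    measurable_const

lemma abs_farKernel_le {ρ : ℝ} (hρ : 0 < ρ) (z t : ℝ) :
    |farKernel ρ z t| ≤ farProfile ρ z := by
  unfold farKernel
  split_ifs with h
  · exact abs_heatKernelXT_le_farProfile hρ h t
  · simpa using farProfile_nonneg ρ z

lemma isCausalKernel_farKernel (hl : 0 < lam) {ρ : ℝ} (hρ : 0 < ρ) :
    IsCausalKernel lam (farKernel ρ) ∧
      kernelNorm lam (farKernel ρ) ≤ 2304 * Real.pi * ρ⁻¹ ^ 3
        * ∫ s : ℝ, (Ioi (0 : ℝ)).indicator (fun s => Real.exp (-lam * s)) s := by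
  have hcausal : ∀ z t, t ≤ 0 → farKernel ρ z t = 0 := fun z t ht => by
    simp [farKernel, heatKernelXT_of_nonpos ht]
  have hexp : Integrable fun s : ℝ => (Ioi (0 : ℝ)).indicator (fun s => Real.exp (-lam * s)) s := by
    rw [integrable_indicator_iff measurableSet_Ioi]
    exact integrableOn_exp_mul_Ioi (by linarith) 0
  have hI : Integrable fun q : ℝ × ℝ => farProfile ρ q.1
      * (Ioi (0 : ℝ)).indicator (fun s => Real.exp (-lam * s)) q.2 :=
    (integrable_farProfile hρ).mul_prod hexp
  have hle : ∀ q : ℝ × ℝ, |Real.exp (-lam * q.2) * farKernel ρ q.1 q.2| ≤ farProfile ρ q.1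
      * (Ioi (0 : ℝ)).indicator (fun s => Real.exp (-lam * s)) q.2 := by
    intro q
    by_cases hq : 0 < q.2
    · rw [indicator_of_mem (mem_Ioi.2 hq), abs_mul, abs_of_pos (Real.exp_pos _), mul_comm]
      gcongr
      exact abs_farKernel_le hρ _ _
    · rw [hcausal _ _ (not_lt.1 hq)]; simp [hq]
  have hm : Measurable fun q : ℝ × ℝ => Real.exp (-lam * q.2) * farKernel ρ q.1 q.2 :=
    (by fun_prop : Measurable fun q : ℝ × ℝ => Real.exp (-lam * q.2)).mul (measurable_farKernel ρ)
  have hint := hI.mono' hm.aestronglyMeasurable (Eventually.of_forall hle)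
  refine ⟨⟨measurable_farKernel ρ, hcausal, hint⟩, ?_⟩
  rw [← integral_farProfile hρ, ← integral_prod_mul, ← Measure.volume_eq_prod]
  exact integral_mono hint.abs hI hle

lemma kernelConv_heatKernelXT_eq_far {x₀ ρ ρ' x : ℝ} (hf : ∀ y s, |y - x₀| < ρ → f y s = 0)
    (hx : |x - x₀| + ρ' ≤ ρ) (t : ℝ) :
    kernelConv heatKernelXT f x t = kernelConv (farKernel ρ') f x t := by
  unfold kernelConv
  congr 1; ext q
  unfold farKernel
  split_ifs with h
  · rfl
  · rw [hf (x - q.1) _ ?_, mul_zero, mul_zero]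
    have := abs_sub (x - x₀) q.1
    rw [show x - q.1 - x₀ = x - x₀ - q.1 by ring]
    linarith

/-- If the source vanishes for `|y - x₀| < ρ`, its Duhamel integral is differentiable in time
near `x₀` without any regularity of the source, the kernel being smooth off its singularity. -/
lemma hasDerivAt_kernelConv_far (hl : 0 < lam) (hf : IsCausal f) {x₀ ρ x : ℝ} (hρ : 0 < ρ)
    (hf0 : ∀ y s, |y - x₀| < ρ → f y s = 0)
    (hM : ∀ y s, |f y s| ≤ M * Real.exp (lam * s)) (hx : |x - x₀| ≤ ρ / 2) (t : ℝ) :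
    HasDerivAt (kernelConv heatKernelX f x) (kernelConv heatKernelXT f x t) t := by
  have hM0 : 0 ≤ M := by
    have := (abs_nonneg _).trans (hM 0 0); simpa using this
  obtain ⟨hK, -⟩ := isCausalKernel_heatKernelX hl
  have hfun : kernelConv heatKernelX f x
      = fun t => ∫ q : ℝ × ℝ, heatKernelX (x - q.1) (t - q.2) * f q.1 q.2 := by
    ext t; exact kernelConv_eq_integral_sub _ _ _ _
  rw [hfun, kernelConv_eq_integral_sub]
  have hmeas : ∀ k : ℝ → ℝ → ℝ, Measurable (fun q : ℝ × ℝ => k q.1 q.2) → ∀ t,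
      Measurable fun q : ℝ × ℝ => k (x - q.1) (t - q.2) * f q.1 q.2 := fun k hk t =>
    (hk.comp (by fun_prop : Measurable fun q : ℝ × ℝ => ((x - q.1, t - q.2) : ℝ × ℝ))).mul
      hf.measurable
  have hint : Integrable fun q : ℝ × ℝ => heatKernelX (x - q.1) (t - q.2) * f q.1 q.2 := by
    have h := (integrable_conv hK hf.measurable x (t := t) fun y s _ => hM y s).comp_sub_left
      ((x, t) : ℝ × ℝ)
    simpa using h
  set bd : ℝ × ℝ → ℝ := fun q => M * Real.exp (lam * (t + 1)) *
    (farProfile (ρ / 2) (x - q.1) * (Ioo 0 (t + 1)).indicator 1 q.2) with hbd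
  have hbdint : Integrable bd := by
    refine Integrable.const_mul ?_ _
    refine ((integrable_farProfile (by positivity : 0 < ρ / 2)).comp_sub_left x).mul_prod
      (f := fun y => farProfile (ρ / 2) (x - y)) ?_
    rw [integrable_indicator_iff measurableSet_Ioo]
    exact integrableOn_const (by simp)
  have hfar : ∀ q : ℝ × ℝ, f q.1 q.2 ≠ 0 → ρ / 2 ≤ |x - q.1| := by
    intro q hq
    by_contra! h
    refine hq (hf0 _ _ ?_)
    have := abs_sub_le q.1 x x₀
    rw [abs_sub_comm q.1 x] at this
    linarith
  refine (hasDerivAt_integral_of_dominated_loc_of_deriv_le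
    (F := fun t (q : ℝ × ℝ) => heatKernelX (x - q.1) (t - q.2) * f q.1 q.2)
    (F' := fun t (q : ℝ × ℝ) => heatKernelXT (x - q.1) (t - q.2) * f q.1 q.2)
    (bound := bd)
    (Iio_mem_nhds (lt_add_one t))
    (Eventually.of_forall fun s => (hmeas _ measurable_heatKernelX s).aestronglyMeasurable) hint
    (hmeas _ measurable_heatKernelXT t).aestronglyMeasurable ?_ hbdint ?_).2
  · refine Eventually.of_forall fun q s hs => ?_
    have hfp := farProfile_nonneg (ρ / 2) (x - q.1)
    have hb0 : 0 ≤ bd q := by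
      refine mul_nonneg (by positivity) (mul_nonneg hfp ?_)
      exact indicator_nonneg (fun _ _ => zero_le_one) _
    by_cases hq : f q.1 q.2 = 0
    · simpa [hq] using hb0
    rcases le_or_gt (s - q.2) 0 with h | h
    · simpa [heatKernelXT_of_nonpos h] using hb0
    have hq2 : 0 < q.2 := by
      by_contra! h'; exact hq (hf.causal _ _ h')
    have hq2' : q.2 < t + 1 := by have := mem_Iio.1 hs; linarith
    have h1 := abs_heatKernelXT_le_farProfile (by positivity : 0 < ρ / 2) (hfar q hq) (s - q.2)
    have h2 : |f q.1 q.2| ≤ M * Real.exp (lam * (t + 1)) := (hM _ _).trans (by gcongr)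
    rw [norm_mul, Real.norm_eq_abs, Real.norm_eq_abs]
    simp only [hbd, indicator_of_mem (mem_Ioo.2 ⟨hq2, hq2'⟩), Pi.one_apply, mul_one]
    rw [mul_comm]
    gcongr
  · refine Eventually.of_forall fun q s hs => ?_
    by_cases hq : f q.1 q.2 = 0
    · simpa [hq] using hasDerivAt_const s (0 : ℝ)
    have hne : x - q.1 ≠ 0 := by
      have := hfar q hq
      intro h; rw [h, abs_zero] at this; linarith
    have h1 : HasDerivAt (fun s => s - q.2) 1 s := (hasDerivAt_id s).sub_const _
    have h2 := ((hasDerivAt_heatKernelX_t hne (s - q.2)).comp s h1).mul_const (f q.1 q.2)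
    simpa using h2

end FarPart

section LocalStep

/-- Regularity in time on the rectangle `(-R,R) × (0,T)`: the function is continuously
differentiable in time there, with a bound on `s ∂_s f(y,s)` that may blow up cubically at the
lateral boundary. The power `3` matches the size `ρ⁻³` of the far part of the Duhamel integral. -/
structure TimeRegular (lam R T N : ℝ) (f : ℝ → ℝ → ℝ) : Prop where
  differentiableAt : ∀ y ∈ Ioo (-R) R, ∀ s ∈ Ioo 0 T, DifferentiableAt ℝ (f y) s
  continuousOn : ContinuousOn (fun r : ℝ × ℝ => deriv (f r.1) r.2) (Ioo (-R) R ×ˢ Ioo 0 T)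
  bound : ∀ y ∈ Ioo (-R) R, ∀ s ∈ Ioo 0 T,
    (R - |y|) ^ 3 * |s * deriv (f y) s| ≤ N * Real.exp (lam * s)

lemma continuousAt_ite_ball {f : ℝ → ℝ → ℝ} {x₀ ρ y s : ℝ} (h : |y - x₀| ≠ ρ)
    (hc : |y - x₀| < ρ → ContinuousAt (fun r : ℝ × ℝ => f r.1 r.2) (y, s)) :
    ContinuousAt (fun r : ℝ × ℝ => if |r.1 - x₀| < ρ then f r.1 r.2 else 0) (y, s) := by
  have hcont : ContinuousAt (fun r : ℝ × ℝ => |r.1 - x₀|) (y, s) := by fun_prop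
  rcases lt_or_gt_of_ne h with h | h
  · refine (hc h).congr ?_
    filter_upwards [hcont.eventually_lt_const h] with r hr
    rw [if_pos hr]
  · refine (continuousAt_const (y := (0 : ℝ))).congr ?_
    filter_upwards [hcont.eventually_const_lt h] with r hr
    rw [if_neg (not_lt.2 hr.le)]

/-- One step of the local time-regularity estimate for the Duhamel integral. Only the constant in
front of `N`, which does not involve the size of the rectangle, has to be small. -/
lemma TimeRegular.duhamel_step {lam R T : ℝ} (hl : 0 < lam) (hT : 0 < T) :
    ∃ C : ℝ, 0 ≤ C ∧ ∀ (f : ℝ → ℝ → ℝ) (M N : ℝ), IsCausal f →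
      ContinuousOn (fun r : ℝ × ℝ => f r.1 r.2) {r | 0 < r.2} →
      (∀ y s, |f y s| ≤ M * Real.exp (lam * s)) → 0 ≤ N → TimeRegular lam R T N f →
      TimeRegular lam R T (C * M + 16 * √(Real.pi / lam) * N) (kernelConv heatKernelX f) := by
  set I : ℝ := ∫ s : ℝ, (Ioi (0 : ℝ)).indicator (fun s => Real.exp (-lam * s)) s with hI
  have hI0 : 0 ≤ I := integral_nonneg fun s => indicator_nonneg (fun _ _ => (Real.exp_pos _).le) s
  set S : ℝ := √(Real.pi / lam) with hS
  have hS0 : 0 ≤ S := by positivity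
  refine ⟨18 * S * |R| ^ 3 + T * (2304 * Real.pi * 8 * I), by positivity, ?_⟩
  intro f M N hf hfc hM hN0 hreg
  have hM0 : 0 ≤ M := by
    have := (abs_nonneg _).trans (hM 0 0); simpa using this
  obtain ⟨hK, hKn⟩ := isCausalKernel_heatKernelX hl
  obtain ⟨hK', hKn'⟩ := isCausalKernel_mul_heatKernelXT hl
  have key : ∀ x₀ ∈ Ioo (-R) R, ∀ t₀ ∈ Ioo 0 T,
      DifferentiableAt ℝ (kernelConv heatKernelX f x₀) t₀ ∧
      ContinuousAt (fun r : ℝ × ℝ => deriv (kernelConv heatKernelX f r.1) r.2) (x₀, t₀) ∧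
      (R - |x₀|) ^ 3 * |t₀ * deriv (kernelConv heatKernelX f x₀) t₀| ≤
        ((18 * S * |R| ^ 3 + T * (2304 * Real.pi * 8 * I)) * M + 16 * S * N)
          * Real.exp (lam * t₀) := by
    intro x₀ hx₀ t₀ ht₀
    have hR : |x₀| < R := abs_lt.2 hx₀
    obtain ⟨d, hd⟩ : ∃ d, d = R - |x₀| := ⟨_, rfl⟩
    have hd0 : 0 < d := by linarith
    have hρ : 0 < d / 2 := by positivity
    set h : ℝ → ℝ → ℝ := fun y s => if 0 < s ∧ s < T then deriv (f y) s else 0 with hh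
    set f1 : ℝ → ℝ → ℝ := fun y s => if |y - x₀| < d / 2 then f y s else 0 with hf1
    set f1' : ℝ → ℝ → ℝ := fun y s => if |y - x₀| < d / 2 then h y s else 0 with hf1'
    set f2 : ℝ → ℝ → ℝ := fun y s => f y s - f1 y s with hf2
    have hball : MeasurableSet {r : ℝ × ℝ | |r.1 - x₀| < d / 2} :=
      measurableSet_lt (by fun_prop) measurable_const
    have hsub : ∀ y, |y - x₀| < d / 2 → y ∈ Ioo (-R) R ∧ d / 2 ≤ R - |y| := by
      intro y hy
      have : |y| - |x₀| ≤ |y - x₀| := abs_sub_abs_le_abs_sub _ _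
      have h3 : |y| < R := by linarith
      exact ⟨abs_lt.1 h3, by linarith⟩
    have hc1 : IsCausal f1 :=
      ⟨Measurable.ite hball hf.measurable measurable_const, fun y s hs => by
        simp [hf1, hf.causal y s hs]⟩
    have hc2 : IsCausal f2 :=
      ⟨hf.measurable.sub hc1.measurable, fun y s hs => by
        simp [hf2, hf.causal y s hs, hc1.causal y s hs]⟩
    have hc1' : IsCausal f1' := by
      refine ⟨?_, fun y s hs => by simp [hf1', hh, not_lt.2 hs]⟩
      have hset : MeasurableSet (Ioo (-R) R ×ˢ Ioo 0 T : Set (ℝ × ℝ)) :=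
        measurableSet_Ioo.prod measurableSet_Ioo
      classical
      have hm := hreg.continuousOn.measurable_piecewise (continuousOn_const (c := (0 : ℝ))) hset
      have : (fun q : ℝ × ℝ => f1' q.1 q.2)
          = fun q : ℝ × ℝ => if |q.1 - x₀| < d / 2 then (Ioo (-R) R ×ˢ Ioo 0 T).piecewise
            (fun r : ℝ × ℝ => deriv (f r.1) r.2) (fun _ => 0) q else 0 := by
        ext q
        simp only [hf1', hh]
        split_ifs with h1 h2
        · rw [piecewise_eq_of_mem]
          exact ⟨(hsub _ h1).1, h2⟩
        · rw [piecewise_eq_of_notMem]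
          exact fun hmem => h2 hmem.2
        · rfl
      rw [this]
      exact Measurable.ite hball hm measurable_const
    have hM1 : ∀ y s, |f1 y s| ≤ M * Real.exp (lam * s) := by
      intro y s; simp only [hf1]; split_ifs
      · exact hM y s
      · rw [abs_zero]; positivity
    have hM2 : ∀ y s, |f2 y s| ≤ M * Real.exp (lam * s) := by
      intro y s; simp only [hf2, hf1]; split_ifs
      · rw [sub_self, abs_zero]; positivity
      · rw [sub_zero]; exact hM y s
    have hf20 : ∀ y s, |y - x₀| < d / 2 → f2 y s = 0 := by
      intro y s hy; simp [hf2, hf1, hy]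
    have hd1 : ∀ y s, 0 < s → s < T → HasDerivAt (f1 y) (f1' y s) s := by
      intro y s hs hsT
      by_cases hy : |y - x₀| < d / 2
      · have e1 : f1 y = f y := by ext s; simp [hf1, hy]
        have e2 : f1' y s = deriv (f y) s := by simp [hf1', hh, hy, hs, hsT]
        rw [e1, e2]
        exact (hreg.differentiableAt y (hsub y hy).1 s ⟨hs, hsT⟩).hasDerivAt
      · have e1 : f1 y = fun _ => 0 := by ext s; simp [hf1, hy]
        have e2 : f1' y s = 0 := by simp [hf1', hy]
        rw [e1, e2]; exact hasDerivAt_const _ _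
    have hN1 : ∀ y s, s < T → |s * f1' y s| ≤ 8 * N / d ^ 3 * Real.exp (lam * s) := by
      intro y s hsT
      by_cases hy : |y - x₀| < d / 2 ∧ 0 < s
      · have e2 : f1' y s = deriv (f y) s := by simp [hf1', hh, hy, hsT]
        obtain ⟨hm, hle⟩ := hsub y hy.1
        have h3 := hreg.bound y hm s ⟨hy.2, hsT⟩
        rw [e2, div_mul_eq_mul_div, le_div_iff₀ (by positivity)]
        have h4 : (d / 2) ^ 3 ≤ (R - |y|) ^ 3 := by gcongr
        have h5 := mul_le_mul_of_nonneg_right h4 (abs_nonneg (s * deriv (f y) s))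
        nlinarith
      · have e2 : s * f1' y s = 0 := by
          simp only [hf1', hh]
          split_ifs with h1 h2
          · exact absurd ⟨h1, h2.1⟩ hy
          · simp
          · simp
        rw [e2, abs_zero]; positivity
    have hderiv : ∀ x t, |x - x₀| ≤ d / 4 → 0 < t → t < T →
        HasDerivAt (kernelConv heatKernelX f x)
          (t⁻¹ * (kernelConv heatKernelX f1 x t
            + kernelConv (fun z τ => τ * heatKernelXT z τ) f1 x t
            + kernelConv heatKernelX (fun y s => s * f1' y s) x t)
            + kernelConv heatKernelXT f2 x t) t := by
      intro x t hx ht htT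
      have h1 := hasDerivAt_kernelConv_near hl hc1 hc1' hd1 (fun y s _ => hM1 y s) hN1 x ht htT
      have h2 := hasDerivAt_kernelConv_far hl hc2 hρ hf20 hM2 (x := x) (by linarith) t
      refine (h1.add h2).congr_of_eventuallyEq (Eventually.of_forall fun s => ?_)
      simp only [Pi.add_apply]
      unfold kernelConv
      rw [← integral_add (integrable_conv hK hc1.measurable x fun y s _ => hM1 y s)
        (integrable_conv hK hc2.measurable x fun y s _ => hM2 y s)]
      congr 1; ext q
      simp only [hf2]; ring
    have hD := hderiv x₀ t₀ (by simp; linarith) ht₀.1 ht₀.2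
    refine ⟨hD.differentiableAt, ?_, ?_⟩
    · have hae : ∀ᵐ q : ℝ × ℝ, |x₀ - q.1 - x₀| ≠ d / 2 ∧ q.2 ≠ t₀ := by
        filter_upwards [ae_fst_ne (d / 2), ae_fst_ne (-(d / 2)), ae_snd_ne t₀] with q h1 h2 h3
        refine ⟨fun h4 => ?_, h3⟩
        rw [show x₀ - q.1 - x₀ = -q.1 by ring, abs_neg] at h4
        rcases abs_eq (by positivity : 0 ≤ d / 2) |>.1 h4 with h | h
        · exact h1 h
        · exact h2 h
      have hcf1 : ∀ᵐ q : ℝ × ℝ, 0 < q.2 →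
          ContinuousAt (fun r : ℝ × ℝ => f1 r.1 r.2) (x₀ - q.1, t₀ - q.2) := by
        filter_upwards [hae] with q hq _
        exact continuousAt_ite_ball hq.1 fun _ => hf.continuousAt hfc (sub_ne_zero.2 hq.2.symm)
      have hcf2 : ∀ᵐ q : ℝ × ℝ, 0 < q.2 →
          ContinuousAt (fun r : ℝ × ℝ => f2 r.1 r.2) (x₀ - q.1, t₀ - q.2) := by
        filter_upwards [hae, hcf1] with q hq hq1 hq2
        exact (hf.continuousAt hfc (sub_ne_zero.2 hq.2.symm)).sub (hq1 hq2)
      have hcg1 : ∀ᵐ q : ℝ × ℝ, 0 < q.2 →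
          ContinuousAt (fun r : ℝ × ℝ => r.2 * f1' r.1 r.2) (x₀ - q.1, t₀ - q.2) := by
        filter_upwards [hae] with q hq hq2
        refine continuousAt_snd.mul (continuousAt_ite_ball hq.1 fun hlt => ?_)
        have hcs : ContinuousAt (fun r : ℝ × ℝ => r.2) (x₀ - q.1, t₀ - q.2) := continuousAt_snd
        rcases lt_or_gt_of_ne (sub_ne_zero.2 hq.2.symm) with h0 | h0
        · refine (continuousAt_const (y := (0 : ℝ))).congr ?_
          filter_upwards [hcs.eventually_lt_const h0] with r hr
          simp [hh, not_lt.2 hr.le]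
        · have hlt' : t₀ - q.2 < T := by linarith [ht₀.2]
          have hmem : Ioo (-R) R ×ˢ Ioo 0 T ∈ 𝓝 ((x₀ - q.1, t₀ - q.2) : ℝ × ℝ) :=
            (isOpen_Ioo.prod isOpen_Ioo).mem_nhds ⟨(hsub _ hlt).1, h0, hlt'⟩
          refine (hreg.continuousOn.continuousAt hmem).congr ?_
          filter_upwards [hcs.eventually_lt_const hlt', hcs.eventually_const_lt h0] with r h5 h6
          simp [hh, h5, h6]
      obtain ⟨hF, -⟩ := isCausalKernel_farKernel hl (ρ := d / 4) (by positivity)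
      have hg1 : Measurable fun q : ℝ × ℝ => q.2 * f1' q.1 q.2 :=
        measurable_snd.mul hc1'.measurable
      have k1 := continuousAt_kernelConv hK hc1.measurable hl.le ht₀.2 (fun y s _ => hM1 y s) hcf1
      have k2 := continuousAt_kernelConv hK' hc1.measurable hl.le ht₀.2 (fun y s _ => hM1 y s) hcf1
      have k3 := continuousAt_kernelConv (f := fun y s => s * f1' y s) hK hg1 hl.le ht₀.2 hN1 hcg1
      have k4 := continuousAt_kernelConv hF hc2.measurable hl.le ht₀.2 (fun y s _ => hM2 y s) hcf2
      have hinv : ContinuousAt (fun r : ℝ × ℝ => r.2⁻¹) (x₀, t₀) :=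
        continuousAt_snd.inv₀ ht₀.1.ne'
      refine ((hinv.mul ((k1.add k2).add k3)).add k4).congr ?_
      have e1 : ∀ᶠ r : ℝ × ℝ in 𝓝 (x₀, t₀), |r.1 - x₀| < d / 4 := by
        have : ContinuousAt (fun r : ℝ × ℝ => |r.1 - x₀|) (x₀, t₀) := by fun_prop
        exact this.eventually_lt_const (by simp; linarith)
      have hcs : ContinuousAt (fun r : ℝ × ℝ => r.2) (x₀, t₀) := continuousAt_snd
      filter_upwards [e1, hcs.eventually_lt_const ht₀.2, hcs.eventually_const_lt ht₀.1]
        with r h1 h2 h3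
      rw [(hderiv r.1 r.2 h1.le h3 h2).deriv,
        kernelConv_heatKernelXT_eq_far (ρ' := d / 4) hf20 (by linarith)]
      rfl
    · rw [hD.deriv]
      obtain ⟨hF, hFn⟩ := isCausalKernel_farKernel hl hρ
      have b1 := abs_kernelConv_le hK x₀ (t := t₀) fun y s _ => hM1 y s
      have b2 := abs_kernelConv_le hK' x₀ (t := t₀) fun y s _ => hM1 y s
      have b3 := abs_kernelConv_le (f := fun y s => s * f1' y s) hK x₀ (t := t₀)
        fun y s hs => hN1 y s (hs.trans ht₀.2)
      have b4 := abs_kernelConv_le hF x₀ (t := t₀) fun y s _ => hM2 y s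
      rw [kernelConv_heatKernelXT_eq_far (ρ' := d / 2) hf20 (by simp)]
      set E := Real.exp (lam * t₀) with hE
      have hE0 : 0 < E := Real.exp_pos _
      have hdR : d ≤ |R| := by rw [hd]; linarith [abs_nonneg x₀, le_abs_self R]
      rw [← hd, mul_add, mul_inv_cancel_left₀ ht₀.1.ne']
      have c1 := b1.trans (mul_le_mul_of_nonneg_left hKn (by positivity))
      have c2 := b2.trans (mul_le_mul_of_nonneg_left hKn' (by positivity))
      have c3 := b3.trans (mul_le_mul_of_nonneg_left hKn (by positivity))
      have c4 := b4.trans (mul_le_mul_of_nonneg_left hFn (by positivity))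
      have c5 : |t₀ * kernelConv (farKernel (d / 2)) f2 x₀ t₀|
          ≤ T * (M * E * (2304 * Real.pi * (d / 2)⁻¹ ^ 3 * I)) := by
        rw [abs_mul, abs_of_pos ht₀.1]
        have := ht₀.2.le
        gcongr
      calc _ ≤ d ^ 3 * (M * E * (2 * S) + M * E * (16 * S) + 8 * N / d ^ 3 * E * (2 * S)
            + T * (M * E * (2304 * Real.pi * (d / 2)⁻¹ ^ 3 * I))) := by
            gcongr
            refine (abs_add_le _ _).trans (add_le_add ((abs_add_le _ _).trans
              (add_le_add ((abs_add_le _ _).trans (add_le_add c1 c2)) c3)) c5)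
        _ = (18 * S * d ^ 3 + T * (2304 * Real.pi * 8 * I)) * M * E + 16 * S * N * E := by
            field_simp; ring
        _ ≤ (18 * S * |R| ^ 3 + T * (2304 * Real.pi * 8 * I)) * M * E + 16 * S * N * E := by
            gcongr
        _ = _ := by ring
  exact ⟨fun y hy s hs => (key y hy s hs).1,
    fun r hr => (key r.1 hr.1 r.2 hr.2).2.1.continuousWithinAt,
    fun y hy s hs => (key y hy s hs).2.2⟩

end LocalStep

/-! ### Space derivatives of the Duhamel integral -/

section KernelPrimitive

/-- The primitive `H(s) = ∫₀ˢ G(w,1) dw` of the normalized Gaussian. -/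
noncomputable def gaussPrimitive (s : ℝ) : ℝ := ∫ w in (0 : ℝ)..s, heatKernel w 1

lemma hasDerivAt_gaussPrimitive (s : ℝ) : HasDerivAt gaussPrimitive (heatKernel s 1) s := by
  have hc : Continuous fun w => heatKernel w 1 :=
    continuous_iff_continuousAt.2 fun w => (hasDerivAt_heatKernel_x w 1).continuousAt
  exact hc.integral_hasStrictDerivAt 0 s |>.hasDerivAt

lemma heatKernel_div_sqrt (z : ℝ) {t : ℝ} (ht : 0 < t) :
    heatKernel (z / √t) 1 = √t * heatKernel z t := by
  have hs : 0 < √t := Real.sqrt_pos.2 ht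
  unfold heatKernel
  rw [Real.sqrt_mul (by positivity) t, div_pow, Real.sq_sqrt ht.le, mul_one, mul_one, mul_inv]
  have : -(z ^ 2 / t) / 4 = -z ^ 2 / (4 * t) := by field_simp
  rw [this]; field_simp

lemma hasDerivAt_gaussPrimitive_x (z : ℝ) {t : ℝ} (ht : 0 < t) :
    HasDerivAt (fun z => gaussPrimitive (z / √t)) (heatKernel z t) z := by
  have hs : 0 < √t := Real.sqrt_pos.2 ht
  refine ((hasDerivAt_gaussPrimitive _).comp z ((hasDerivAt_id z).div_const (√t))).congr_deriv ?_
  simp only [id]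
  rw [heatKernel_div_sqrt z ht]; field_simp

lemma hasDerivAt_gaussPrimitive_t (z : ℝ) {t : ℝ} (ht : 0 < t) :
    HasDerivAt (fun t => gaussPrimitive (z / √t)) (heatKernelX z t) t := by
  have hs : 0 < √t := Real.sqrt_pos.2 ht
  have h := (hasDerivAt_const t z).div ((hasDerivAt_id t).sqrt ht.ne') hs.ne'
  refine ((hasDerivAt_gaussPrimitive _).comp t h).congr_deriv ?_
  simp only [id, Pi.div_apply]
  rw [heatKernel_div_sqrt z ht, Real.sq_sqrt ht.le]
  unfold heatKernelX
  field_simp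
  ring

lemma exists_tendsto_gaussPrimitive :
    ∃ A B : ℝ, A - B = 1 ∧ Tendsto gaussPrimitive atTop (𝓝 A) ∧
      Tendsto gaussPrimitive atBot (𝓝 B) := by
  have hI := integrable_heatKernel 1
  refine ⟨∫ w in Ioi 0, heatKernel w 1, -∫ w in Iic 0, heatKernel w 1, ?_, ?_, ?_⟩
  · rw [sub_neg_eq_add, add_comm, intervalIntegral.integral_Iic_add_Ioi hI.integrableOn
      hI.integrableOn, integral_heatKernel one_pos]
  · exact intervalIntegral_tendsto_integral_Ioi 0 hI.integrableOn tendsto_id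
  · have := (intervalIntegral_tendsto_integral_Iic 0 hI.integrableOn tendsto_id).neg
    refine this.congr fun s => ?_
    unfold gaussPrimitive
    rw [intervalIntegral.integral_symm, id, neg_neg]

lemma continuous_heatKernelX_t {z : ℝ} (hz : z ≠ 0) : Continuous fun t => heatKernelX z t :=
  continuous_iff_continuousAt.2 fun t => (hasDerivAt_heatKernelX_t hz t).continuousAt

/-- The time integral of `∂_z G` is the space integral of `G` corrected by the jump at `z = 0`;
this is the heat equation `∂_t G = ∂_z² G + δ` integrated once in each variable. -/
lemma integral_heatKernelX_sub {z₀ z₁ t : ℝ} (h₀ : z₀ ≠ 0) (h₁ : z₁ ≠ 0) (h : z₀ < z₁)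
    (ht : 0 < t) :
    (∫ r in (0 : ℝ)..t, heatKernelX z₁ r) - ∫ r in (0 : ℝ)..t, heatKernelX z₀ r
      = (∫ w in z₀..z₁, heatKernel w t) - if z₀ < 0 ∧ 0 < z₁ then 1 else 0 := by
  obtain ⟨A, B, hAB, hA, hB⟩ := exists_tendsto_gaussPrimitive
  have hlim : ∀ z : ℝ, z ≠ 0 → Tendsto (fun t => gaussPrimitive (z / √t)) (𝓝[>] 0)
      (𝓝 (if 0 < z then A else B)) := by
    intro z hz
    have hs : Tendsto (fun t : ℝ => (√t)⁻¹) (𝓝[>] 0) atTop := by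
      refine Tendsto.inv_tendsto_nhdsGT_zero ?_
      refine tendsto_nhdsWithin_iff.2 ⟨?_, ?_⟩
      · have := (Real.continuous_sqrt.tendsto 0).mono_left (nhdsWithin_le_nhds (s := Ioi 0))
        simpa using this
      · filter_upwards [self_mem_nhdsWithin] with t ht using Real.sqrt_pos.2 ht
    split_ifs with hz0
    · exact hA.comp (hs.const_mul_atTop hz0)
    · exact hB.comp (hs.const_mul_atTop_of_neg (lt_of_le_of_ne (not_lt.1 hz0) hz))
  have hJ : ∀ z : ℝ, z ≠ 0 → ∫ r in (0 : ℝ)..t, heatKernelX z r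
      = gaussPrimitive (z / √t) - if 0 < z then A else B := by
    intro z hz
    refine intervalIntegral.integral_eq_sub_of_hasDerivAt_of_tendsto ht
      (fun r hr => hasDerivAt_gaussPrimitive_t z hr.1)
      ((continuous_heatKernelX_t hz).intervalIntegrable _ _) (hlim z hz) ?_
    exact (hasDerivAt_gaussPrimitive_t z ht).continuousAt.tendsto.mono_left nhdsWithin_le_nhds
  have hG : ∫ w in z₀..z₁, heatKernel w t
      = gaussPrimitive (z₁ / √t) - gaussPrimitive (z₀ / √t) := by
    refine intervalIntegral.integral_eq_sub_of_hasDerivAt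
      (fun w _ => hasDerivAt_gaussPrimitive_x w ht) ?_
    exact (integrable_heatKernel t).intervalIntegrable
  rw [hJ z₁ h₁, hJ z₀ h₀, hG]
  rcases lt_or_gt_of_ne h₀ with a | a <;> rcases lt_or_gt_of_ne h₁ with b | b
  · simp [not_lt.2 b.le, not_lt.2 a.le]
  · simp only [a, b, not_lt.2 a.le, if_true, if_false, true_and]; linarith
  · linarith
  · simp [a, b, not_lt.2 a.le]

end KernelPrimitive

section Fubini

variable {lam M T : ℝ} {k F : ℝ → ℝ → ℝ}

lemma integrable_conv_prod {P : Type*} [MeasurableSpace P] (ν : Measure P) [IsFiniteMeasure ν]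
    (hl : 0 ≤ lam) (hk : IsCausalKernel lam k) (hF : IsCausal F)
    (hM : ∀ y s, |F y s| ≤ M * Real.exp (lam * s)) {c : P → ℝ × ℝ} (hc : Measurable c)
    (hcT : ∀ᵐ p ∂ν, (c p).2 ≤ T) :
    Integrable (fun r : P × (ℝ × ℝ) =>
      k ((c r.1).1 - r.2.1) ((c r.1).2 - r.2.2) * F r.2.1 r.2.2) (ν.prod volume) := by
  have hM0 : 0 ≤ M := by
    have := (abs_nonneg _).trans (hM 0 0); simpa using this
  have hm : Measurable fun r : P × (ℝ × ℝ) =>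
      k ((c r.1).1 - r.2.1) ((c r.1).2 - r.2.2) * F r.2.1 r.2.2 := by
    refine (hk.measurable.comp (?_ : Measurable fun r : P × (ℝ × ℝ) =>
      (((c r.1).1 - r.2.1, (c r.1).2 - r.2.2) : ℝ × ℝ))).mul
      (hF.measurable.comp measurable_snd)
    have := hc.comp (measurable_fst : Measurable (Prod.fst : P × (ℝ × ℝ) → P))
    exact (this.fst.sub measurable_snd.fst).prodMk (this.snd.sub measurable_snd.snd)
  have hconv : ∀ p, Integrable fun q : ℝ × ℝ =>
      k ((c p).1 - q.1) ((c p).2 - q.2) * F q.1 q.2 := by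
    intro p
    have h := (integrable_conv hk hF.measurable (c p).1 (t := (c p).2)
      fun y s _ => hM y s).comp_sub_left (((c p).1, (c p).2) : ℝ × ℝ)
    simpa using h
  rw [integrable_prod_iff hm.aestronglyMeasurable]
  refine ⟨Eventually.of_forall hconv, ?_⟩
  refine Integrable.mono' (g := fun _ => M * Real.exp (lam * T) * kernelNorm lam k)
    (integrable_const _) hm.norm.stronglyMeasurable.integral_prod_right'.aestronglyMeasurable ?_
  filter_upwards [hcT] with p hp
  rw [Real.norm_of_nonneg (integral_nonneg fun _ => norm_nonneg _)]
  have e : ∫ q : ℝ × ℝ, ‖k ((c p).1 - q.1) ((c p).2 - q.2) * F q.1 q.2‖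
      = ∫ q : ℝ × ℝ, ‖k q.1 q.2 * F ((c p).1 - q.1) ((c p).2 - q.2)‖ := by
    rw [← integral_sub_left_eq_self (fun q : ℝ × ℝ =>
      ‖k q.1 q.2 * F ((c p).1 - q.1) ((c p).2 - q.2)‖) volume (((c p).1, (c p).2) : ℝ × ℝ)]
    simp
  rw [e]
  unfold kernelNorm
  rw [← integral_const_mul]
  refine integral_mono (integrable_conv hk hF.measurable _ fun y s _ => hM y s).norm
    (hk.integrable.abs.const_mul _) fun q => ?_
  refine (abs_conv_integrand_le hk (fun y s _ => hM y s) q).trans ?_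
  gcongr

lemma integral_kernelConv {P : Type*} [MeasurableSpace P] (ν : Measure P) [IsFiniteMeasure ν]
    (hl : 0 ≤ lam) (hk : IsCausalKernel lam k) (hF : IsCausal F)
    (hM : ∀ y s, |F y s| ≤ M * Real.exp (lam * s)) {c : P → ℝ × ℝ} (hc : Measurable c)
    (hcT : ∀ᵐ p ∂ν, (c p).2 ≤ T) :
    Integrable (fun q : ℝ × ℝ => (∫ p, k ((c p).1 - q.1) ((c p).2 - q.2) ∂ν) * F q.1 q.2) ∧
    ∫ p, kernelConv k F (c p).1 (c p).2 ∂ν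
      = ∫ q : ℝ × ℝ, (∫ p, k ((c p).1 - q.1) ((c p).2 - q.2) ∂ν) * F q.1 q.2 := by
  have h := integrable_conv_prod ν hl hk hF hM hc hcT
  constructor
  · refine h.integral_prod_right.congr (Eventually.of_forall fun q => ?_)
    exact integral_mul_const (F q.1 q.2) fun p => k ((c p).1 - q.1) ((c p).2 - q.2)
  · simp_rw [kernelConv_eq_integral_sub]
    rw [integral_integral_swap h]
    simp_rw [integral_mul_const]

variable (hl : 0 < lam) (hF : IsCausal F) (hM : ∀ y s, |F y s| ≤ M * Real.exp (lam * s))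
include hl hF hM

/-- `∂_x (G ** F) = ∂_z G ** F`, integrated in `x`. -/
lemma integral_kernelConv_heatKernelX {a x : ℝ} (hax : a ≤ x) (t : ℝ) :
    ∫ y in a..x, kernelConv heatKernelX F y t
      = kernelConv heatKernel F x t - kernelConv heatKernel F a t := by
  obtain ⟨hK, -⟩ := isCausalKernel_heatKernelX hl
  have hG := isCausalKernel_heatKernel hl
  have h := (integral_kernelConv (volume.restrict (Ioc a x)) hl.le hK hF hM
    (c := fun y : ℝ => (y, t)) (by fun_prop) (Eventually.of_forall fun _ => le_refl t)).2
  rw [intervalIntegral.integral_of_le hax]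
  simp only at h
  have hint : ∀ y, Integrable fun q : ℝ × ℝ => heatKernel (y - q.1) (t - q.2) * F q.1 q.2 := by
    intro y
    have h := (integrable_conv hG hF.measurable y (t := t)
      fun y s _ => hM y s).comp_sub_left ((y, t) : ℝ × ℝ)
    simpa using h
  rw [h, kernelConv_eq_integral_sub, kernelConv_eq_integral_sub, ← integral_sub (hint x) (hint a)]
  refine integral_congr_ae (Eventually.of_forall fun q => ?_)
  simp only
  rw [← sub_mul, ← intervalIntegral.integral_of_le hax]
  congr 1
  have hd : ∀ y, HasDerivAt (fun y => heatKernel (y - q.1) (t - q.2))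
      (heatKernelX (y - q.1) (t - q.2)) y := fun y =>
    (hasDerivAt_heatKernel_x (y - q.1) (t - q.2)).comp_sub_const y q.1
  have hd' : ∀ y, HasDerivAt (fun y => heatKernelX (y - q.1) (t - q.2))
      (heatKernelT (y - q.1) (t - q.2)) y := fun y =>
    (hasDerivAt_heatKernelX_x (y - q.1) (t - q.2)).comp_sub_const y q.1
  exact intervalIntegral.integral_eq_sub_of_hasDerivAt (fun y _ => hd y)
    ((continuous_iff_continuousAt.2 fun y => (hd' y).continuousAt).intervalIntegrable _ _)

/-- The inhomogeneous heat equation `∂_x V = ∂_t (G ** F) - F` for `V = ∂_z G ** F`, integrated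
once in time and once in space. -/
lemma integral_kernelConv_heatKernel {a x t : ℝ} (hax : a < x) (ht : 0 < t) :
    (∫ r in (0 : ℝ)..t, kernelConv heatKernelX F x r)
        - ∫ r in (0 : ℝ)..t, kernelConv heatKernelX F a r
      = (∫ y in a..x, kernelConv heatKernel F y t) - ∫ s in (0 : ℝ)..t, ∫ y in a..x, F y s := by
  obtain ⟨hK, -⟩ := isCausalKernel_heatKernelX hl
  have hG := isCausalKernel_heatKernel hl
  have hM0 : 0 ≤ M := by
    have := (abs_nonneg _).trans (hM 0 0); simpa using this
  have hU : ∀ x, _ := fun x => integral_kernelConv (volume.restrict (Ioc 0 t)) hl.le hK hF hM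
    (c := fun r : ℝ => (x, r)) (by fun_prop) (T := t)
    ((ae_restrict_mem measurableSet_Ioc).mono fun r hr => hr.2)
  obtain ⟨iW, hW⟩ := integral_kernelConv (volume.restrict (Ioc a x)) hl.le hG hF hM
    (c := fun y : ℝ => (y, t)) (by fun_prop) (Eventually.of_forall fun _ => le_refl t)
  obtain ⟨i1, h1⟩ := hU x
  obtain ⟨i0, h0⟩ := hU a
  have iF : Integrable (fun q : ℝ × ℝ => F q.1 q.2)
      ((volume.restrict (Ioc a x)).prod (volume.restrict (Ioc 0 t))) := by
    refine Integrable.mono' (g := fun _ => M * Real.exp (lam * t)) (integrable_const _)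
      hF.measurable.aestronglyMeasurable ?_
    rw [Measure.prod_restrict]
    refine (ae_restrict_mem (measurableSet_Ioc.prod measurableSet_Ioc)).mono fun q hq => ?_
    refine (hM _ _).trans ?_
    have := hq.2.2
    gcongr
  have hFF : ∫ s in (0 : ℝ)..t, ∫ y in a..x, F y s
      = ∫ q : ℝ × ℝ, (Ioc a x ×ˢ Ioc 0 t).indicator (fun q => F q.1 q.2) q := by
    rw [integral_indicator (measurableSet_Ioc.prod measurableSet_Ioc), Measure.volume_eq_prod,
      ← Measure.prod_restrict, integral_prod_symm _ iF, intervalIntegral.integral_of_le ht.le]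
    simp_rw [intervalIntegral.integral_of_le hax.le]
  have iF' : Integrable fun q : ℝ × ℝ => (Ioc a x ×ˢ Ioc 0 t).indicator (fun q => F q.1 q.2) q := by
    rw [integrable_indicator_iff (measurableSet_Ioc.prod measurableSet_Ioc), IntegrableOn,
      Measure.volume_eq_prod, ← Measure.prod_restrict]
    exact iF
  simp only at h1 h0 hW i1 i0 iW
  rw [intervalIntegral.integral_of_le ht.le, intervalIntegral.integral_of_le ht.le,
    intervalIntegral.integral_of_le hax.le, hFF, h1, h0, hW, ← integral_sub i1 i0,
    ← integral_sub iW iF']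
  refine integral_congr_ae ?_
  filter_upwards [ae_fst_ne a, ae_fst_ne x, ae_snd_ne t] with q ha hx hqt
  rw [← intervalIntegral.integral_of_le ht.le, ← intervalIntegral.integral_of_le ht.le,
    ← intervalIntegral.integral_of_le hax.le]
  rcases le_or_gt q.2 0 with h | hq0
  · simp [hF.causal _ _ h, h]
  rcases lt_or_gt_of_ne hqt with hqt | hqt
  · have hz : ∀ z : ℝ, z ≠ 0 → ∫ r in (0 : ℝ)..t, heatKernelX z (r - q.2)
        = ∫ r in (0 : ℝ)..(t - q.2), heatKernelX z r := by
      intro z hz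
      rw [intervalIntegral.integral_comp_sub_right (fun r => heatKernelX z r), zero_sub,
        ← intervalIntegral.integral_add_adjacent_intervals
          ((continuous_heatKernelX_t hz).intervalIntegrable (-q.2) 0)
          ((continuous_heatKernelX_t hz).intervalIntegrable 0 (t - q.2))]
      rw [intervalIntegral.integral_congr (g := fun _ => (0 : ℝ)), intervalIntegral.integral_zero,
        zero_add]
      intro r hr
      rw [uIcc_of_le (by linarith)] at hr
      exact heatKernelX_of_nonpos hr.2 z
    rw [hz _ (sub_ne_zero.2 hx.symm), hz _ (sub_ne_zero.2 ha.symm),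
      intervalIntegral.integral_comp_sub_right (fun y => heatKernel y (t - q.2)), ← sub_mul,
      integral_heatKernelX_sub (sub_ne_zero.2 ha.symm) (sub_ne_zero.2 hx.symm) (by linarith)
        (by linarith), sub_mul]
    congr 1
    by_cases hmem : a < q.1 ∧ q.1 < x
    · rw [if_pos ⟨by linarith, by linarith⟩, indicator_of_mem, one_mul]
      exact ⟨⟨hmem.1, hmem.2.le⟩, hq0, hqt.le⟩
    · rw [if_neg (fun h => hmem ⟨by linarith, by linarith⟩), indicator_of_notMem, zero_mul]
      exact fun h => hmem ⟨h.1.1, lt_of_le_of_ne h.1.2 hx⟩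
  · have hz : ∀ z : ℝ, ∫ r in (0 : ℝ)..t, heatKernelX z (r - q.2) = 0 := by
      intro z
      rw [intervalIntegral.integral_congr (g := fun _ => (0 : ℝ)), intervalIntegral.integral_zero]
      intro r hr
      rw [uIcc_of_le ht.le] at hr
      exact heatKernelX_of_nonpos (by linarith [hr.2]) z
    rw [hz, hz, indicator_of_notMem (fun h => absurd h.2.2 (not_le.2 hqt))]
    simp [heatKernel_of_nonpos (by linarith : t - q.2 ≤ 0)]

end Fubini

section Parametric

variable {g g' : ℝ → ℝ → ℝ}

lemma continuousOn_integral_param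
    (hg : ContinuousOn (fun r : ℝ × ℝ => g r.1 r.2) {r | 0 < r.2}) (a : ℝ) :
    ContinuousOn (fun r : ℝ × ℝ => ∫ y in a..r.1, g y r.2) {r | 0 < r.2} := by
  rintro ⟨x₀, t₀⟩ (ht₀ : 0 < t₀)
  have hc : Continuous fun r : (ℝ × ℝ) × ℝ => g r.2 (max r.1.2 (t₀ / 2)) :=
    hg.comp_continuous (by fun_prop : Continuous fun r : (ℝ × ℝ) × ℝ =>
      ((r.2, max r.1.2 (t₀ / 2)) : ℝ × ℝ)) fun r =>
      (lt_max_of_lt_right (half_pos ht₀) : (0 : ℝ) < max r.1.2 (t₀ / 2))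
  have h := intervalIntegral.continuous_parametric_intervalIntegral_of_continuous
    (μ := volume) (a₀ := a)
    (f := fun (r : ℝ × ℝ) y => g y (max r.2 (t₀ / 2))) hc (continuous_fst (X := ℝ) (Y := ℝ))
  refine (h.continuousAt.congr ?_).continuousWithinAt
  have hcs : ContinuousAt (fun r : ℝ × ℝ => r.2) (x₀, t₀) := continuousAt_snd
  filter_upwards [hcs.eventually_const_lt (by simp; linarith : t₀ / 2 < (x₀, t₀).2)] with r hr
  simp only [max_eq_left hr.le]

lemma continuous_slice (hg : ContinuousOn (fun r : ℝ × ℝ => g r.1 r.2) {r | 0 < r.2}) {t : ℝ}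
    (ht : 0 < t) : Continuous fun y => g y t :=
  hg.comp_continuous (by fun_prop : Continuous fun y : ℝ => ((y, t) : ℝ × ℝ)) fun _ => ht

lemma hasDerivAt_integral_param
    (hg : ContinuousOn (fun r : ℝ × ℝ => g r.1 r.2) {r | 0 < r.2})
    (hg' : ContinuousOn (fun r : ℝ × ℝ => g' r.1 r.2) {r | 0 < r.2})
    (hd : ∀ y t, 0 < t → HasDerivAt (g y) (g' y t) t) (a x : ℝ) {t : ℝ} (ht : 0 < t) :
    HasDerivAt (fun t => ∫ y in a..x, g y t) (∫ y in a..x, g' y t) t := by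
  have hcomp : IsCompact (uIcc a x ×ˢ Icc (t / 2) (2 * t) : Set (ℝ × ℝ)) :=
    isCompact_uIcc.prod isCompact_Icc
  obtain ⟨C, hC⟩ := hcomp.exists_bound_of_continuousOn
    (hg'.mono fun r hr => lt_of_lt_of_le (by positivity : 0 < t / 2) hr.2.1)
  refine (intervalIntegral.hasDerivAt_integral_of_dominated_loc_of_deriv_le
    (F := fun t y => g y t) (F' := fun t y => g' y t) (bound := fun _ => C)
    (Icc_mem_nhds (by linarith : t / 2 < t) (by linarith : t < 2 * t)) ?_
    ((continuous_slice hg ht).intervalIntegrable _ _)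
    (continuous_slice hg' ht).aestronglyMeasurable ?_ intervalIntegrable_const ?_).2
  · filter_upwards [Ioi_mem_nhds ht] with s hs
    exact (continuous_slice hg hs).aestronglyMeasurable
  · exact Eventually.of_forall fun y hy s hs => hC (y, s) ⟨uIoc_subset_uIcc hy, hs⟩
  · exact Eventually.of_forall fun y _ s hs =>
      hd y s (lt_of_lt_of_le (by positivity : 0 < t / 2) hs.1)

end Parametric

section SpaceRegularity

variable {lam M : ℝ} {F Vt : ℝ → ℝ → ℝ}

/-- The time derivative of `G ** F` at the space point `a`, expressed through `V = ∂_z G ** F`,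
its time derivative and `F`. -/
noncomputable def potentialT (F Vt : ℝ → ℝ → ℝ) (a t : ℝ) : ℝ :=
  kernelConv heatKernelX F (a + 1) t - kernelConv heatKernelX F a t
    + (∫ y in a..(a + 1), F y t) - ∫ y in a..(a + 1), ∫ z in a..y, Vt z t

variable (hl : 0 < lam) (hF : IsCausal F)
  (hFc : ContinuousOn (fun r : ℝ × ℝ => F r.1 r.2) {r | 0 < r.2})
  (hM : ∀ y s, |F y s| ≤ M * Real.exp (lam * s))
  (hVt : ∀ x t, 0 < t → HasDerivAt (kernelConv heatKernelX F x) (Vt x t) t)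
  (hVtc : ContinuousOn (fun r : ℝ × ℝ => Vt r.1 r.2) {r | 0 < r.2})
include hl hF hFc hM hVt hVtc

/-- If the Duhamel integral `V = ∂_z G ** F` is continuously differentiable in time, it solves
`∂_x V = ∂_t (G ** F) - F`, where `∂_t (G ** F)` is a primitive of `∂_t V` in `x`. -/
lemma kernelConv_sub_eq {a x t : ℝ} (hax : a < x) (ht : 0 < t) :
    kernelConv heatKernelX F x t - kernelConv heatKernelX F a t
      = (x - a) * potentialT F Vt a t + (∫ y in a..x, ∫ z in a..y, Vt z t)
        - ∫ y in a..x, F y t := by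
  obtain ⟨hK, -⟩ := isCausalKernel_heatKernelX hl
  set V := kernelConv heatKernelX F with hV
  set W := kernelConv heatKernel F with hW
  have hVc : Continuous fun r : ℝ × ℝ => V r.1 r.2 := continuousOn_kernelConv hK hF hl.le hM hFc
  have hVx : ∀ s, Continuous fun y => V y s := fun s =>
    hVc.comp (by fun_prop : Continuous fun y : ℝ => ((y, s) : ℝ × ℝ))
  have hVs : ∀ y, Continuous fun s => V y s := fun y =>
    hVc.comp (by fun_prop : Continuous fun s : ℝ => ((y, s) : ℝ × ℝ))
  -- the identity to be differentiated in time
  have hid : ∀ x s, a < x → 0 < s → (∫ r in (0 : ℝ)..s, V x r) - (∫ r in (0 : ℝ)..s, V a r)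
      = (x - a) * W a s + (∫ y in a..x, ∫ z in a..y, V z s)
        - ∫ r in (0 : ℝ)..s, ∫ y in a..x, F y r := by
    intro x s hx hs
    rw [hV, integral_kernelConv_heatKernel hl hF hM hx hs, ← hV, ← hW]
    congr 1
    have e : ∀ y ∈ uIcc a x, W y s = W a s + ∫ z in a..y, V z s := by
      intro y hy
      rw [uIcc_of_le hx.le] at hy
      rw [hV, integral_kernelConv_heatKernelX hl hF hM hy.1 s]; ring
    rw [intervalIntegral.integral_congr e, intervalIntegral.integral_add
      intervalIntegrable_const ((continuous_iff_continuousAt.2 fun y =>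
        ((hVx s).integral_hasStrictDerivAt a y).hasDerivAt.continuousAt).intervalIntegrable _ _)]
    simp
  have hVn : ContinuousOn (fun r : ℝ × ℝ => V r.1 r.2) {r | 0 < r.2} := hVc.continuousOn
  have hUd : ∀ y, HasDerivAt (fun s => ∫ r in (0 : ℝ)..s, V y r) (V y t) t := fun y =>
    ((hVs y).integral_hasStrictDerivAt 0 t).hasDerivAt
  have hID : ∀ x, HasDerivAt (fun s => ∫ y in a..x, ∫ z in a..y, V z s)
      (∫ y in a..x, ∫ z in a..y, Vt z t) t := fun x =>
    hasDerivAt_integral_param (g := fun y s => ∫ z in a..y, V z s)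
      (g' := fun y s => ∫ z in a..y, Vt z s) (continuousOn_integral_param hVn a)
      (continuousOn_integral_param hVtc a)
      (fun y s hs => hasDerivAt_integral_param hVn hVtc hVt a y hs) a x ht
  have hFd : ∀ x, a < x → HasDerivAt (fun s => ∫ r in (0 : ℝ)..s, ∫ y in a..x, F y r)
      (∫ y in a..x, F y t) t := by
    intro x hx
    have hmeas : StronglyMeasurable fun r => ∫ y in a..x, F y r := by
      simp_rw [intervalIntegral.integral_of_le hx.le]
      have h2 : Measurable fun q : ℝ × ℝ => F q.2 q.1 := hF.measurable.comp measurable_swap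
      exact h2.stronglyMeasurable.integral_prod_right (ν := volume.restrict (Ioc a x))
    have hcont : ContinuousAt (fun r => ∫ y in a..x, F y r) t := by
      have h3 := (continuousOn_integral_param hFc a).continuousAt
        ((isOpen_lt continuous_const continuous_snd).mem_nhds (by exact ht) : _ ∈ 𝓝 (x, t))
      exact ContinuousAt.comp (f := fun r : ℝ => ((x, r) : ℝ × ℝ)) (x := t) h3 (by fun_prop)
    refine intervalIntegral.integral_hasDerivAt_right ?_ hmeas.stronglyMeasurableAtFilter hcont
    rw [intervalIntegrable_iff_integrableOn_Ioc_of_le ht.le]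
    refine Integrable.mono' (g := fun _ => M * Real.exp (lam * t) * |x - a|) (integrable_const _)
      hmeas.aestronglyMeasurable ?_
    refine (ae_restrict_mem measurableSet_Ioc).mono fun r hr => ?_
    refine intervalIntegral.norm_integral_le_of_norm_le_const fun y _ => (hM y r).trans ?_
    have hM0 : 0 ≤ M := by
      have := (abs_nonneg _).trans (hM 0 0); simpa using this
    have := hr.2
    gcongr
  have hWd : HasDerivAt (W a) (potentialT F Vt a t) t := by
    have h := (((hUd (a + 1)).sub (hUd a)).add (hFd (a + 1) (by linarith))).sub (hID (a + 1))
    refine h.congr_of_eventuallyEq ?_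
    filter_upwards [Ioi_mem_nhds ht] with s hs
    have := hid (a + 1) s (by linarith) hs
    simp only [Pi.sub_apply, Pi.add_apply]
    linarith
  have hL := (hUd x).sub (hUd a)
  have hR := (((hWd.const_mul (x - a)).add (hID x)).sub (hFd x hax))
  refine hL.unique (hR.congr_of_eventuallyEq ?_)
  filter_upwards [Ioi_mem_nhds ht] with s hs
  exact hid x s hax hs

lemma hasDerivAt_kernelConv_x {a x t : ℝ} (hax : a < x) (ht : 0 < t) :
    HasDerivAt (fun y => kernelConv heatKernelX F y t)
      (potentialT F Vt a t + (∫ z in a..x, Vt z t) - F x t) x := by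
  have h1 : Continuous fun y => ∫ z in a..y, Vt z t := continuous_iff_continuousAt.2 fun y =>
    ((continuous_slice hVtc ht).integral_hasStrictDerivAt a y).hasDerivAt.continuousAt
  have h2 := (h1.integral_hasStrictDerivAt a x).hasDerivAt
  have h3 := ((continuous_slice hFc ht).integral_hasStrictDerivAt a x).hasDerivAt
  have h4 : HasDerivAt (fun y => (y - a) * potentialT F Vt a t) (potentialT F Vt a t) x := by
    simpa using ((hasDerivAt_id x).sub_const a).mul_const (potentialT F Vt a t)
  refine (((h4.add h2).sub h3).const_add (kernelConv heatKernelX F a t)).congr_of_eventuallyEq ?_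
  filter_upwards [Ioi_mem_nhds hax] with y hy
  have := kernelConv_sub_eq hl hF hFc hM hVt hVtc hy ht
  simp only [Pi.sub_apply, Pi.add_apply]
  linarith

lemma continuousOn_deriv_kernelConv_x :
    ContinuousOn (fun r : ℝ × ℝ => deriv (fun y => kernelConv heatKernelX F y r.2) r.1)
      {r | 0 < r.2} := by
  rintro ⟨x₀, t₀⟩ (ht₀ : 0 < t₀)
  obtain ⟨hK, -⟩ := isCausalKernel_heatKernelX hl
  have hVc : Continuous fun r : ℝ × ℝ => kernelConv heatKernelX F r.1 r.2 :=
    continuousOn_kernelConv hK hF hl.le hM hFc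
  obtain ⟨a, ha⟩ : ∃ a, a < x₀ := ⟨x₀ - 1, by linarith⟩
  have hopen : {r : ℝ × ℝ | 0 < r.2} ∈ 𝓝 (x₀, t₀) :=
    (isOpen_lt continuous_const continuous_snd).mem_nhds ht₀
  have hopen' : ∀ x, {r : ℝ × ℝ | 0 < r.2} ∈ 𝓝 (x, t₀) := fun x =>
    (isOpen_lt continuous_const continuous_snd).mem_nhds ht₀
  have hpt : ∀ {g : ℝ → ℝ → ℝ}, ContinuousOn (fun r : ℝ × ℝ => g r.1 r.2) {r | 0 < r.2} → ∀ x,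
      ContinuousAt (fun r : ℝ × ℝ => g x r.2) (x₀, t₀) := by
    intro g hg x
    exact ContinuousAt.comp (g := fun r : ℝ × ℝ => g r.1 r.2)
      (f := fun r : ℝ × ℝ => ((x, r.2) : ℝ × ℝ)) (x := (x₀, t₀))
      (hg.continuousAt (hopen' x)) (by fun_prop)
  have hp : ContinuousAt (fun r : ℝ × ℝ => potentialT F Vt a r.2) (x₀, t₀) := by
    unfold potentialT
    refine ((((hpt hVc.continuousOn (a + 1)).sub (hpt hVc.continuousOn a)).add
      (hpt (g := fun x t => ∫ y in a..x, F y t) (continuousOn_integral_param hFc a) (a + 1))).sub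
      (hpt (g := fun x t => ∫ y in a..x, ∫ z in a..y, Vt z t) ?_ (a + 1)))
    exact continuousOn_integral_param (g := fun y t => ∫ z in a..y, Vt z t)
      (continuousOn_integral_param hVtc a) a
  have h := (hp.add ((continuousOn_integral_param hVtc a).continuousAt hopen)).sub
    (hFc.continuousAt hopen)
  refine (h.congr ?_).continuousWithinAt
  have hcf : ContinuousAt (fun r : ℝ × ℝ => r.1) (x₀, t₀) := continuousAt_fst
  filter_upwards [hopen, hcf.eventually_const_lt ha] with r hr1 hr2
  exact (hasDerivAt_kernelConv_x hl hF hFc hM hVt hVtc hr2 hr1).deriv.symm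

lemma hasDerivAt_deriv_kernelConv_x {x t Fx : ℝ} (ht : 0 < t)
    (hFx : HasDerivAt (fun y => F y t) Fx x) :
    HasDerivAt (deriv fun y => kernelConv heatKernelX F y t) (Vt x t - Fx) x := by
  obtain ⟨a, ha⟩ : ∃ a, a < x := ⟨x - 1, by linarith⟩
  have h1 := ((continuous_slice hVtc ht).integral_hasStrictDerivAt a x).hasDerivAt
  refine ((h1.const_add (potentialT F Vt a t)).sub hFx).congr_of_eventuallyEq ?_
  filter_upwards [Ioi_mem_nhds ha] with y hy
  exact (hasDerivAt_kernelConv_x hl hF hFc hM hVt hVtc hy ht).deriv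

end SpaceRegularity

/-! ### The heat semigroup on bounded functions -/

section GaussianKernels

/-- Kernels with Gaussian decay, uniformly on compact time intervals of `(0,∞)`. -/
structure IsGaussianKernel (k : ℝ → ℝ → ℝ) : Prop where
  continuousOn : ContinuousOn (fun q : ℝ × ℝ => k q.1 q.2) {q | 0 < q.2}
  bound : ∀ z t, 0 < t → |k z t| ≤ 4 * (1 + 1 / t) * heatKernel z (2 * t)

lemma heatKernel_eq_double (z : ℝ) {t a : ℝ} (ht : 0 < t) (hz : z ^ 2 = 4 * t * a ^ 2) :
    heatKernel z t = √2 * Real.exp (-(a ^ 2 / 2)) * heatKernel z (2 * t) := by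
  have h := heatKernel_eq_majorant z ht hz
  unfold kernelMajorant at h
  have hs : 0 < √t := Real.sqrt_pos.2 ht
  have : (√t)⁻¹ * heatKernel z t
      = (√t)⁻¹ * (√2 * Real.exp (-(a ^ 2 / 2)) * heatKernel z (2 * t)) := by rw [h]; ring
  exact mul_left_cancel₀ (inv_pos.2 hs).ne' this

lemma abs_mul_heatKernelT_le (z : ℝ) {t : ℝ} (ht : 0 < t) :
    |t * heatKernelT z t| ≤ 4 * heatKernel z (2 * t) := by
  obtain ⟨a, ha, hz, hz', -⟩ := exists_similarity z ht
  have hk := heatKernel_nonneg z (2 * t)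
  have e : t * heatKernelT z t = (a ^ 2 - 1 / 2) * heatKernel z t := by
    unfold heatKernelT; rw [hz]; field_simp
  rw [e, heatKernel_eq_double z ht hz, abs_mul, abs_mul, abs_of_nonneg hk,
    abs_of_pos (by positivity : 0 < √2 * Real.exp (-(a ^ 2 / 2))), ← mul_assoc]
  refine mul_le_mul_of_nonneg_right ?_ hk
  have h3 : √2 ≤ 2 := by rw [Real.sqrt_le_left (by norm_num)]; norm_num
  have h1 : |a ^ 2 - 1 / 2| ≤ 2 * Real.exp (a ^ 2 / 2) := by
    have := Real.add_one_le_exp (a ^ 2 / 2)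
    rw [abs_le]; constructor <;> nlinarith [sq_nonneg a]
  have h2 : |a ^ 2 - 1 / 2| * Real.exp (-(a ^ 2 / 2)) ≤ 2 := by
    rw [Real.exp_neg, ← div_eq_mul_inv, div_le_iff₀ (Real.exp_pos _)]; exact h1
  calc _ = √2 * (|a ^ 2 - 1 / 2| * Real.exp (-(a ^ 2 / 2))) := by ring
    _ ≤ 2 * 2 := by gcongr
    _ = 4 := by norm_num

lemma isGaussianKernel_heatKernel : IsGaussianKernel heatKernel := by
  refine ⟨continuousOn_heatKernel, fun z t ht => ?_⟩
  obtain ⟨a, ha, hz, hz', -⟩ := exists_similarity z ht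
  have hk := heatKernel_nonneg z (2 * t)
  rw [abs_of_nonneg (heatKernel_nonneg z t), heatKernel_eq_double z ht hz]
  refine mul_le_mul_of_nonneg_right ?_ hk
  have h3 : √2 ≤ 2 := by rw [Real.sqrt_le_left (by norm_num)]; norm_num
  have h4 : Real.exp (-(a ^ 2 / 2)) ≤ 1 := Real.exp_le_one_iff.2 (by nlinarith)
  have h5 : 0 < 1 / t := by positivity
  calc √2 * Real.exp (-(a ^ 2 / 2)) ≤ 2 * 1 := by gcongr
    _ ≤ 4 * (1 + 1 / t) := by linarith

lemma isGaussianKernel_heatKernelX : IsGaussianKernel heatKernelX := by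
  refine ⟨continuousOn_heatKernelX, fun z t ht => (abs_heatKernelX_le z t).trans ?_⟩
  unfold kernelMajorant
  rw [← mul_assoc]
  refine mul_le_mul_of_nonneg_right ?_ (heatKernel_nonneg _ _)
  have hs : 0 < √t := Real.sqrt_pos.2 ht
  have e : 1 / t = (√t)⁻¹ * (√t)⁻¹ := by
    rw [← mul_inv, Real.mul_self_sqrt ht.le, one_div]
  rw [e]
  nlinarith [sq_nonneg ((√t)⁻¹ - 1), inv_pos.2 hs]

lemma isGaussianKernel_heatKernelT : IsGaussianKernel heatKernelT := by
  refine ⟨continuousOn_heatKernelT, fun z t ht => ?_⟩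
  have h := abs_mul_heatKernelT_le z ht
  rw [abs_mul, abs_of_pos ht] at h
  have hk := heatKernel_nonneg z (2 * t)
  have : |heatKernelT z t| ≤ 1 / t * (4 * heatKernel z (2 * t)) := by
    rw [div_mul_eq_mul_div, one_mul, le_div_iff₀ ht]; linarith
  refine this.trans ?_
  nlinarith

lemma heatKernel_shift_le {t₀ t x x₀ : ℝ} (ht₀ : 0 < t₀) (h1 : t₀ / 2 ≤ t) (h2 : t ≤ 2 * t₀)
    (hx : |x - x₀| ≤ 1) (y : ℝ) :
    heatKernel (x - y) (2 * t)
      ≤ 3 * Real.exp (1 / (16 * t₀)) * heatKernel (x₀ - y) (8 * t₀) := by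
  have ht : 0 < t := by linarith
  unfold heatKernel
  have e1 : (√(4 * Real.pi * (2 * t)))⁻¹ ≤ 3 * (√(4 * Real.pi * (8 * t₀)))⁻¹ := by
    have hp := Real.pi_pos
    have : √(4 * Real.pi * (8 * t₀)) ≤ 3 * √(4 * Real.pi * (2 * t)) := by
      rw [Real.sqrt_le_left (by positivity), mul_pow, Real.sq_sqrt (by positivity)]
      nlinarith
    have h3 : 0 < √(4 * Real.pi * (8 * t₀)) := Real.sqrt_pos.2 (by positivity)
    have h4 : 0 < √(4 * Real.pi * (2 * t)) := Real.sqrt_pos.2 (by positivity)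
    rw [← div_eq_mul_inv, le_div_iff₀ h3, inv_mul_le_iff₀ h4]
    linarith
  have e2 : -(x - y) ^ 2 / (4 * (2 * t)) ≤ 1 / (16 * t₀) + -(x₀ - y) ^ 2 / (4 * (8 * t₀)) := by
    have a1 : (x - y) ^ 2 / (16 * t₀) ≤ (x - y) ^ 2 / (4 * (2 * t)) := by
      exact div_le_div_of_nonneg_left (sq_nonneg _) (by positivity) (by linarith)
    have a2 : (x₀ - y) ^ 2 / (4 * (8 * t₀)) ≤ 1 / (16 * t₀) + (x - y) ^ 2 / (16 * t₀) := by
      rw [← add_div, div_le_div_iff₀ (by positivity) (by positivity)]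
      have : (x - x₀) ^ 2 ≤ 1 := by rw [← sq_abs]; exact pow_le_one₀ (abs_nonneg _) hx
      have : (x₀ - y) ^ 2 ≤ 2 * (1 + (x - y) ^ 2) := by nlinarith [sq_nonneg (x - y + (x - x₀))]
      nlinarith
    rw [neg_div, neg_div]; linarith
  calc _ ≤ 3 * (√(4 * Real.pi * (8 * t₀)))⁻¹
        * Real.exp (1 / (16 * t₀) + -(x₀ - y) ^ 2 / (4 * (8 * t₀))) := by gcongr
    _ = _ := by rw [Real.exp_add]; ring

lemma IsGaussianKernel.exists_bound {k : ℝ → ℝ → ℝ} (hk : IsGaussianKernel k) {t₀ : ℝ}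
    (ht₀ : 0 < t₀) (x₀ : ℝ) : ∃ g : ℝ → ℝ, Integrable g ∧ ∀ x t y, |x - x₀| ≤ 1 → t₀ / 2 ≤ t →
      t ≤ 2 * t₀ → |k (x - y) t| ≤ g y := by
  refine ⟨fun y => 4 * (1 + 1 / (t₀ / 2)) * (3 * Real.exp (1 / (16 * t₀))
    * heatKernel (x₀ - y) (8 * t₀)), ?_, ?_⟩
  · exact (((integrable_heatKernel (8 * t₀)).comp_sub_left x₀).const_mul _).const_mul _
  · intro x t y hx h1 h2
    have ht : 0 < t := by linarith
    refine (hk.bound _ _ ht).trans ?_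
    have := heatKernel_nonneg (x - y) (2 * t)
    beta_reduce
    gcongr
    exact heatKernel_shift_le ht₀ h1 h2 hx y

/-- The function `(x,t) ↦ ∫ k(x-y,t) u₀(y) dy`; for `k` the heat kernel, the heat semigroup. -/
noncomputable def kernelInt (k : ℝ → ℝ → ℝ) (u₀ : ℝ → ℝ) (x t : ℝ) : ℝ :=
  ∫ y, k (x - y) t * u₀ y

variable {k k' : ℝ → ℝ → ℝ} {u₀ : ℝ → ℝ} {M : ℝ}

lemma IsGaussianKernel.measurable_slice (hk : IsGaussianKernel k) {t : ℝ} (ht : 0 < t) (x : ℝ) :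
    Measurable fun y => k (x - y) t := by
  have : Continuous fun y => k (x - y) t := hk.continuousOn.comp_continuous
    (by fun_prop : Continuous fun y : ℝ => ((x - y, t) : ℝ × ℝ)) fun _ => ht
  exact this.measurable

lemma IsGaussianKernel.continuousOn_kernelInt (hk : IsGaussianKernel k) (hu : Measurable u₀)
    (hM : ∀ y, |u₀ y| ≤ M) :
    ContinuousOn (fun r : ℝ × ℝ => kernelInt k u₀ r.1 r.2) {r | 0 < r.2} := by
  rintro ⟨x₀, t₀⟩ (ht₀ : 0 < t₀)
  obtain ⟨g, hg, hgk⟩ := hk.exists_bound ht₀ x₀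
  refine ContinuousAt.continuousWithinAt ?_
  have hcf : ContinuousAt (fun r : ℝ × ℝ => |r.1 - x₀|) (x₀, t₀) := by fun_prop
  have hcs : ContinuousAt (fun r : ℝ × ℝ => r.2) (x₀, t₀) := continuousAt_snd
  have e1 := hcf.eventually_lt_const (by simp : |(x₀, t₀).1 - x₀| < 1)
  have e2 := hcs.eventually_lt_const (by simpa using by linarith : (x₀, t₀).2 < 2 * t₀)
  have e3 := hcs.eventually_const_lt (half_lt_self ht₀ : t₀ / 2 < (x₀, t₀).2)
  refine continuousAt_of_dominated (bound := fun y => g y * M) ?_ ?_ (hg.mul_const M) ?_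
  · filter_upwards [e3] with r h3
    exact ((hk.measurable_slice (by linarith) r.1).mul hu).aestronglyMeasurable
  · filter_upwards [e1, e2, e3] with r h1 h2 h3
    refine Eventually.of_forall fun y => ?_
    have := hgk r.1 r.2 y h1.le h3.le h2.le
    rw [norm_mul, Real.norm_eq_abs, Real.norm_eq_abs]
    exact mul_le_mul this (hM y) (abs_nonneg _) ((abs_nonneg _).trans this)
  · refine Eventually.of_forall fun y => ContinuousAt.mul ?_ continuousAt_const
    have h := hk.continuousOn.continuousAt
      ((isOpen_lt continuous_const continuous_snd).mem_nhds (by exact ht₀) : _ ∈ 𝓝 (x₀ - y, t₀))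
    exact ContinuousAt.comp (g := fun q : ℝ × ℝ => k q.1 q.2)
      (f := fun r : ℝ × ℝ => ((r.1 - y, r.2) : ℝ × ℝ)) (x := (x₀, t₀)) h (by fun_prop)

lemma IsGaussianKernel.integrable_mul (hk : IsGaussianKernel k) (hu : Measurable u₀)
    (hM : ∀ y, |u₀ y| ≤ M) {t : ℝ} (ht : 0 < t) (x : ℝ) :
    Integrable fun y => k (x - y) t * u₀ y := by
  obtain ⟨g, hg, hgk⟩ := hk.exists_bound ht x
  refine (hg.mul_const M).mono' ((hk.measurable_slice ht x).mul hu).aestronglyMeasurable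
    (Eventually.of_forall fun y => ?_)
  have := hgk x t y (by simp) (by linarith) (by linarith)
  rw [norm_mul, Real.norm_eq_abs, Real.norm_eq_abs]
  exact mul_le_mul this (hM y) (abs_nonneg _) ((abs_nonneg _).trans this)

lemma IsGaussianKernel.hasDerivAt_kernelInt_x (hk : IsGaussianKernel k) (hk' : IsGaussianKernel k')
    (hd : ∀ z t, 0 < t → HasDerivAt (fun z => k z t) (k' z t) z) (hu : Measurable u₀)
    (hM : ∀ y, |u₀ y| ≤ M) {t : ℝ} (ht : 0 < t) (x : ℝ) :
    HasDerivAt (fun x => kernelInt k u₀ x t) (kernelInt k' u₀ x t) x := by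
  obtain ⟨g, hg, hgk⟩ := hk'.exists_bound ht x
  refine (hasDerivAt_integral_of_dominated_loc_of_deriv_le (bound := fun y => g y * M)
    (F := fun x y => k (x - y) t * u₀ y) (F' := fun x y => k' (x - y) t * u₀ y)
    (Metric.ball_mem_nhds x one_pos)
    (Eventually.of_forall fun x => ((hk.measurable_slice ht x).mul hu).aestronglyMeasurable)
    (hk.integrable_mul hu hM ht x) ((hk'.measurable_slice ht x).mul hu).aestronglyMeasurable ?_
    (hg.mul_const M) ?_).2
  · refine Eventually.of_forall fun y x' hx' => ?_
    have := hgk x' t y (le_of_lt (by simpa [Real.dist_eq] using hx')) (by linarith) (by linarith)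
    rw [norm_mul, Real.norm_eq_abs, Real.norm_eq_abs]
    exact mul_le_mul this (hM y) (abs_nonneg _) ((abs_nonneg _).trans this)
  · exact Eventually.of_forall fun y x' _ => ((hd (x' - y) t ht).comp_sub_const x' y).mul_const _

lemma IsGaussianKernel.hasDerivAt_kernelInt_t (hk : IsGaussianKernel k) (hk' : IsGaussianKernel k')
    (hd : ∀ z t, 0 < t → HasDerivAt (fun t => k z t) (k' z t) t) (hu : Measurable u₀)
    (hM : ∀ y, |u₀ y| ≤ M) {t : ℝ} (ht : 0 < t) (x : ℝ) :
    HasDerivAt (fun t => kernelInt k u₀ x t) (kernelInt k' u₀ x t) t := by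
  obtain ⟨g, hg, hgk⟩ := hk'.exists_bound ht x
  refine (hasDerivAt_integral_of_dominated_loc_of_deriv_le (bound := fun y => g y * M)
    (F := fun t y => k (x - y) t * u₀ y) (F' := fun t y => k' (x - y) t * u₀ y)
    (Icc_mem_nhds (by linarith : t / 2 < t) (by linarith : t < 2 * t)) ?_
    (hk.integrable_mul hu hM ht x) ((hk'.measurable_slice ht x).mul hu).aestronglyMeasurable ?_
    (hg.mul_const M) ?_).2
  · filter_upwards [Ioi_mem_nhds ht] with s hs
    exact ((hk.measurable_slice hs x).mul hu).aestronglyMeasurable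
  · refine Eventually.of_forall fun y s hs => ?_
    have := hgk x s y (by simp) hs.1 hs.2
    rw [norm_mul, Real.norm_eq_abs, Real.norm_eq_abs]
    exact mul_le_mul this (hM y) (abs_nonneg _) ((abs_nonneg _).trans this)
  · exact Eventually.of_forall fun y s hs =>
      (hd (x - y) s (by linarith [hs.1])).mul_const _

end GaussianKernels

section HeatSemigroup

variable {u₀ : ℝ → ℝ} {M : ℝ}

lemma kernelInt_heatKernel_eq (u₀ : ℝ → ℝ) (x t : ℝ) :
    kernelInt heatKernel u₀ x t = ∫ z, heatKernel z t * u₀ (x - z) := by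
  unfold kernelInt
  rw [← integral_sub_left_eq_self (fun z => heatKernel z t * u₀ (x - z)) volume x]
  simp

lemma kernelInt_heatKernel_of_nonpos (u₀ : ℝ → ℝ) (x : ℝ) {t : ℝ} (ht : t ≤ 0) :
    kernelInt heatKernel u₀ x t = 0 := by
  simp [kernelInt, heatKernel_of_nonpos ht]

lemma isCausal_heatExtension (hu : Measurable u₀) : IsCausal (kernelInt heatKernel u₀) := by
  refine ⟨?_, fun y s hs => kernelInt_heatKernel_of_nonpos u₀ y hs⟩
  unfold kernelInt
  have h : Measurable fun r : (ℝ × ℝ) × ℝ => heatKernel (r.1.1 - r.2) r.1.2 * u₀ r.2 := by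
    refine (measurable_heatKernel.comp (by fun_prop : Measurable fun r : (ℝ × ℝ) × ℝ =>
      ((r.1.1 - r.2, r.1.2) : ℝ × ℝ))).mul (hu.comp measurable_snd)
  exact (h.stronglyMeasurable.integral_prod_right (ν := (volume : Measure ℝ))).measurable

lemma abs_heatExtension_le (hM : ∀ y, |u₀ y| ≤ M) (x t : ℝ) :
    |kernelInt heatKernel u₀ x t| ≤ M := by
  have hM0 : 0 ≤ M := (abs_nonneg _).trans (hM 0)
  rcases le_or_gt t 0 with ht | ht
  · rw [kernelInt_heatKernel_of_nonpos u₀ x ht, abs_zero]; exact hM0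
  rw [kernelInt_heatKernel_eq, ← Real.norm_eq_abs]
  have h := norm_integral_le_of_norm_le ((integrable_heatKernel t).mul_const M)
    (f := fun z => heatKernel z t * u₀ (x - z)) (Eventually.of_forall fun z => by
      rw [norm_mul, Real.norm_of_nonneg (heatKernel_nonneg _ _)]
      exact mul_le_mul_of_nonneg_left (hM _) (heatKernel_nonneg _ _))
  rwa [integral_mul_const, integral_heatKernel ht, one_mul] at h

lemma abs_mul_kernelInt_heatKernelT_le (hM : ∀ y, |u₀ y| ≤ M) (x : ℝ) {t : ℝ} (ht : 0 < t) :
    |t * kernelInt heatKernelT u₀ x t| ≤ 4 * M := by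
  have hI : Integrable fun y => 4 * heatKernel (x - y) (2 * t) * M :=
    (((integrable_heatKernel (2 * t)).comp_sub_left x).const_mul 4).mul_const M
  unfold kernelInt
  rw [← integral_const_mul, ← Real.norm_eq_abs]
  have h := norm_integral_le_of_norm_le hI
    (f := fun y => t * (heatKernelT (x - y) t * u₀ y)) (Eventually.of_forall fun y => by
      rw [← mul_assoc, norm_mul]
      have := abs_mul_heatKernelT_le (x - y) ht
      exact mul_le_mul this (hM _) (norm_nonneg _) ((abs_nonneg _).trans this))
  refine h.trans_eq ?_
  rw [integral_mul_const, integral_const_mul,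
    integral_sub_left_eq_self (fun y => heatKernel y (2 * t)) volume x,
    integral_heatKernel (by positivity)]
  ring

lemma eLpNorm_heatExtension_le {p : ℝ} (hp : 1 ≤ p) (hu : Measurable u₀) (t : ℝ) :
    eLpNorm (fun x => kernelInt heatKernel u₀ x t) (ENNReal.ofReal p) volume
      ≤ eLpNorm u₀ (ENNReal.ofReal p) volume := by
  rcases le_or_gt t 0 with ht | ht
  · simp [kernelInt_heatKernel_of_nonpos u₀ _ ht]
  simp_rw [kernelInt_heatKernel_eq]
  have hk : Measurable fun z => heatKernel z t :=
    measurable_heatKernel.comp (by fun_prop : Measurable fun z : ℝ => ((z, t) : ℝ × ℝ))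
  have h := eLpNorm_integral_kernel_le (μ := (volume : Measure ℝ)) (ν := (volume : Measure ℝ)) hp hk
    (g := fun x z => u₀ (x - z)) (hu.comp (by fun_prop : Measurable fun r : ℝ × ℝ => r.1 - r.2))
    (D := eLpNorm u₀ (ENNReal.ofReal p) volume) (fun z _ => by
      exact (eLpNorm_comp_measurePreserving hu.aestronglyMeasurable
        (measurePreserving_sub_right volume z)).le)
  refine h.trans_eq ?_
  have : ∫⁻ z, ‖heatKernel z t‖ₑ = 1 := by
    have h1 := ofReal_integral_norm_eq_lintegral_enorm (integrable_heatKernel t)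
    simp_rw [Real.norm_of_nonneg (heatKernel_nonneg _ _)] at h1
    rw [← h1, integral_heatKernel ht, ENNReal.ofReal_one]
  rw [this, one_mul]

end HeatSemigroup

section InitialLimit

variable {u₀ : ℝ → ℝ} {M : ℝ}

lemma kernelInt_heatKernel_eq_scaled (u₀ : ℝ → ℝ) (x : ℝ) {t : ℝ} (ht : 0 < t) :
    kernelInt heatKernel u₀ x t = ∫ w, heatKernel w 1 * u₀ (x - √t * w) := by
  have hs : 0 < √t := Real.sqrt_pos.2 ht
  rw [kernelInt_heatKernel_eq]
  have h := Measure.integral_comp_mul_left (fun z => heatKernel z t * u₀ (x - z)) (√t)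
  rw [abs_of_pos (inv_pos.2 hs), smul_eq_mul] at h
  have h2 : ∀ w, heatKernel w 1 * u₀ (x - √t * w)
      = √t * (heatKernel (√t * w) t * u₀ (x - √t * w)) := by
    intro w
    have := heatKernel_div_sqrt (√t * w) ht
    rw [mul_div_cancel_left₀ _ hs.ne'] at this
    rw [this]; ring
  simp_rw [h2]
  rw [integral_const_mul, h, mul_inv_cancel_left₀ hs.ne']

lemma tendsto_heatExtension_of_continuous (hu : Continuous u₀) (hM : ∀ y, |u₀ y| ≤ M) (x : ℝ) :
    Tendsto (fun t => kernelInt heatKernel u₀ x t) (𝓝[>] 0) (𝓝 (u₀ x)) := by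
  have h : ContinuousAt (fun t : ℝ => ∫ w, heatKernel w 1 * u₀ (x - √t * w)) 0 := by
    have hk : Measurable fun w => heatKernel w 1 :=
      measurable_heatKernel.comp (by fun_prop : Measurable fun z : ℝ => ((z, (1 : ℝ)) : ℝ × ℝ))
    refine continuousAt_of_dominated (bound := fun w => heatKernel w 1 * M)
      (Eventually.of_forall fun t => ?_) (Eventually.of_forall fun t =>
        Eventually.of_forall fun w => ?_) ((integrable_heatKernel 1).mul_const M)
      (Eventually.of_forall fun w => ?_)
    · exact (hk.mul (hu.measurable.comp (by fun_prop))).aestronglyMeasurable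
    · rw [norm_mul, Real.norm_of_nonneg (heatKernel_nonneg _ _)]
      exact mul_le_mul_of_nonneg_left (hM _) (heatKernel_nonneg _ _)
    · exact (by fun_prop : Continuous fun t : ℝ => heatKernel w 1 * u₀ (x - √t * w)).continuousAt
  have h0 : ∫ w, heatKernel w 1 * u₀ (x - √0 * w) = u₀ x := by
    simp_rw [Real.sqrt_zero, zero_mul, sub_zero]
    rw [integral_mul_const, integral_heatKernel one_pos, one_mul]
  have h1 := h.tendsto.mono_left (nhdsWithin_le_nhds (s := Ioi 0))
  rw [h0] at h1
  refine h1.congr' ?_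
  filter_upwards [self_mem_nhdsWithin] with t ht
  exact (kernelInt_heatKernel_eq_scaled u₀ x ht).symm

/-- The heat semigroup attains bounded `L^p` initial values in `L¹_loc`, by density of continuous
functions in `L^p` and the contraction property. -/
lemma tendsto_eLpNorm_heatExtension_sub (hu : Measurable u₀) (hM : ∀ y, |u₀ y| ≤ M) {p : ℝ}
    (hp : 1 ≤ p) (hup : MemLp u₀ (ENNReal.ofReal p) volume) {K : Set ℝ} (hK : IsCompact K) :
    Tendsto (fun t : ℝ => eLpNorm (fun x => kernelInt heatKernel u₀ x t - u₀ x) 1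
      (volume.restrict K)) (𝓝[>] 0) (𝓝 0) := by
  have hp1 : (1 : ENNReal) ≤ ENNReal.ofReal p := by
    rw [← ENNReal.ofReal_one]; exact ENNReal.ofReal_le_ofReal hp
  set c : ENNReal := (volume.restrict K) univ ^
    (1 / (1 : ENNReal).toReal - 1 / (ENNReal.ofReal p).toReal) with hc
  have hctop : c ≠ ⊤ := by
    refine (ENNReal.rpow_lt_top_of_nonneg ?_ ?_).ne
    · rw [ENNReal.toReal_ofReal (by linarith), ENNReal.toReal_one, sub_nonneg, div_one,
        div_le_one (by linarith)]
      exact hp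
    · rw [Measure.restrict_apply_univ]; exact hK.measure_lt_top.ne
  rw [ENNReal.tendsto_nhds_zero]
  intro ε hε
  obtain ⟨δ, hδ0, hδ⟩ : ∃ δ : ENNReal, δ ≠ 0 ∧ δ * c + δ * c ≤ ε / 2 := by
    have hε4 : ε / 2 / 2 ≠ 0 := by
      simp [ENNReal.div_eq_zero_iff, hε.ne']
    refine ⟨ε / 2 / 2 / (c + 1), ?_, ?_⟩
    · exact (ENNReal.div_pos hε4 (ENNReal.add_ne_top.2 ⟨hctop, ENNReal.one_ne_top⟩)).ne'
    · have : ε / 2 / 2 / (c + 1) * c ≤ ε / 2 / 2 := by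
        calc _ ≤ ε / 2 / 2 / (c + 1) * (c + 1) := by gcongr; exact le_self_add
          _ = _ := ENNReal.div_mul_cancel (by simp) (ENNReal.add_ne_top.2 ⟨hctop, ENNReal.one_ne_top⟩)
      calc _ ≤ ε / 2 / 2 + ε / 2 / 2 := add_le_add this this
        _ = _ := ENNReal.add_halves _
  obtain ⟨g, hgs, hgu, hgc, -⟩ := hup.exists_hasCompactSupport_eLpNorm_sub_le
    ENNReal.ofReal_ne_top hδ0
  obtain ⟨Mg, hMg⟩ := hgs.exists_bound_of_continuous hgc
  have hlim : Tendsto (fun t : ℝ => eLpNorm (fun x => kernelInt heatKernel g x t - g x) 1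
      (volume.restrict K)) (𝓝[>] 0) (𝓝 0) := by
    simp_rw [eLpNorm_one_eq_lintegral_enorm]
    have := tendsto_lintegral_filter_of_dominated_convergence (μ := volume.restrict K)
      (l := 𝓝[>] (0 : ℝ)) (F := fun t x => ‖kernelInt heatKernel g x t - g x‖ₑ) (f := fun _ => 0)
      (fun _ => ENNReal.ofReal (Mg + Mg)) (Eventually.of_forall fun t => ?_)
      (Eventually.of_forall fun t => Eventually.of_forall fun x => ?_) ?_
      (Eventually.of_forall fun x => ?_)
    · simpa using this
    · have h1 : Measurable fun x => kernelInt heatKernel g x t :=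
        (isCausal_heatExtension hgc.measurable).measurable.comp
          (by fun_prop : Measurable fun x : ℝ => ((x, t) : ℝ × ℝ))
      exact (h1.sub hgc.measurable).enorm
    · rw [← ofReal_norm]
      refine ENNReal.ofReal_le_ofReal ((norm_sub_le _ _).trans (add_le_add ?_ (hMg x)))
      exact abs_heatExtension_le hMg x t
    · rw [lintegral_const, Measure.restrict_apply_univ]
      exact ENNReal.mul_ne_top ENNReal.ofReal_ne_top hK.measure_lt_top.ne
    · have := (tendsto_heatExtension_of_continuous hgc hMg x).sub_const (g x)
      simpa using this.enorm
  have hε2 : 0 < ε / 2 := ENNReal.half_pos hε.ne'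
  filter_upwards [ENNReal.tendsto_nhds_zero.1 hlim _ hε2, self_mem_nhdsWithin] with t h1 ht
  have hmeas : ∀ {w : ℝ → ℝ}, Measurable w → Measurable fun x => kernelInt heatKernel w x t :=
    fun hw => (isCausal_heatExtension hw).measurable.comp
      (by fun_prop : Measurable fun x : ℝ => ((x, t) : ℝ × ℝ))
  have hdec : (fun x => kernelInt heatKernel u₀ x t - u₀ x)
      = ((fun x => kernelInt heatKernel (fun y => u₀ y - g y) x t) + fun x => g x - u₀ x)
        + fun x => kernelInt heatKernel g x t - g x := by
    ext x
    have : kernelInt heatKernel (fun y => u₀ y - g y) x t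
        = kernelInt heatKernel u₀ x t - kernelInt heatKernel g x t := by
      unfold kernelInt
      rw [← integral_sub (isGaussianKernel_heatKernel.integrable_mul hu hM ht x)
        (isGaussianKernel_heatKernel.integrable_mul hgc.measurable hMg ht x)]
      simp_rw [mul_sub]
    simp only [Pi.add_apply, this]; ring
  have hum : Measurable fun y => u₀ y - g y := hu.sub hgc.measurable
  have hL : ∀ {w : ℝ → ℝ}, Measurable w → eLpNorm w (ENNReal.ofReal p) volume ≤ δ →
      eLpNorm w 1 (volume.restrict K) ≤ δ * c := by
    intro w hw hwδ
    refine (eLpNorm_le_eLpNorm_mul_rpow_measure_univ hp1 hw.aestronglyMeasurable).trans ?_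
    gcongr
    exact (eLpNorm_mono_measure _ Measure.restrict_le_self).trans hwδ
  have hgu' : eLpNorm (fun y => u₀ y - g y) (ENNReal.ofReal p) volume ≤ δ := hgu
  rw [hdec]
  have hA := hmeas hum
  have hB := hgc.measurable.sub hu
  have hC := (hmeas hgc.measurable).sub hgc.measurable
  refine (eLpNorm_add_le (hA.add hB).aestronglyMeasurable hC.aestronglyMeasurable le_rfl).trans ?_
  calc _ ≤ (δ * c + δ * c) + ε / 2 := by
        refine add_le_add ((eLpNorm_add_le hA.aestronglyMeasurable hB.aestronglyMeasurable
          le_rfl).trans (add_le_add ?_ ?_)) h1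
        · exact hL hA ((eLpNorm_heatExtension_le hp hum t).trans hgu')
        · refine hL hB ?_
          rw [← neg_sub, eLpNorm_neg]
          exact hgu
    _ ≤ ε / 2 + ε / 2 := by gcongr
    _ = ε := ENNReal.add_halves ε

end InitialLimit

section ConvLp

lemma eLpNorm_kernelConv_le {lam p : ℝ} (hp : 1 ≤ p) {k f : ℝ → ℝ → ℝ}
    (hk : IsCausalKernel lam k) (hf : IsCausal f) {t : ℝ} {D : ENNReal}
    (hD : ∀ s, 0 < s → s < t → eLpNorm (fun x => f x s) (ENNReal.ofReal p) volume
      ≤ ENNReal.ofReal (Real.exp (lam * s)) * D) :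
    eLpNorm (fun x => kernelConv k f x t) (ENNReal.ofReal p) volume
      ≤ ENNReal.ofReal (kernelNorm lam k * Real.exp (lam * t)) * D := by
  have hkm : Measurable fun q : ℝ × ℝ => Real.exp (-lam * q.2) * k q.1 q.2 :=
    (by fun_prop : Measurable fun q : ℝ × ℝ => Real.exp (-lam * q.2)).mul hk.measurable
  have hgm : Measurable fun r : ℝ × (ℝ × ℝ) =>
      Real.exp (lam * r.2.2) * f (r.1 - r.2.1) (t - r.2.2) :=
    (by fun_prop : Measurable fun r : ℝ × (ℝ × ℝ) => Real.exp (lam * r.2.2)).mul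
      (hf.measurable.comp (by fun_prop : Measurable fun r : ℝ × (ℝ × ℝ) =>
        ((r.1 - r.2.1, t - r.2.2) : ℝ × ℝ)))
  have h := eLpNorm_integral_kernel_le (μ := (volume : Measure ℝ))
    (ν := (volume : Measure (ℝ × ℝ))) hp hkm
    (g := fun x q => Real.exp (lam * q.2) * f (x - q.1) (t - q.2)) hgm
    (D := ENNReal.ofReal (Real.exp (lam * t)) * D) ?_
  · have e : (fun x => kernelConv k f x t) = fun x => ∫ q : ℝ × ℝ,
        Real.exp (-lam * q.2) * k q.1 q.2 * (Real.exp (lam * q.2) * f (x - q.1) (t - q.2)) := by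
      ext x
      unfold kernelConv
      refine integral_congr_ae (Eventually.of_forall fun q => ?_)
      have : Real.exp (-lam * q.2) * Real.exp (lam * q.2) = 1 := by
        rw [← Real.exp_add]; simp
      calc _ = (Real.exp (-lam * q.2) * Real.exp (lam * q.2))
            * (k q.1 q.2 * f (x - q.1) (t - q.2)) := by rw [this, one_mul]
        _ = _ := by ring
    rw [e]
    refine h.trans_eq ?_
    rw [← ofReal_integral_norm_eq_lintegral_enorm hk.integrable, ← mul_assoc,
      ← ENNReal.ofReal_mul (integral_nonneg fun _ => norm_nonneg _)]
    rfl
  · intro q hq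
    have hq2 : 0 < q.2 := by
      by_contra! h'; exact hq (by rw [hk.causal _ _ h', mul_zero])
    have hs : Measurable fun x => f x (t - q.2) :=
      hf.measurable.comp (by fun_prop : Measurable fun x : ℝ => ((x, t - q.2) : ℝ × ℝ))
    have e1 : eLpNorm (fun x => Real.exp (lam * q.2) * f (x - q.1) (t - q.2))
        (ENNReal.ofReal p) volume = ENNReal.ofReal (Real.exp (lam * q.2))
          * eLpNorm (fun x => f x (t - q.2)) (ENNReal.ofReal p) volume := by
      have h1 := eLpNorm_const_smul (Real.exp (lam * q.2)) (fun x => f (x - q.1) (t - q.2))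
        (ENNReal.ofReal p) (volume : Measure ℝ)
      have h2 := eLpNorm_comp_measurePreserving (p := ENNReal.ofReal p) hs.aestronglyMeasurable
        (measurePreserving_sub_right volume q.1)
      rw [← ofReal_norm, Real.norm_of_nonneg (Real.exp_pos _).le] at h1
      rw [← h2]; exact h1
    rw [e1]
    rcases le_or_gt t q.2 with h' | h'
    · have : (fun x => f x (t - q.2)) = 0 := by
        ext x; exact hf.causal _ _ (by linarith)
      simp [this]
    · calc _ ≤ ENNReal.ofReal (Real.exp (lam * q.2))
            * (ENNReal.ofReal (Real.exp (lam * (t - q.2))) * D) := by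
            gcongr; exact hD _ (by linarith) (by linarith)
        _ = _ := by
            rw [← mul_assoc, ← ENNReal.ofReal_mul (Real.exp_pos _).le, ← Real.exp_add]
            congr 3; ring

end ConvLp

/-! ### The drift -/

section Drift

/-- A bounded drift extended by zero to nonpositive times, with the regularity that is available
for positive times. The time derivative is only locally bounded. -/
structure IsCausalDrift (β : ℝ → ℝ → ℝ) (B : ℝ) : Prop where
  isCausal : IsCausal β
  continuousOn : ContinuousOn (fun r : ℝ × ℝ => β r.1 r.2) {r | 0 < r.2}
  bound : ∀ y s, |β y s| ≤ B
  differentiableAt_t : ∀ y s, 0 < s → DifferentiableAt ℝ (β y) s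
  continuousOn_t : ContinuousOn (fun r : ℝ × ℝ => deriv (β r.1) r.2) {r | 0 < r.2}
  bound_t : ∀ R T : ℝ, ∃ C, ∀ y s, |y| < R → 0 < s → s < T → |deriv (β y) s| ≤ C
  differentiableAt_x : ∀ y s, 0 < s → DifferentiableAt ℝ (fun y => β y s) y
  continuousOn_x : ContinuousOn (fun r : ℝ × ℝ => deriv (fun y => β y r.2) r.1) {r | 0 < r.2}

/-- The advection field, extended by zero to nonpositive times. -/
noncomputable def causalDrift (b : ℝ → ℝ → ℝ) (y s : ℝ) : ℝ := if 0 < s then b y s else 0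

lemma isCausal_of_continuousOn {f : ℝ → ℝ → ℝ}
    (hc : ContinuousOn (fun r : ℝ × ℝ => f r.1 r.2) {r | 0 < r.2})
    (h0 : ∀ y s, s ≤ 0 → f y s = 0) : IsCausal f := by
  refine ⟨?_, h0⟩
  classical
  have hset : MeasurableSet {r : ℝ × ℝ | 0 < r.2} := measurableSet_lt measurable_const measurable_snd
  have hm := hc.measurable_piecewise (continuousOn_const (c := (0 : ℝ))) hset
  convert hm using 1
  ext r
  by_cases hr : 0 < r.2
  · rw [piecewise_eq_of_mem _ _ _ (by exact hr)]
  · rw [piecewise_eq_of_notMem _ _ _ (by exact hr), h0 _ _ (not_lt.1 hr)]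

lemma isCausalDrift_causalDrift {b : ℝ → ℝ → ℝ} (hb : IsAdvectionField b) :
    ∃ B, 0 ≤ B ∧ IsCausalDrift (causalDrift b) B := by
  obtain ⟨B, hB⟩ := hb.bounded
  have hB0 : 0 ≤ B := (abs_nonneg _).trans (hB 0 0 le_rfl)
  set f : ℝ × ℝ → ℝ := fun z => b z.1 z.2 with hf
  have hopen : IsOpen {r : ℝ × ℝ | 0 < r.2} := isOpen_lt continuous_const continuous_snd
  have hsub : {r : ℝ × ℝ | 0 < r.2} ⊆ univ ×ˢ Ici (0 : ℝ) := fun r (hr : 0 < r.2) => ⟨mem_univ _, hr.le⟩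
  have hC : ContDiffOn ℝ 1 f {r : ℝ × ℝ | 0 < r.2} := hb.contDiffOn.mono hsub
  have hd : ∀ r : ℝ × ℝ, 0 < r.2 → DifferentiableAt ℝ f r := fun r hr =>
    (hC.differentiableOn one_ne_zero).differentiableAt (hopen.mem_nhds hr)
  have hfd : ContinuousOn (fderiv ℝ f) {r : ℝ × ℝ | 0 < r.2} :=
    hC.continuousOn_fderiv_of_isOpen hopen le_rfl
  have ht : ∀ r : ℝ × ℝ, 0 < r.2 → HasDerivAt (b r.1) (fderiv ℝ f r (0, 1)) r.2 := by
    intro r hr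
    have h1 : HasDerivAt (fun s : ℝ => ((r.1, s) : ℝ × ℝ)) (0, 1) r.2 :=
      (hasDerivAt_const _ _).prodMk (hasDerivAt_id _)
    exact (hd r hr).hasFDerivAt.comp_hasDerivAt r.2 h1
  have hx : ∀ r : ℝ × ℝ, 0 < r.2 → HasDerivAt (fun y => b y r.2) (fderiv ℝ f r (1, 0)) r.1 := by
    intro r hr
    have h1 : HasDerivAt (fun y : ℝ => ((y, r.2) : ℝ × ℝ)) (1, 0) r.1 :=
      (hasDerivAt_id _).prodMk (hasDerivAt_const _ _)
    exact (hd r hr).hasFDerivAt.comp_hasDerivAt r.1 h1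
  have et : ∀ y s, 0 < s → causalDrift b y =ᶠ[𝓝 s] b y := by
    intro y s hs
    filter_upwards [Ioi_mem_nhds hs] with s' hs'
    exact if_pos hs'
  have ex : ∀ s, 0 < s → (fun y => causalDrift b y s) = fun y => b y s := by
    intro s hs; ext y; exact if_pos hs
  have hcont : ContinuousOn (fun r : ℝ × ℝ => causalDrift b r.1 r.2) {r | 0 < r.2} :=
    hC.continuousOn.congr fun r hr => if_pos hr
  refine ⟨B, hB0, ⟨?_, hcont, ?_, ?_, ?_, ?_, ?_, ?_⟩⟩
  · exact isCausal_of_continuousOn hcont fun y s hs => if_neg (not_lt.2 hs)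
  · intro y s
    unfold causalDrift
    split_ifs with h
    · exact hB y s h.le
    · simpa using hB0
  · intro y s hs
    exact ((ht (y, s) hs).congr_of_eventuallyEq (et y s hs)).differentiableAt
  · refine (hfd.clm_apply (continuousOn_const (c := ((0, 1) : ℝ × ℝ)))).congr fun r hr => ?_
    exact ((ht r hr).congr_of_eventuallyEq (et r.1 r.2 hr)).deriv
  · intro R T
    have hu : UniqueDiffOn ℝ (univ ×ˢ Ici (0 : ℝ) : Set (ℝ × ℝ)) :=
      uniqueDiffOn_univ.prod (uniqueDiffOn_Ici 0)
    have hw := hb.contDiffOn.continuousOn_fderivWithin hu le_rfl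
    have hcomp : IsCompact (Icc (-R) R ×ˢ Icc 0 T : Set (ℝ × ℝ)) := isCompact_Icc.prod isCompact_Icc
    obtain ⟨C, hC'⟩ := hcomp.exists_bound_of_continuousOn
      (hw.mono fun r hr => ⟨mem_univ _, hr.2.1⟩)
    refine ⟨C, fun y s hy hs hsT => ?_⟩
    rw [((ht (y, s) hs).congr_of_eventuallyEq (et y s hs)).deriv]
    have h1 : fderivWithin ℝ f (univ ×ˢ Ici (0 : ℝ)) (y, s) = fderiv ℝ f (y, s) :=
      fderivWithin_of_mem_nhds (mem_of_superset (hopen.mem_nhds (by exact hs)) hsub)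
    have h2 := hC' (y, s) ⟨⟨(abs_lt.1 hy).1.le, (abs_lt.1 hy).2.le⟩, hs.le, hsT.le⟩
    rw [h1] at h2
    have h3 := (fderiv ℝ f (y, s)).le_opNorm ((0, 1) : ℝ × ℝ)
    have h4 : ‖((0, 1) : ℝ × ℝ)‖ = 1 := by simp [Prod.norm_def]
    rw [h4, mul_one] at h3
    exact h3.trans h2
  · intro y s hs
    rw [ex s hs]
    exact (hx (y, s) hs).differentiableAt
  · refine (hfd.clm_apply (continuousOn_const (c := ((1, 0) : ℝ × ℝ)))).congr fun r hr => ?_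
    rw [ex r.2 hr]
    exact (hx r hr).deriv

end Drift

/-! ### The Picard series -/

section Picard

/-- The terms of the Picard series of the integral equation `u = P_t u₀ - ∂_z G ** (β u)`. -/
noncomputable def picardTerm (β : ℝ → ℝ → ℝ) (u₀ : ℝ → ℝ) : ℕ → ℝ → ℝ → ℝ
  | 0 => kernelInt heatKernel u₀
  | n + 1 => fun x t => -kernelConv heatKernelX (fun y s => β y s * picardTerm β u₀ n y s) x t

/-- The sum of the Picard series. -/
noncomputable def picardSum (β : ℝ → ℝ → ℝ) (u₀ : ℝ → ℝ) (x t : ℝ) : ℝ :=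
  ∑' n, picardTerm β u₀ n x t

variable {β : ℝ → ℝ → ℝ} {B M lam : ℝ} {u₀ : ℝ → ℝ}

lemma IsCausal.mul {f g : ℝ → ℝ → ℝ} (hf : IsCausal f) (hg : IsCausal g) :
    IsCausal fun y s => f y s * g y s :=
  ⟨hf.measurable.mul hg.measurable, fun y s hs => by rw [hf.causal y s hs, zero_mul]⟩

lemma IsCausalDrift.abs_mul_le (hβ : IsCausalDrift β B) {f : ℝ → ℝ → ℝ} {C y s : ℝ}
    (hf : |f y s| ≤ C) : |β y s * f y s| ≤ B * C := by
  rw [abs_mul]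
  exact mul_le_mul (hβ.bound y s) hf (abs_nonneg _) ((abs_nonneg _).trans (hβ.bound y s))

lemma picardTerm_spec (hβ : IsCausalDrift β B) (hu : Measurable u₀) (hM : ∀ y, |u₀ y| ≤ M)
    (hl : 0 < lam) (hlB : 2 * √(Real.pi / lam) * B ≤ 1 / 2) (n : ℕ) :
    IsCausal (picardTerm β u₀ n) ∧
      ContinuousOn (fun r : ℝ × ℝ => picardTerm β u₀ n r.1 r.2) {r | 0 < r.2} ∧
      ∀ x t, |picardTerm β u₀ n x t| ≤ M * (1 / 2) ^ n * Real.exp (lam * t) := by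
  have hM0 : 0 ≤ M := (abs_nonneg _).trans (hM 0)
  induction n with
  | zero =>
    have hc := isCausal_heatExtension (u₀ := u₀) hu
    refine ⟨hc, isGaussianKernel_heatKernel.continuousOn_kernelInt hu hM, fun x t => ?_⟩
    rcases le_or_gt t 0 with ht | ht
    · rw [picardTerm, hc.causal x t ht, abs_zero]; positivity
    · have h1 := abs_heatExtension_le hM x t
      have h2 := Real.one_le_exp (by positivity : 0 ≤ lam * t)
      rw [picardTerm, pow_zero, mul_one]
      nlinarith
  | succ n ih =>
    obtain ⟨hc, hcont, hb⟩ := ih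
    obtain ⟨hK, hKn⟩ := isCausalKernel_heatKernelX hl
    have hc' := hβ.isCausal.mul hc
    have hb' : ∀ y s, |β y s * picardTerm β u₀ n y s|
        ≤ B * (M * (1 / 2) ^ n) * Real.exp (lam * s) := fun y s => by
      rw [mul_assoc]; exact hβ.abs_mul_le (hb y s)
    have hV := hc'.kernelConv hK
    refine ⟨⟨hV.measurable.neg, fun y s hs => by
      simp only [picardTerm]; rw [hV.causal y s hs, neg_zero]⟩, ?_,
      fun x t => ?_⟩
    · exact (continuousOn_kernelConv hK hc' hl.le hb' (hβ.continuousOn.mul hcont)).neg.continuousOn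
    · rw [picardTerm, abs_neg]
      have hB0 : 0 ≤ B := (abs_nonneg _).trans (hβ.bound 0 0)
      refine (abs_kernelConv_le hK x fun y s _ => hb' y s).trans ?_
      calc _ ≤ B * (M * (1 / 2) ^ n) * Real.exp (lam * t) * (2 * √(Real.pi / lam)) := by gcongr
        _ = (2 * √(Real.pi / lam) * B) * (M * (1 / 2) ^ n * Real.exp (lam * t)) := by ring
        _ ≤ 1 / 2 * (M * (1 / 2) ^ n * Real.exp (lam * t)) := by gcongr
        _ = _ := by rw [pow_succ]; ring

lemma TimeRegular.neg {R T N : ℝ} {f : ℝ → ℝ → ℝ} (h : TimeRegular lam R T N f) :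
    TimeRegular lam R T N fun x t => -f x t := by
  have e : ∀ y s, deriv (fun t => -f y t) s = -deriv (f y) s := fun y s => deriv.fun_neg
  refine ⟨fun y hy s hs => (h.differentiableAt y hy s hs).neg, ?_, fun y hy s hs => ?_⟩
  · simp_rw [e]; exact h.continuousOn.neg
  · rw [e, mul_neg, abs_neg]; exact h.bound y hy s hs

lemma TimeRegular.mono {R T N N' : ℝ} {f : ℝ → ℝ → ℝ} (h : TimeRegular lam R T N f)
    (hN : N ≤ N') : TimeRegular lam R T N' f :=
  ⟨h.differentiableAt, h.continuousOn, fun y hy s hs => (h.bound y hy s hs).trans (by gcongr)⟩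

lemma IsCausalDrift.timeRegular_mul (hβ : IsCausalDrift β B) {R T : ℝ} (hR : 0 < R) (hT : 0 < T) :
    ∃ C, 0 ≤ C ∧ ∀ (f : ℝ → ℝ → ℝ) (L N : ℝ),
      ContinuousOn (fun r : ℝ × ℝ => f r.1 r.2) {r | 0 < r.2} →
      (∀ y s, |f y s| ≤ L * Real.exp (lam * s)) → TimeRegular lam R T N f →
      TimeRegular lam R T (C * L + B * N) fun y s => β y s * f y s := by
  obtain ⟨C, hC⟩ := hβ.bound_t R T
  have hC0 : 0 ≤ C := (abs_nonneg _).trans (hC 0 (T / 2) (by simpa using hR) (by positivity)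
    (by linarith))
  refine ⟨R ^ 3 * T * C, by positivity, fun f L N hfc hL h => ?_⟩
  have hsub : Ioo (-R) R ×ˢ Ioo 0 T ⊆ {r : ℝ × ℝ | 0 < r.2} := fun r hr => hr.2.1
  have e : ∀ y ∈ Ioo (-R) R, ∀ s ∈ Ioo 0 T, HasDerivAt (fun s => β y s * f y s)
      (deriv (β y) s * f y s + β y s * deriv (f y) s) s := fun y hy s hs =>
    (hβ.differentiableAt_t y s hs.1).hasDerivAt.mul (h.differentiableAt y hy s hs).hasDerivAt
  refine ⟨fun y hy s hs => (e y hy s hs).differentiableAt, ?_, fun y hy s hs => ?_⟩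
  · refine (((hβ.continuousOn_t.mono hsub).mul (hfc.mono hsub)).add
      ((hβ.continuousOn.mono hsub).mul h.continuousOn)).congr fun r hr => ?_
    exact (e r.1 hr.1 r.2 hr.2).deriv
  · rw [(e y hy s hs).deriv]
    have hy' : |y| < R := abs_lt.2 hy
    have h1 := hC y s hy' hs.1 hs.2
    have h2 := hL y s
    have h3 := h.bound y hy s hs
    have h4 := hβ.bound y s
    have hL0 : 0 ≤ L * Real.exp (lam * s) := (abs_nonneg _).trans h2
    have hB0 : 0 ≤ B := (abs_nonneg _).trans h4
    have hd : 0 ≤ R - |y| := by linarith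
    have hd' : R - |y| ≤ R := by linarith [abs_nonneg y]
    have hsT := hs.2.le
    have hs0 := hs.1
    have a1 : (R - |y|) ^ 3 * |s * (deriv (β y) s * f y s)|
        ≤ R ^ 3 * (T * (C * (L * Real.exp (lam * s)))) := by
      rw [abs_mul, abs_mul, abs_of_pos hs0]
      gcongr
    have a2 : (R - |y|) ^ 3 * |s * (β y s * deriv (f y) s)| ≤ B * (N * Real.exp (lam * s)) := by
      calc _ = |β y s| * ((R - |y|) ^ 3 * |s * deriv (f y) s|) := by
            rw [show s * (β y s * deriv (f y) s) = β y s * (s * deriv (f y) s) by ring, abs_mul]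
            ring
        _ ≤ B * (N * Real.exp (lam * s)) :=
            mul_le_mul h4 h3 (by positivity) hB0
    calc _ ≤ (R - |y|) ^ 3 * |s * (deriv (β y) s * f y s)|
          + (R - |y|) ^ 3 * |s * (β y s * deriv (f y) s)| := by
          rw [← mul_add, mul_add s]
          gcongr
          exact abs_add_le _ _
      _ ≤ _ := add_le_add a1 a2
      _ = _ := by ring

lemma timeRegular_heatExtension (hu : Measurable u₀) (hM : ∀ y, |u₀ y| ≤ M) (hl : 0 < lam)
    {R : ℝ} (hR : 0 < R) (T : ℝ) :
    TimeRegular lam R T (R ^ 3 * (4 * M)) (kernelInt heatKernel u₀) := by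
  have hM0 : 0 ≤ M := (abs_nonneg _).trans (hM 0)
  have hd : ∀ y s, 0 < s → HasDerivAt (kernelInt heatKernel u₀ y) (kernelInt heatKernelT u₀ y s) s :=
    fun y s hs => isGaussianKernel_heatKernel.hasDerivAt_kernelInt_t isGaussianKernel_heatKernelT
      (fun z t ht => hasDerivAt_heatKernel_t z ht) hu hM hs y
  refine ⟨fun y _ s hs => (hd y s hs.1).differentiableAt, ?_, fun y hy s hs => ?_⟩
  · refine ((isGaussianKernel_heatKernelT.continuousOn_kernelInt hu hM).mono fun r hr =>
      hr.2.1).congr fun r hr => (hd r.1 r.2 hr.2.1).deriv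
  · rw [(hd y s hs.1).deriv]
    have h1 := abs_mul_kernelInt_heatKernelT_le hM y hs.1
    have hy' : |y| < R := abs_lt.2 hy
    have hd : 0 ≤ R - |y| := by linarith
    have hd' : R - |y| ≤ R := by linarith [abs_nonneg y]
    have h2 := Real.one_le_exp (mul_pos hl hs.1).le
    calc _ ≤ R ^ 3 * (4 * M) * 1 := by rw [mul_one]; gcongr
      _ ≤ _ := by gcongr

/-- The Picard series converges geometrically together with its time derivatives, locally in
space-time. -/
lemma exists_timeRegular_picardTerm (hβ : IsCausalDrift β B) (hu : Measurable u₀)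
    (hM : ∀ y, |u₀ y| ≤ M) (hl : 0 < lam) (hlB : 16 * √(Real.pi / lam) * B ≤ 1 / 4)
    {R T : ℝ} (hR : 0 < R) (hT : 0 < T) :
    ∃ N, ∀ n, TimeRegular lam R T (N * (1 / 2) ^ n) (picardTerm β u₀ n) := by
  have hM0 : 0 ≤ M := (abs_nonneg _).trans (hM 0)
  have hB0 : 0 ≤ B := (abs_nonneg _).trans (hβ.bound 0 0)
  set S := √(Real.pi / lam) with hS
  have hS0 : 0 ≤ S := Real.sqrt_nonneg _
  have hlB' : 2 * S * B ≤ 1 / 2 := by nlinarith [mul_nonneg hS0 hB0]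
  obtain ⟨C, hC0, hC⟩ := TimeRegular.duhamel_step (R := R) hl hT
  obtain ⟨D, hD0, hD⟩ := hβ.timeRegular_mul (lam := lam) hR hT
  have hspec := picardTerm_spec hβ hu hM hl hlB'
  set N := R ^ 3 * (4 * M) + 4 * (C * (B * M) + 16 * S * (D * M)) with hN
  have hN0 : 0 ≤ N := by positivity
  refine ⟨N, fun n => ?_⟩
  induction n with
  | zero =>
    rw [pow_zero, mul_one]
    refine (timeRegular_heatExtension hu hM hl hR T).mono ?_
    rw [hN]; have : 0 ≤ C * (B * M) + 16 * S * (D * M) := by positivity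
    linarith
  | succ n ih =>
    obtain ⟨hc, hcont, hb⟩ := hspec n
    have h1 := hD _ _ _ hcont hb ih
    have h2 := hC _ (B * (M * (1 / 2) ^ n)) _ (hβ.isCausal.mul hc) (hβ.continuousOn.mul hcont)
      (fun y s => by rw [mul_assoc]; exact hβ.abs_mul_le (hb y s)) (by positivity) h1
    refine h2.neg.mono ?_
    have hpow : 0 ≤ (1 / 2 : ℝ) ^ n := by positivity
    have h3 : 16 * S * B * N ≤ 1 / 4 * N := by gcongr
    have h4 : C * (B * M) + 16 * S * (D * M + B * N) ≤ N * (1 / 2) := by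
      have : 0 ≤ R ^ 3 * (4 * M) := by positivity
      linarith
    calc _ = (C * (B * M) + 16 * S * (D * M + B * N)) * (1 / 2) ^ n := by ring
      _ ≤ N * (1 / 2) * (1 / 2) ^ n := by gcongr
      _ = _ := by rw [pow_succ]; ring

section Sum

variable (hβ : IsCausalDrift β B) (hu : Measurable u₀) (hM : ∀ y, |u₀ y| ≤ M)
  (hl : 0 < lam) (hlB : 16 * √(Real.pi / lam) * B ≤ 1 / 4)
include hβ hu hM hl hlB

omit hu hM hl in
lemma two_sqrt_mul_le : 2 * √(Real.pi / lam) * B ≤ 1 / 2 := by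
  have hB0 : 0 ≤ B := (abs_nonneg _).trans (hβ.bound 0 0)
  nlinarith [mul_nonneg (Real.sqrt_nonneg (Real.pi / lam)) hB0]

lemma summable_picardTerm (x t : ℝ) : Summable fun n => picardTerm β u₀ n x t := by
  have hg : Summable fun n : ℕ => M * Real.exp (lam * t) * (1 / 2 : ℝ) ^ n :=
    summable_geometric_two.mul_left _
  refine Summable.of_norm_bounded hg fun n => ?_
  have := (picardTerm_spec hβ hu hM hl (two_sqrt_mul_le hβ hlB) n).2.2 x t
  rw [Real.norm_eq_abs]; linarith

lemma abs_picardSum_sub_le (n : ℕ) (x t : ℝ) :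
    |picardSum β u₀ x t - ∑ k ∈ Finset.range n, picardTerm β u₀ k x t|
      ≤ 2 * M * (1 / 2) ^ n * Real.exp (lam * t) := by
  have hs := summable_picardTerm hβ hu hM hl hlB x t
  have h1 : picardSum β u₀ x t - ∑ k ∈ Finset.range n, picardTerm β u₀ k x t
      = ∑' k, picardTerm β u₀ (k + n) x t := by
    rw [picardSum, ← hs.sum_add_tsum_nat_add n]; ring
  rw [h1, ← Real.norm_eq_abs]
  have hg : HasSum (fun k : ℕ => M * Real.exp (lam * t) * (1 / 2 : ℝ) ^ n * (1 / 2 : ℝ) ^ k)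
      (M * Real.exp (lam * t) * (1 / 2 : ℝ) ^ n * 2) := hasSum_geometric_two.mul_left _
  refine (tsum_of_norm_bounded hg fun k => ?_).trans_eq (by ring)
  have := (picardTerm_spec hβ hu hM hl (two_sqrt_mul_le hβ hlB) (k + n)).2.2 x t
  rw [Real.norm_eq_abs]
  refine this.trans_eq ?_
  rw [pow_add]; ring

lemma abs_picardSum_le (x t : ℝ) : |picardSum β u₀ x t| ≤ 2 * M * Real.exp (lam * t) := by
  simpa using abs_picardSum_sub_le hβ hu hM hl hlB 0 x t

lemma continuousOn_picardSum :
    ContinuousOn (fun r : ℝ × ℝ => picardSum β u₀ r.1 r.2) {r | 0 < r.2} := by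
  have hM0 : 0 ≤ M := (abs_nonneg _).trans (hM 0)
  have hspec := picardTerm_spec hβ hu hM hl (two_sqrt_mul_le hβ hlB)
  rintro ⟨x₀, t₀⟩ (ht₀ : 0 < t₀)
  have h : ContinuousOn (fun r : ℝ × ℝ => ∑' n, picardTerm β u₀ n r.1 r.2)
      {r : ℝ × ℝ | 0 < r.2 ∧ r.2 < t₀ + 1} := by
    refine continuousOn_tsum (u := fun n => M * Real.exp (lam * (t₀ + 1)) * (1 / 2 : ℝ) ^ n)
      (fun n => (hspec n).2.1.mono fun r hr => hr.1) (summable_geometric_two.mul_left _) ?_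
    rintro n r ⟨-, hr⟩
    rw [Real.norm_eq_abs]
    refine ((hspec n).2.2 r.1 r.2).trans ?_
    calc _ ≤ M * (1 / 2) ^ n * Real.exp (lam * (t₀ + 1)) := by gcongr
      _ = _ := by ring
  refine (h.continuousAt (IsOpen.mem_nhds ?_ ⟨ht₀, lt_add_one t₀⟩)).continuousWithinAt
  exact (isOpen_lt continuous_const continuous_snd).inter (isOpen_lt continuous_snd continuous_const)

lemma isCausal_picardSum : IsCausal (picardSum β u₀) := by
  refine isCausal_of_continuousOn (continuousOn_picardSum hβ hu hM hl hlB) fun y s hs => ?_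
  have hspec := picardTerm_spec hβ hu hM hl (two_sqrt_mul_le hβ hlB)
  have : ∀ n, picardTerm β u₀ n y s = 0 := fun n => (hspec n).1.causal y s hs
  simp [picardSum, this]

lemma isCausal_picardPartial (n : ℕ) :
    IsCausal fun x t => ∑ k ∈ Finset.range n, picardTerm β u₀ k x t := by
  have hspec := picardTerm_spec hβ hu hM hl (two_sqrt_mul_le hβ hlB)
  refine ⟨Finset.measurable_fun_sum _ fun k _ => (hspec k).1.measurable, fun y s hs => ?_⟩
  exact Finset.sum_eq_zero fun k _ => (hspec k).1.causal y s hs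

lemma picardPartial_succ (n : ℕ) (x t : ℝ) :
    ∑ k ∈ Finset.range (n + 1), picardTerm β u₀ k x t = kernelInt heatKernel u₀ x t
      - kernelConv heatKernelX
        (fun y s => β y s * ∑ k ∈ Finset.range n, picardTerm β u₀ k y s) x t := by
  have hspec := picardTerm_spec hβ hu hM hl (two_sqrt_mul_le hβ hlB)
  obtain ⟨hK, -⟩ := isCausalKernel_heatKernelX hl
  rw [Finset.sum_range_succ', sub_eq_neg_add]
  congr 1
  have : ∀ k, picardTerm β u₀ (k + 1) x t
      = -kernelConv heatKernelX (fun y s => β y s * picardTerm β u₀ k y s) x t := fun k => rfl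
  simp_rw [this]
  rw [Finset.sum_neg_distrib]
  congr 1
  unfold kernelConv
  rw [← integral_finsetSum]
  · refine integral_congr_ae (Eventually.of_forall fun q => ?_)
    simp only [Finset.mul_sum]
  · intro k _
    exact integrable_conv (f := fun y s => β y s * picardTerm β u₀ k y s) hK
      (hβ.isCausal.mul (hspec k).1).measurable x
      (M := B * (M * (1 / 2) ^ k)) fun y s _ => by
        rw [mul_assoc]; exact hβ.abs_mul_le ((hspec k).2.2 y s)

/-- The Picard sum solves the integral equation `u = P_t u₀ - ∂_z G ** (β u)`. -/
lemma picardSum_eq (x t : ℝ) :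
    picardSum β u₀ x t = kernelInt heatKernel u₀ x t
      - kernelConv heatKernelX (fun y s => β y s * picardSum β u₀ y s) x t := by
  obtain ⟨hK, -⟩ := isCausalKernel_heatKernelX hl
  have hM0 : 0 ≤ M := (abs_nonneg _).trans (hM 0)
  have hB0 : 0 ≤ B := (abs_nonneg _).trans (hβ.bound 0 0)
  have hgeo : Tendsto (fun n : ℕ => (1 / 2 : ℝ) ^ n) atTop (𝓝 0) :=
    tendsto_pow_atTop_nhds_zero_of_lt_one (by norm_num) (by norm_num)
  have h1 : Tendsto (fun n => ∑ k ∈ Finset.range (n + 1), picardTerm β u₀ k x t) atTop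
      (𝓝 (picardSum β u₀ x t)) :=
    (summable_picardTerm hβ hu hM hl hlB x t).hasSum.tendsto_sum_nat.comp (tendsto_add_atTop_nat 1)
  have hcs := hβ.isCausal.mul (isCausal_picardSum hβ hu hM hl hlB)
  have hcp := fun n => hβ.isCausal.mul (isCausal_picardPartial hβ hu hM hl hlB n)
  have hbs : ∀ y s, |β y s * picardSum β u₀ y s| ≤ B * (2 * M) * Real.exp (lam * s) :=
    fun y s => by rw [mul_assoc]; exact hβ.abs_mul_le (abs_picardSum_le hβ hu hM hl hlB y s)
  have hdiff : ∀ n y s, |β y s * (picardSum β u₀ y s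
      - ∑ k ∈ Finset.range n, picardTerm β u₀ k y s)|
      ≤ B * (2 * M * (1 / 2) ^ n) * Real.exp (lam * s) := fun n y s => by
    rw [mul_assoc, abs_mul]
    exact mul_le_mul (hβ.bound y s) (abs_picardSum_sub_le hβ hu hM hl hlB n y s) (abs_nonneg _) hB0
  have hdm : ∀ n, Measurable fun q : ℝ × ℝ => β q.1 q.2 * (picardSum β u₀ q.1 q.2
      - ∑ k ∈ Finset.range n, picardTerm β u₀ k q.1 q.2) := fun n =>
    hβ.isCausal.measurable.mul ((isCausal_picardSum hβ hu hM hl hlB).measurable.sub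
      (isCausal_picardPartial hβ hu hM hl hlB n).measurable)
  have h2 : Tendsto (fun n => kernelConv heatKernelX
      (fun y s => β y s * ∑ k ∈ Finset.range n, picardTerm β u₀ k y s) x t) atTop
      (𝓝 (kernelConv heatKernelX (fun y s => β y s * picardSum β u₀ y s) x t)) := by
    rw [tendsto_iff_norm_sub_tendsto_zero]
    have hlim : Tendsto (fun n : ℕ => B * (2 * M) * Real.exp (lam * t) * kernelNorm lam heatKernelX
        * (1 / 2 : ℝ) ^ n) atTop (𝓝 0) := by simpa using hgeo.const_mul _
    refine squeeze_zero (fun _ => norm_nonneg _) (fun n => ?_) hlim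
    have e : kernelConv heatKernelX
        (fun y s => β y s * ∑ k ∈ Finset.range n, picardTerm β u₀ k y s) x t
        - kernelConv heatKernelX (fun y s => β y s * picardSum β u₀ y s) x t
        = -kernelConv heatKernelX (fun y s => β y s * (picardSum β u₀ y s
          - ∑ k ∈ Finset.range n, picardTerm β u₀ k y s)) x t := by
      rw [← neg_eq_iff_eq_neg, neg_sub, eq_comm]
      have i1 := integrable_conv (f := fun y s => β y s * picardSum β u₀ y s) hK hcs.measurable x
        (t := t) fun y s _ => hbs y s
      have i2 := integrable_conv (f := fun y s => β y s * (picardSum β u₀ y s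
        - ∑ k ∈ Finset.range n, picardTerm β u₀ k y s)) hK (hdm n) x (t := t) fun y s _ =>
          hdiff n y s
      unfold kernelConv
      rw [eq_sub_iff_add_eq, ← integral_add i2 ?_]
      · refine integral_congr_ae (Eventually.of_forall fun q => ?_)
        simp only; ring
      · refine (i1.sub i2).congr (Eventually.of_forall fun q => ?_)
        simp only [Pi.sub_apply]; ring
    rw [e, norm_neg, Real.norm_eq_abs]
    refine (abs_kernelConv_le hK x fun y s _ => hdiff n y s).trans_eq ?_
    ring
  refine tendsto_nhds_unique h1 ?_
  simp_rw [picardPartial_succ hβ hu hM hl hlB]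
  exact h2.const_sub _

lemma exists_hasDerivAt_picardSum_t :
    ∃ ut : ℝ → ℝ → ℝ, ContinuousOn (fun r : ℝ × ℝ => ut r.1 r.2) {r | 0 < r.2} ∧
      ∀ x t, 0 < t → HasDerivAt (picardSum β u₀ x) (ut x t) t := by
  refine ⟨fun x t => ∑' n, deriv (picardTerm β u₀ n x) t, ?_, ?_⟩
  · rintro ⟨x₀, t₀⟩ (ht₀ : 0 < t₀)
    obtain ⟨N, hN⟩ := exists_timeRegular_picardTerm hβ hu hM hl hlB (R := |x₀| + 2) (T := t₀ + 1)
      (by positivity) (by positivity)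
    have hsub : Ioo (-(|x₀| + 1)) (|x₀| + 1) ×ˢ Ioo (t₀ / 2) (t₀ + 1)
        ⊆ Ioo (-(|x₀| + 2)) (|x₀| + 2) ×ˢ Ioo 0 (t₀ + 1) := by
      rintro r ⟨h1, h2⟩
      exact ⟨⟨by linarith [h1.1], by linarith [h1.2]⟩, by linarith [h2.1], h2.2⟩
    have hc : ContinuousOn (fun r : ℝ × ℝ => ∑' n, deriv (picardTerm β u₀ n r.1) r.2)
        (Ioo (-(|x₀| + 1)) (|x₀| + 1) ×ˢ Ioo (t₀ / 2) (t₀ + 1)) := by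
      refine continuousOn_tsum
        (u := fun n => 2 / t₀ * (|N| * Real.exp (lam * (t₀ + 1))) * (1 / 2 : ℝ) ^ n)
        (fun n => (hN n).continuousOn.mono hsub) (summable_geometric_two.mul_left _) ?_
      intro n r hr
      have h := (hN n).bound r.1 (hsub hr).1 r.2 (hsub hr).2
      have h1 : 1 ≤ (|x₀| + 2 - |r.1|) ^ 3 := by
        have : |r.1| < |x₀| + 1 := abs_lt.2 hr.1
        exact one_le_pow₀ (by linarith)
      have h2 : t₀ / 2 < r.2 := hr.2.1
      have h3 : N * (1 / 2) ^ n * Real.exp (lam * r.2)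
          ≤ |N| * (1 / 2) ^ n * Real.exp (lam * (t₀ + 1)) := by
        have := hr.2.2.le
        gcongr; exact le_abs_self N
      have h4 : |r.2 * deriv (picardTerm β u₀ n r.1) r.2|
          ≤ |N| * (1 / 2) ^ n * Real.exp (lam * (t₀ + 1)) :=
        (le_mul_of_one_le_left (abs_nonneg _) h1).trans (h.trans h3)
      rw [abs_mul, abs_of_pos (by linarith)] at h4
      rw [Real.norm_eq_abs]
      have h5 : t₀ / 2 * |deriv (picardTerm β u₀ n r.1) r.2|
          ≤ |N| * (1 / 2) ^ n * Real.exp (lam * (t₀ + 1)) :=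
        (mul_le_mul_of_nonneg_right h2.le (abs_nonneg _)).trans h4
      calc _ = 2 / t₀ * (t₀ / 2 * |deriv (picardTerm β u₀ n r.1) r.2|) := by field_simp
        _ ≤ 2 / t₀ * (|N| * (1 / 2) ^ n * Real.exp (lam * (t₀ + 1))) := by gcongr
        _ = _ := by ring
    refine (hc.continuousAt ((isOpen_Ioo.prod isOpen_Ioo).mem_nhds
      ⟨?_, half_lt_self ht₀, lt_add_one t₀⟩)).continuousWithinAt
    exact abs_lt.1 (lt_add_one |x₀|)
  · intro x t ht
    obtain ⟨N, hN⟩ := exists_timeRegular_picardTerm hβ hu hM hl hlB (R := |x| + 1) (T := t + 1)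
      (by positivity) (by positivity)
    have hx : x ∈ Ioo (-(|x| + 1)) (|x| + 1) := abs_lt.1 (lt_add_one |x|)
    refine hasDerivAt_tsum_of_isPreconnected (t := Ioo (t / 2) (t + 1)) (y₀ := t)
      (u := fun n => 2 / t * (|N| * Real.exp (lam * (t + 1))) * (1 / 2 : ℝ) ^ n)
      (summable_geometric_two.mul_left _) isOpen_Ioo isPreconnected_Ioo
      (fun n s hs => ((hN n).differentiableAt x hx s ⟨by linarith [hs.1], hs.2⟩).hasDerivAt) ?_
      ⟨half_lt_self ht, lt_add_one t⟩ (summable_picardTerm hβ hu hM hl hlB x t)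
      ⟨half_lt_self ht, lt_add_one t⟩
    intro n s hs
    have h := (hN n).bound x hx s ⟨by linarith [hs.1], hs.2⟩
    rw [add_sub_cancel_left, one_pow, one_mul, abs_mul, abs_of_pos (by linarith [hs.1])] at h
    have h3 : N * (1 / 2) ^ n * Real.exp (lam * s)
        ≤ |N| * (1 / 2) ^ n * Real.exp (lam * (t + 1)) := by
      have := hs.2.le
      gcongr; exact le_abs_self N
    have h5 : t / 2 * |deriv (picardTerm β u₀ n x) s|
        ≤ |N| * (1 / 2) ^ n * Real.exp (lam * (t + 1)) :=
      (mul_le_mul_of_nonneg_right hs.1.le (abs_nonneg _)).trans (h.trans h3)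
    rw [Real.norm_eq_abs]
    calc _ = 2 / t * (t / 2 * |deriv (picardTerm β u₀ n x) s|) := by field_simp
      _ ≤ 2 / t * (|N| * (1 / 2) ^ n * Real.exp (lam * (t + 1))) := by gcongr
      _ = _ := by ring

lemma eLpNorm_picardSum_le {p : ℝ} (hp : 1 ≤ p) {t : ℝ} (ht : 0 < t) :
    eLpNorm (fun x => picardSum β u₀ x t) (ENNReal.ofReal p) volume
      ≤ ENNReal.ofReal (2 * Real.exp (lam * t)) * eLpNorm u₀ (ENNReal.ofReal p) volume := by
  have hB0 : 0 ≤ B := (abs_nonneg _).trans (hβ.bound 0 0)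
  obtain ⟨hK, hKn⟩ := isCausalKernel_heatKernelX hl
  have hp1 : (1 : ENNReal) ≤ ENNReal.ofReal p := by
    rw [← ENNReal.ofReal_one]; exact ENNReal.ofReal_le_ofReal hp
  set D := eLpNorm u₀ (ENNReal.ofReal p) volume with hD
  have hslice : ∀ {f : ℝ → ℝ → ℝ}, IsCausal f → ∀ s, Measurable fun x => f x s := fun hf s =>
    hf.measurable.comp (by fun_prop : Measurable fun x : ℝ => ((x, s) : ℝ × ℝ))
  have hpart : ∀ n : ℕ, ∀ t, 0 < t →
      eLpNorm (fun x => ∑ k ∈ Finset.range n, picardTerm β u₀ k x t) (ENNReal.ofReal p) volume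
        ≤ ENNReal.ofReal (2 * Real.exp (lam * t)) * D := by
    intro n
    induction n with
    | zero => intro t _; simp
    | succ n ih =>
      intro t ht
      have hc := hβ.isCausal.mul (isCausal_picardPartial hβ hu hM hl hlB n)
      have hconv := eLpNorm_kernelConv_le (t := t) (D := ENNReal.ofReal (2 * B) * D) hp hK hc
        fun s hs hst => by
          have h1 : eLpNorm (fun x => β x s * ∑ k ∈ Finset.range n, picardTerm β u₀ k x s)
              (ENNReal.ofReal p) volume ≤ ENNReal.ofReal B * eLpNorm
              (fun x => ∑ k ∈ Finset.range n, picardTerm β u₀ k x s) (ENNReal.ofReal p) volume :=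
            eLpNorm_le_mul_eLpNorm_of_ae_le_mul (Eventually.of_forall fun x => by
              rw [norm_mul]; gcongr; exact hβ.bound x s) _
          refine h1.trans ((mul_le_mul_right (ih s hs) _).trans_eq ?_)
          rw [← mul_assoc, ← mul_assoc, ← ENNReal.ofReal_mul hB0,
            ← ENNReal.ofReal_mul (Real.exp_pos _).le]
          congr 2; ring
      simp_rw [picardPartial_succ hβ hu hM hl hlB]
      refine (eLpNorm_sub_le (hslice (isCausal_heatExtension hu) t).aestronglyMeasurable
        (hslice (hc.kernelConv hK) t).aestronglyMeasurable hp1).trans ?_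
      refine (add_le_add (eLpNorm_heatExtension_le hp hu t) hconv).trans ?_
      have hkn := kernelNorm_nonneg lam heatKernelX
      have h2 : kernelNorm lam heatKernelX * Real.exp (lam * t) * (2 * B) ≤ Real.exp (lam * t) := by
        have := two_sqrt_mul_le hβ hlB
        have h3 : kernelNorm lam heatKernelX * (2 * B) ≤ 1 := by nlinarith
        nlinarith [Real.exp_pos (lam * t)]
      have h4 : (1 : ℝ) ≤ Real.exp (lam * t) := Real.one_le_exp (by positivity)
      calc _ = ENNReal.ofReal (1 + kernelNorm lam heatKernelX * Real.exp (lam * t) * (2 * B)) * D := by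
            rw [ENNReal.ofReal_add zero_le_one (by positivity), add_mul, ENNReal.ofReal_one, one_mul,
              ENNReal.ofReal_mul (by positivity : 0 ≤ kernelNorm lam heatKernelX
                * Real.exp (lam * t)), mul_assoc]
        _ ≤ _ := by
            gcongr; linarith
  have hlim := Lp.eLpNorm_lim_le_liminf_eLpNorm (p := ENNReal.ofReal p) (μ := (volume : Measure ℝ))
    (f := fun n x => ∑ k ∈ Finset.range n, picardTerm β u₀ k x t)
    (fun n => (hslice (isCausal_picardPartial hβ hu hM hl hlB n) t).aestronglyMeasurable)
    (fun x => picardSum β u₀ x t) (Eventually.of_forall fun x =>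
      (summable_picardTerm hβ hu hM hl hlB x t).hasSum.tendsto_sum_nat)
  refine hlim.trans ?_
  refine (liminf_le_liminf (Eventually.of_forall fun n => hpart n t ht)).trans ?_
  simp

end Sum

end Picard

/-! ### Global solutions -/

section CongrSolution

variable {T : EReal} {u v : ℝ → ℝ → ℝ}

lemma isOpen_openStrip (T : EReal) : IsOpen (openStrip T) :=
  (isOpen_lt continuous_const continuous_snd).inter
    (isOpen_lt (continuous_coe_real_ereal.comp continuous_snd) continuous_const)

lemma openStrip_top : openStrip ⊤ = {r : ℝ × ℝ | 0 < r.2} := by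
  ext r; simp [openStrip, EReal.coe_lt_top]

lemma IsC21.congr (h : IsC21 T u) (hv : ∀ z ∈ openStrip T, v z.1 z.2 = u z.1 z.2) :
    IsC21 T v := by
  have ht : ∀ z ∈ openStrip T, (fun s => v z.1 s) =ᶠ[𝓝 z.2] fun s => u z.1 s := fun z hz => by
    have hc : ContinuousAt (fun s : ℝ => ((z.1, s) : ℝ × ℝ)) z.2 := by fun_prop
    filter_upwards [hc.preimage_mem_nhds ((isOpen_openStrip T).mem_nhds hz)] with s hs
    exact hv _ hs
  have hx : ∀ z ∈ openStrip T, (fun y => v y z.2) = fun y => u y z.2 := fun z hz => by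
    funext y; exact hv (y, z.2) hz
  refine ⟨fun z hz => (h.differentiableAt_t z hz).congr_of_eventuallyEq (ht z hz), fun z hz => ?_,
    fun z hz => ?_, h.continuousOn.congr hv, h.continuousOn_t.congr fun z hz => (ht z hz).deriv_eq,
    h.continuousOn_x.congr fun z hz => ?_, h.continuousOn_xx.congr fun z hz => ?_⟩
  · rw [hx z hz]; exact h.differentiableAt_x z hz
  · rw [hx z hz]; exact h.differentiableAt_xx z hz
  · simp only [hx z hz]
  · simp only [hx z hz]

/-- Being a solution depends on the initial data only up to null sets, and the values at `t = 0`
may be changed on a null set. -/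
lemma IsSolution.congr {b : ℝ → ℝ → ℝ} {u₀ v₀ : ℝ → ℝ} (hT : 0 < T)
    (h : IsSolution b u₀ T u)
    (hv : ∀ x t : ℝ, 0 < t → (t : EReal) < T → v x t = u x t) (h0 : ∃ M : ℝ, ∀ x, |v x 0| ≤ M)
    (hv0 : (fun x => v x 0) =ᵐ[volume] v₀) (hu0 : u₀ =ᵐ[volume] v₀) : IsSolution b v₀ T v := by
  refine ⟨fun S hS hST => ?_, h.isC21.congr fun z hz => hv _ _ hz.1 hz.2, fun x t ht htT => ?_, hv0,
    fun K hK => ?_⟩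
  · obtain ⟨M, hM⟩ := h.bounded S hS hST
    obtain ⟨M₀, hM₀⟩ := h0
    refine ⟨max M M₀, fun x t ht => ?_⟩
    rcases ht.1.eq_or_lt with rfl | h1
    · exact (hM₀ x).trans (le_max_right _ _)
    · rw [hv x t h1 ((EReal.coe_le_coe_iff.2 ht.2).trans_lt hST)]
      exact (hM x t ht).trans (le_max_left _ _)
  · have hx : (fun y => v y t) = fun y => u y t := funext fun y => hv y t ht htT
    have hx' : (fun y => b y t * v y t) = fun y => b y t * u y t := funext fun y => by
      rw [hv y t ht htT]
    have ht' : (fun s => v x s) =ᶠ[𝓝 t] fun s => u x s := by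
      have hc : ContinuousAt (fun s : ℝ => ((x, s) : ℝ × ℝ)) t := by fun_prop
      filter_upwards [hc.preimage_mem_nhds
        ((isOpen_openStrip T).mem_nhds (show (x, t) ∈ openStrip T from ⟨ht, htT⟩))] with s hs
      exact hv x s hs.1 hs.2
    rw [hx, hx', ht'.deriv_eq]
    exact h.equation x t ht htT
  · refine (h.initial_limit K hK).congr' ?_
    obtain ⟨q, hq, hq'⟩ := EReal.lt_iff_exists_real_btwn.1 hT
    filter_upwards [Ioo_mem_nhdsGT (by exact_mod_cast hq : (0 : ℝ) < q)] with t ht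
    refine eLpNorm_congr_ae ?_
    filter_upwards [ae_restrict_of_ae hu0] with x hx
    rw [hx, hv x t ht.1 ((EReal.coe_lt_coe_iff.2 ht.2).trans hq')]

end CongrSolution

section Existence

variable {β : ℝ → ℝ → ℝ} {B M lam : ℝ} {u₀ : ℝ → ℝ}
variable (hβ : IsCausalDrift β B) (hu : Measurable u₀) (hM : ∀ y, |u₀ y| ≤ M)
  (hl : 0 < lam) (hlB : 16 * √(Real.pi / lam) * B ≤ 1 / 4)
include hβ hu hM hl hlB

lemma isC21_picardSum : IsC21 ⊤ (picardSum β u₀) ∧ ∀ x t, 0 < t →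
    deriv (fun s => picardSum β u₀ x s) t + deriv (fun y => β y t * picardSum β u₀ y t) x
      = deriv (deriv fun y => picardSum β u₀ y t) x := by
  obtain ⟨ut, hutc, hut⟩ := exists_hasDerivAt_picardSum_t hβ hu hM hl hlB
  have huc := continuousOn_picardSum hβ hu hM hl hlB
  set u := picardSum β u₀ with hudef
  have hcF : IsCausal fun y s => β y s * u y s :=
    hβ.isCausal.mul (isCausal_picardSum hβ hu hM hl hlB)
  have hFc : ContinuousOn (fun r : ℝ × ℝ => β r.1 r.2 * u r.1 r.2) {r | 0 < r.2} :=
    hβ.continuousOn.mul huc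
  have hFM : ∀ y s, |β y s * u y s| ≤ B * (2 * M) * Real.exp (lam * s) := fun y s => by
    rw [mul_assoc]; exact hβ.abs_mul_le (abs_picardSum_le hβ hu hM hl hlB y s)
  set V := kernelConv heatKernelX (fun y s => β y s * u y s) with hVdef
  have hVeq : ∀ x t, V x t = kernelInt heatKernel u₀ x t - u x t := fun x t => by
    rw [hudef, picardSum_eq hβ hu hM hl hlB x t]; ring
  have hueq : ∀ x t, u x t = kernelInt heatKernel u₀ x t - V x t := fun x t => by rw [hVeq]; ring
  have hVt : ∀ x t, 0 < t → HasDerivAt (V x) (kernelInt heatKernelT u₀ x t - ut x t) t := by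
    intro x t ht
    have e : V x = fun t => kernelInt heatKernel u₀ x t - u x t := funext (hVeq x)
    rw [e]
    exact (isGaussianKernel_heatKernel.hasDerivAt_kernelInt_t isGaussianKernel_heatKernelT
      (fun z t ht => hasDerivAt_heatKernel_t z ht) hu hM ht x).sub (hut x t ht)
  have hVtc : ContinuousOn (fun r : ℝ × ℝ => kernelInt heatKernelT u₀ r.1 r.2 - ut r.1 r.2)
      {r | 0 < r.2} := (isGaussianKernel_heatKernelT.continuousOn_kernelInt hu hM).sub hutc
  have hVx : ∀ x t, 0 < t → DifferentiableAt ℝ (fun y => V y t) x := fun x t ht =>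
    (hasDerivAt_kernelConv_x hl hcF hFc hFM hVt hVtc (sub_one_lt x) ht).differentiableAt
  have hux : ∀ x t, 0 < t → HasDerivAt (fun y => u y t)
      (kernelInt heatKernelX u₀ x t - deriv (fun y => V y t) x) x := by
    intro x t ht
    have e : (fun y => u y t) = fun y => kernelInt heatKernel u₀ y t - V y t :=
      funext fun y => hueq y t
    rw [e]
    exact (isGaussianKernel_heatKernel.hasDerivAt_kernelInt_x isGaussianKernel_heatKernelX
      (fun z t _ => hasDerivAt_heatKernel_x z t) hu hM ht x).sub (hVx x t ht).hasDerivAt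
  have hbx : ∀ x t, 0 < t → HasDerivAt (fun y => β y t * u y t)
      (deriv (fun y => β y t) x * u x t + β x t * deriv (fun y => u y t) x) x := fun x t ht =>
    (hβ.differentiableAt_x x t ht).hasDerivAt.mul (hux x t ht).differentiableAt.hasDerivAt
  have huxx : ∀ x t, 0 < t → HasDerivAt (deriv fun y => u y t)
      (ut x t + (deriv (fun y => β y t) x * u x t + β x t * deriv (fun y => u y t) x)) x := by
    intro x t ht
    have e : (deriv fun y => u y t)
        = fun y => kernelInt heatKernelX u₀ y t - deriv (fun y => V y t) y :=
      funext fun y => (hux y t ht).deriv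
    have h1 := (isGaussianKernel_heatKernelX.hasDerivAt_kernelInt_x isGaussianKernel_heatKernelT
      (fun z t _ => hasDerivAt_heatKernelX_x z t) hu hM ht x).sub
      (hasDerivAt_deriv_kernelConv_x hl hcF hFc hFM hVt hVtc ht (hbx x t ht))
    exact (h1.congr_of_eventuallyEq (Eventually.of_forall (congrFun e))).congr_deriv (by ring)
  have huxc : ContinuousOn (fun r : ℝ × ℝ => deriv (fun y => u y r.2) r.1) {r | 0 < r.2} :=
    ((isGaussianKernel_heatKernelX.continuousOn_kernelInt hu hM).sub
      (continuousOn_deriv_kernelConv_x hl hcF hFc hFM hVt hVtc)).congr fun r hr =>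
        (hux r.1 r.2 hr).deriv
  refine ⟨⟨?_, ?_, ?_, ?_, ?_, ?_, ?_⟩, ?_⟩
  all_goals try rw [openStrip_top]
  · exact fun z hz => (hut z.1 z.2 hz).differentiableAt
  · exact fun z hz => (hux z.1 z.2 hz).differentiableAt
  · exact fun z hz => (huxx z.1 z.2 hz).differentiableAt
  · exact huc
  · exact hutc.congr fun z hz => (hut z.1 z.2 hz).deriv
  · exact huxc
  · exact (hutc.add ((hβ.continuousOn_x.mul huc).add (hβ.continuousOn.mul huxc))).congr
      fun z hz => (huxx z.1 z.2 hz).deriv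
  · intro x t ht
    rw [(huxx x t ht).deriv, (hut x t ht).deriv, (hbx x t ht).deriv]

/-- Bounds on the Duhamel term with constant `O(√t)`: the exponential weight `e^{s/t}` is
comparable to one on `(0,t)`, and the corresponding norm of the kernel is `2√(πt)`. -/
lemma abs_kernelConv_picardSum_le {x t : ℝ} (ht : 0 < t) :
    |kernelConv heatKernelX (fun y s => β y s * picardSum β u₀ y s) x t|
      ≤ 4 * √Real.pi * Real.exp 1 * B * Real.exp (lam * t) * √t * M := by
  have hM0 : 0 ≤ M := (abs_nonneg _).trans (hM 0)
  have hB0 : 0 ≤ B := (abs_nonneg _).trans (hβ.bound 0 0)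
  obtain ⟨hK, hKn⟩ := isCausalKernel_heatKernelX (lam := 1 / t) (by positivity)
  have hF : ∀ y s, s < t → |β y s * picardSum β u₀ y s|
      ≤ 2 * B * M * Real.exp (lam * t) * Real.exp (1 / t * s) := by
    intro y s hs
    rcases le_or_gt s 0 with h0 | h0
    · rw [hβ.isCausal.causal y s h0, zero_mul, abs_zero]; positivity
    refine (hβ.abs_mul_le (abs_picardSum_le hβ hu hM hl hlB y s)).trans ?_
    have h1 : Real.exp (lam * s) ≤ Real.exp (lam * t) := Real.exp_le_exp.2 (by gcongr)
    have h2 : 1 ≤ Real.exp (1 / t * s) := Real.one_le_exp (by positivity)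
    calc B * (2 * M * Real.exp (lam * s)) ≤ B * (2 * M * Real.exp (lam * t)) * 1 := by
          rw [mul_one]; gcongr
      _ ≤ B * (2 * M * Real.exp (lam * t)) * Real.exp (1 / t * s) := by gcongr
      _ = _ := by ring
  refine (abs_kernelConv_le hK x hF).trans ?_
  have e1 : Real.pi / (1 / t) = Real.pi * t := by field_simp
  rw [e1, Real.sqrt_mul Real.pi_pos.le] at hKn
  rw [one_div_mul_cancel ht.ne']
  calc _ ≤ 2 * B * M * Real.exp (lam * t) * Real.exp 1 * (2 * (√Real.pi * √t)) := by gcongr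
    _ = _ := by ring

lemma eLpNorm_picardSum_le_of_small {p t : ℝ} (hp : 1 ≤ p) (ht : 0 < t) :
    eLpNorm (fun x => picardSum β u₀ x t) (ENNReal.ofReal p) volume
      ≤ ENNReal.ofReal (1 + 4 * √Real.pi * Real.exp 1 * B * Real.exp (lam * t) * √t)
        * eLpNorm u₀ (ENNReal.ofReal p) volume := by
  have hB0 : 0 ≤ B := (abs_nonneg _).trans (hβ.bound 0 0)
  have hp1 : (1 : ENNReal) ≤ ENNReal.ofReal p := by
    rw [← ENNReal.ofReal_one]; exact ENNReal.ofReal_le_ofReal hp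
  obtain ⟨hK, hKn⟩ := isCausalKernel_heatKernelX (lam := 1 / t) (by positivity)
  have hcF : IsCausal fun y s => β y s * picardSum β u₀ y s :=
    hβ.isCausal.mul (isCausal_picardSum hβ hu hM hl hlB)
  set D := eLpNorm u₀ (ENNReal.ofReal p) volume with hD
  have hF : ∀ s, 0 < s → s < t →
      eLpNorm (fun x => β x s * picardSum β u₀ x s) (ENNReal.ofReal p) volume
      ≤ ENNReal.ofReal (Real.exp (1 / t * s))
        * (ENNReal.ofReal (2 * B * Real.exp (lam * t)) * D) := by
    intro s hs hst
    have h1 : eLpNorm (fun x => β x s * picardSum β u₀ x s) (ENNReal.ofReal p) volume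
        ≤ ENNReal.ofReal B * eLpNorm (fun x => picardSum β u₀ x s) (ENNReal.ofReal p) volume :=
      eLpNorm_le_mul_eLpNorm_of_ae_le_mul (Eventually.of_forall fun x => by
        rw [norm_mul]; exact mul_le_mul_of_nonneg_right (hβ.bound x s) (norm_nonneg _)) _
    have h3 : 2 * B * Real.exp (lam * s) ≤ Real.exp (1 / t * s) * (2 * B * Real.exp (lam * t)) := by
      have h1 : Real.exp (lam * s) ≤ Real.exp (lam * t) := Real.exp_le_exp.2 (by gcongr)
      have h2 : 1 ≤ Real.exp (1 / t * s) := Real.one_le_exp (by positivity)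
      calc 2 * B * Real.exp (lam * s) ≤ 1 * (2 * B * Real.exp (lam * t)) := by
            rw [one_mul]; gcongr
        _ ≤ _ := by gcongr
    calc _ ≤ ENNReal.ofReal B * (ENNReal.ofReal (2 * Real.exp (lam * s)) * D) :=
          h1.trans (by gcongr; exact eLpNorm_picardSum_le hβ hu hM hl hlB hp hs)
      _ = ENNReal.ofReal (2 * B * Real.exp (lam * s)) * D := by
          rw [← mul_assoc, ← ENNReal.ofReal_mul hB0]; congr 2; ring
      _ ≤ ENNReal.ofReal (Real.exp (1 / t * s) * (2 * B * Real.exp (lam * t))) * D := by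
          gcongr
      _ = _ := by rw [ENNReal.ofReal_mul (by positivity), mul_assoc]
  have h2 := eLpNorm_kernelConv_le hp hK hcF hF
  have e1 : Real.pi / (1 / t) = Real.pi * t := by field_simp
  rw [e1, Real.sqrt_mul Real.pi_pos.le] at hKn
  have hmeas : ∀ {f : ℝ → ℝ → ℝ}, IsCausal f →
      AEStronglyMeasurable (fun x => f x t) volume := fun hf =>
    (hf.measurable.comp (by fun_prop : Measurable fun x : ℝ => ((x, t) : ℝ × ℝ))).aestronglyMeasurable
  simp_rw [picardSum_eq hβ hu hM hl hlB _ t]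
  refine (eLpNorm_sub_le (hmeas (isCausal_heatExtension hu)) (hmeas (hcF.kernelConv hK)) hp1).trans ?_
  refine (add_le_add (eLpNorm_heatExtension_le hp hu t) h2).trans ?_
  rw [ENNReal.ofReal_add zero_le_one (by positivity), add_mul, ENNReal.ofReal_one, one_mul,
    ← mul_assoc, ← ENNReal.ofReal_mul (mul_nonneg (kernelNorm_nonneg _ _) (Real.exp_pos _).le)]
  gcongr _ + ENNReal.ofReal ?_ * _
  rw [one_div_mul_cancel ht.ne']
  calc _ ≤ 2 * (√Real.pi * √t) * Real.exp 1 * (2 * B * Real.exp (lam * t)) := by gcongr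
    _ = _ := by ring

end Existence

/-- Existence of a global solution whose `L^p` norms, `1 ≤ p ≤ ∞`, are controlled by those of the
initial data, with a constant that tends to `1` as `t → 0`. -/
theorem exists_isSolution {b : ℝ → ℝ → ℝ} (hb : IsAdvectionField b) {u₀ : ℝ → ℝ} {M p₀ : ℝ}
    (hu : Measurable u₀) (hM : ∀ y, |u₀ y| ≤ M) (hp₀ : 1 ≤ p₀)
    (hup : MemLp u₀ (ENNReal.ofReal p₀) volume) :
    ∃ v, IsSolution b u₀ ⊤ v ∧ (∀ x, v x 0 = u₀ x) ∧ ∀ T : ℝ, ∃ C, 0 ≤ C ∧ ∀ t : ℝ, 0 ≤ t → t ≤ T →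
      (∀ x, |v x t| ≤ (1 + C * √t) * M) ∧
      ∀ p : ℝ, 1 ≤ p → eLpNorm (fun x => v x t) (ENNReal.ofReal p) volume
        ≤ ENNReal.ofReal (1 + C * √t) * eLpNorm u₀ (ENNReal.ofReal p) volume := by
  have hM0 : 0 ≤ M := (abs_nonneg _).trans (hM 0)
  obtain ⟨B, hB0, hβ⟩ := isCausalDrift_causalDrift hb
  obtain ⟨lam, hl, hlB⟩ : ∃ lam : ℝ, 0 < lam ∧ 16 * √(Real.pi / lam) * B ≤ 1 / 4 := by
    have hp := Real.pi_pos
    -- chosen so that `√(π/λ) = 1 / (64 (B + 1))`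
    refine ⟨Real.pi * (64 * (B + 1)) ^ 2, by positivity, ?_⟩
    have e : Real.pi / (Real.pi * (64 * (B + 1)) ^ 2) = (1 / (64 * (B + 1))) ^ 2 := by field_simp
    rw [e, Real.sqrt_sq (by positivity), mul_one_div, div_mul_eq_mul_div,
      div_le_iff₀ (by positivity)]
    linarith
  set u := picardSum (causalDrift b) u₀ with hudef
  set A : ℝ → ℝ := fun t => 4 * √Real.pi * Real.exp 1 * B * Real.exp (lam * t) with hA
  have hA0 : ∀ t, 0 ≤ A t := fun t => by positivity
  have hAm : ∀ {t T}, t ≤ T → A t ≤ A T := fun h => by simp only [hA]; gcongr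
  obtain ⟨hC, heq⟩ := isC21_picardSum hβ hu hM hl hlB
  have hvu : ∀ x t, 0 < t → (if t = 0 then u₀ x else u x t) = u x t := fun x t ht =>
    if_neg ht.ne'
  refine ⟨fun x t => if t = 0 then u₀ x else u x t, ⟨fun S hS _ => ?_, hC.congr fun z hz =>
    hvu _ _ hz.1, fun x t ht _ => ?_, ?_, fun K hK => ?_⟩, fun x => if_pos rfl, fun T => ?_⟩
  · refine ⟨2 * M * Real.exp (lam * S), fun x t ht => ?_⟩
    have h1 : 1 ≤ Real.exp (lam * S) := Real.one_le_exp (by positivity)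
    rcases ht.1.eq_or_lt with rfl | h0
    · rw [if_pos rfl]; exact (hM x).trans (by nlinarith)
    · rw [hvu x t h0]
      refine (abs_picardSum_le hβ hu hM hl hlB x t).trans ?_
      have := ht.2
      gcongr
  · have ht' : (fun s => if s = 0 then u₀ x else u x s) =ᶠ[𝓝 t] fun s => u x s := by
      filter_upwards [Ioi_mem_nhds ht] with s hs using hvu x s hs
    have e : (fun y => b y t * u y t) = fun y => causalDrift b y t * u y t := by
      simp only [causalDrift, if_pos ht]
    rw [ht'.deriv_eq]
    simp only [if_neg ht.ne']
    rw [e]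
    exact heq x t ht
  · simp
  · have h1 := tendsto_eLpNorm_heatExtension_sub hu hM hp₀ hup hK
    have h2 : Tendsto (fun t : ℝ => volume K * ENNReal.ofReal (A 1 * √t * M)) (𝓝[>] 0) (𝓝 0) := by
      have h3 : Tendsto (fun t : ℝ => A 1 * √t * M) (𝓝[>] 0) (𝓝 0) := by
        have : ContinuousAt (fun t : ℝ => A 1 * √t * M) 0 := by fun_prop
        have := this.tendsto
        simp only [Real.sqrt_zero, mul_zero, zero_mul] at this
        exact this.mono_left nhdsWithin_le_nhds
      have h4 := ENNReal.tendsto_ofReal h3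
      rw [ENNReal.ofReal_zero] at h4
      have := ENNReal.Tendsto.const_mul h4 (Or.inr (hK.measure_lt_top (μ := volume)).ne)
      rwa [mul_zero] at this
    have h5 := h1.add h2
    rw [add_zero] at h5
    refine tendsto_of_tendsto_of_tendsto_of_le_of_le' tendsto_const_nhds h5
      (Eventually.of_forall fun _ => zero_le) ?_
    filter_upwards [Ioo_mem_nhdsGT (zero_lt_one' ℝ)] with t ht
    obtain ⟨hK', -⟩ := isCausalKernel_heatKernelX (lam := 1) one_pos
    have hcF : IsCausal fun y s => causalDrift b y s * picardSum (causalDrift b) u₀ y s :=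
      hβ.isCausal.mul (isCausal_picardSum hβ hu hM hl hlB)
    have hmeas : ∀ {f : ℝ → ℝ → ℝ}, IsCausal f → Measurable (fun x => f x t) := fun hf =>
      hf.measurable.comp (by fun_prop : Measurable fun x : ℝ => ((x, t) : ℝ × ℝ))
    have e : (fun x => (if t = 0 then u₀ x else u x t) - u₀ x)
        = (fun x => (kernelInt heatKernel u₀ x t - u₀ x)) - fun x => kernelConv heatKernelX
          (fun y s => causalDrift b y s * picardSum (causalDrift b) u₀ y s) x t := by
      funext x
      rw [hvu x t ht.1, hudef, picardSum_eq hβ hu hM hl hlB]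
      simp only [Pi.sub_apply]; ring
    rw [e]
    refine (eLpNorm_sub_le ((hmeas (isCausal_heatExtension hu)).sub hu).aestronglyMeasurable
      (hmeas (hcF.kernelConv hK')).aestronglyMeasurable le_rfl).trans (add_le_add le_rfl ?_)
    refine (eLpNorm_le_of_ae_bound (C := A 1 * √t * M) (Eventually.of_forall fun x => ?_)).trans ?_
    · refine (abs_kernelConv_picardSum_le hβ hu hM hl hlB ht.1).trans ?_
      have := hAm ht.2.le
      simp only [hA] at this ⊢
      gcongr
    · simp
  · refine ⟨A T, hA0 T, fun t ht htT => ?_⟩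
    rcases ht.eq_or_lt with rfl | h0
    · simpa using hM
    have hAt := hAm htT
    simp only [if_neg h0.ne']
    refine ⟨fun x => ?_, fun p hp => ?_⟩
    · have h1 := abs_heatExtension_le hM x t
      have h2 := abs_kernelConv_picardSum_le hβ hu hM hl hlB (x := x) h0
      rw [hudef, picardSum_eq hβ hu hM hl hlB]
      refine (abs_sub _ _).trans ((add_le_add h1 h2).trans ?_)
      rw [add_mul, one_mul]
      simp only [hA] at hAt ⊢
      gcongr
    · refine (eLpNorm_picardSum_le_of_small hβ hu hM hl hlB hp h0).trans ?_
      simp only [hA] at hAt ⊢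
      gcongr

/-! ### The localized energy inequality -/

section Nash

lemma integral_abs_mul_le_sqrt {f g : ℝ → ℝ} (hf : Continuous f) (hf' : HasCompactSupport f)
    (hg : Continuous g) (hg' : HasCompactSupport g) :
    ∫ x, |f x| * |g x| ≤ √(∫ x, f x ^ 2) * √(∫ x, g x ^ 2) := by
  have h := integral_mul_norm_le_Lp_mul_Lq (μ := (volume : Measure ℝ)) Real.HolderConjugate.two_two
    (hf.memLp_of_hasCompactSupport hf') (hg.memLp_of_hasCompactSupport hg')
  simpa [Real.sqrt_eq_rpow] using h

/-- Nash's inequality on the line, `‖v‖₂³ ≤ ‖v‖₁² ‖v'‖₂`. -/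
lemma nash_inequality {v v' : ℝ → ℝ} (hv : ∀ x, HasDerivAt v (v' x) x) (hv' : Continuous v')
    (hs : HasCompactSupport v) :
    √(∫ x, v x ^ 2) ^ 3 ≤ (∫ x, |v x|) ^ 2 * √(∫ x, v' x ^ 2) := by
  have hvc : Continuous v := continuous_iff_continuousAt.2 fun x => (hv x).continuousAt
  have hdv : deriv v = v' := funext fun x => (hv x).deriv
  have hs' : HasCompactSupport v' := hdv ▸ hs.deriv
  have hsq : ∀ x, HasDerivAt (fun x => v x ^ 2) (2 * (v x * v' x)) x := fun x =>
    ((hv x).fun_pow 2).congr_deriv (by norm_num; ring)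
  have hdsq : deriv (fun x => v x ^ 2) = fun x => 2 * (v x * v' x) :=
    funext fun x => (hsq x).deriv
  have hC : ContDiff ℝ 1 fun x => v x ^ 2 := contDiff_one_iff_deriv.2
    ⟨fun x => (hsq x).differentiableAt, by rw [hdsq]; fun_prop⟩
  have hsc : HasCompactSupport fun x => v x ^ 2 := HasCompactSupport.intro hs fun x hx => by
    simp [image_eq_zero_of_notMem_tsupport hx]
  have hI : Integrable fun x => |v x| * |v' x| :=
    (by fun_prop : Continuous fun x => |v x| * |v' x|).integrable_of_hasCompactSupport
      (hs.abs.mul_right)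
  have hIm : Integrable fun x => v x * v' x :=
    (by fun_prop : Continuous fun x => v x * v' x).integrable_of_hasCompactSupport hs.mul_right
  have hI1 : Integrable fun x => |v x| := hvc.abs.integrable_of_hasCompactSupport hs.abs
  set X := √(∫ x, v' x ^ 2) with hX
  set Y := √(∫ x, v x ^ 2) with hY
  set A := ∫ x, |v x| with hA
  have hX0 : 0 ≤ X := Real.sqrt_nonneg _
  have hY0 : 0 ≤ Y := Real.sqrt_nonneg _
  have hA0 : 0 ≤ A := integral_nonneg fun x => abs_nonneg _
  have hXY := integral_abs_mul_le_sqrt hvc hs hv' hs'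
  -- `v²` is bounded by `∫ |v v'|`: average the integrals of `2 v v'` over the two half-lines.
  have hsup : ∀ x, v x ^ 2 ≤ Y * X := by
    intro x
    refine le_trans ?_ hXY
    have h1 := HasCompactSupport.integral_Iic_deriv_eq hC hsc x
    have h2 := HasCompactSupport.integral_Ioi_deriv_eq hC hsc x
    rw [hdsq] at h1 h2
    have h3 : ∀ s : Set ℝ, |∫ y in s, 2 * (v y * v' y)| ≤ 2 * ∫ y in s, |v y| * |v' y| := by
      intro s
      rw [integral_const_mul, abs_mul, abs_two]
      gcongr
      refine (abs_integral_le_integral_abs).trans (le_of_eq ?_)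
      simp_rw [abs_mul]
    have h4 := h3 (Iic x)
    have h5 := h3 (Ioi x)
    rw [h1] at h4
    rw [h2, abs_neg] at h5
    have h6 := intervalIntegral.integral_Iic_add_Ioi (b := x) hI.integrableOn hI.integrableOn
    have h7 := le_abs_self (v x ^ 2)
    linarith
  have hsup' : ∀ x, |v x| ≤ √(Y * X) := fun x => Real.abs_le_sqrt (hsup x)
  have hYA : Y ^ 2 ≤ √(Y * X) * A := by
    rw [hY, Real.sq_sqrt (integral_nonneg fun x => sq_nonneg _), hA, ← integral_const_mul]
    refine integral_mono (hC.continuous.integrable_of_hasCompactSupport hsc)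
      (hI1.const_mul _) fun x => ?_
    beta_reduce
    rw [← sq_abs, sq]
    exact mul_le_mul_of_nonneg_right (hsup' x) (abs_nonneg _)
  rcases hY0.eq_or_lt with h0 | h0
  · rw [← h0, zero_pow three_ne_zero]; positivity
  have h4 : Y ^ 2 * Y ^ 2 ≤ (Y * X) * A ^ 2 := by
    calc Y ^ 2 * Y ^ 2 ≤ (√(Y * X) * A) * (√(Y * X) * A) :=
          mul_le_mul hYA hYA (by positivity) (by positivity)
      _ = (√(Y * X) * √(Y * X)) * A ^ 2 := by ring
      _ = _ := by rw [Real.mul_self_sqrt (by positivity)]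
  nlinarith [mul_pos h0 h0]

end Nash

section Powers

lemma hasDerivAt_abs_rpow_mul {r : ℝ} (hr : 0 ≤ r) (x : ℝ) :
    HasDerivAt (fun x : ℝ => |x| ^ r * x) ((r + 1) * |x| ^ r) x := by
  rcases lt_trichotomy x 0 with hx | rfl | hx
  · have h := (((hasDerivAt_id x).neg).rpow_const (p := r + 1) (Or.inl (by simpa using hx.ne))).neg
    refine (h.congr_of_eventuallyEq ?_).congr_deriv ?_
    · filter_upwards [Iio_mem_nhds hx] with y hy
      have hy' : 0 < -y := neg_pos.2 hy
      simp only [Pi.neg_apply, id]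
      rw [abs_of_neg hy, Real.rpow_add_one hy'.ne']; ring
    · simp only [Pi.neg_apply, id, abs_of_neg hx]
      rw [add_sub_cancel_right]; ring
  · rw [hasDerivAt_iff_tendsto_slope_zero]
    have hc : Tendsto (fun t : ℝ => |t| ^ r) (𝓝[≠] 0) (𝓝 (|0| ^ r)) :=
      ((continuous_abs.rpow_const fun _ => Or.inr hr).tendsto 0).mono_left nhdsWithin_le_nhds
    have e : (r + 1) * |(0 : ℝ)| ^ r = |0| ^ r := by
      rcases hr.eq_or_lt with rfl | h
      · simp
      · simp [Real.zero_rpow h.ne']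
    rw [e]
    refine hc.congr' ?_
    filter_upwards [self_mem_nhdsWithin] with t (ht : t ≠ 0)
    simp only [zero_add, mul_zero, sub_zero, smul_eq_mul]
    field_simp
  · have h := ((hasDerivAt_id x).rpow_const (p := r + 1) (Or.inl hx.ne'))
    refine (h.congr_of_eventuallyEq ?_).congr_deriv ?_
    · filter_upwards [Ioi_mem_nhds hx] with y hy
      simp only [id]
      rw [abs_of_pos hy, Real.rpow_add_one (ne_of_gt hy)]
    · simp only [id, abs_of_pos hx]
      rw [add_sub_cancel_right]; ring

lemma abs_rpow_half_sq {q : ℝ} (x : ℝ) : (|x| ^ (q / 2 - 1)) ^ 2 = |x| ^ (q - 2) := by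
  rw [← Real.rpow_natCast, ← Real.rpow_mul (abs_nonneg x)]
  congr 1; push_cast; ring

lemma abs_rpow_sub_two_mul_sq {q : ℝ} (hq : 2 ≤ q) (x : ℝ) : |x| ^ (q - 2) * x ^ 2 = |x| ^ q := by
  rw [← sq_abs x, ← Real.rpow_natCast, ← Real.rpow_add_of_nonneg (abs_nonneg x) (by linarith)
    (by norm_num)]
  congr 1; push_cast; ring

lemma abs_rpow_half_mul {q : ℝ} (hq : 2 ≤ q) (x : ℝ) :
    |x| ^ (q / 2 - 1) * |x| = |x| ^ (q / 2) := by
  nth_rewrite 2 [← Real.rpow_one |x|]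
  rw [← Real.rpow_add_of_nonneg (abs_nonneg x) (by linarith) zero_le_one]
  congr 1; ring

end Powers

/-- The pointwise form of the energy inequality: `c = φ' s w`, `d = φ s w`, `a = φ s w_x` with
`s = |w|^{q/2-1}`, and `V = c + (q/2) a` is the derivative of `d`. -/
lemma energy_pointwise {q m m' μ β a c d V : ℝ} (hq : 2 ≤ q) (hμ : |μ| ≤ m) (hβ : |β| ≤ m')
    (hV : V = c + q / 2 * a) :
    -2 * q * (a * c) + 2 * q * (c * d) * μ - q * (q - 1) * a ^ 2 + q * (q - 1) * (a * d) * μ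
        + 2 * β * (c * d)
      ≤ -(4 * (q - 1) / q) * V ^ 2 + 2 * (q - 1) * m * (|V| * |d|)
        + (4 + 4 * q * m + 2 * m') * (|V| * |c| + |c| * |d| + c ^ 2) := by
  have hq0 : 0 < q := by linarith
  have hm : 0 ≤ m := (abs_nonneg _).trans hμ
  have hm' : 0 ≤ m' := (abs_nonneg _).trans hβ
  have ha : a = 2 / q * (V - c) := by rw [hV]; field_simp; ring
  have e : -2 * q * (a * c) + 2 * q * (c * d) * μ - q * (q - 1) * a ^ 2
      + q * (q - 1) * (a * d) * μ + 2 * β * (c * d)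
      = -(4 * (q - 1) / q) * V ^ 2 + 2 * (q - 1) * (V * d * μ) + (4 - 8 / q) * (V * c)
        + 4 / q * c ^ 2 + 2 * (c * d * μ) + 2 * (c * d * β) := by
    rw [ha]; field_simp; ring
  have h1 : V * d * μ ≤ |V| * |d| * m := by
    refine (le_abs_self _).trans ?_
    rw [abs_mul, abs_mul]; gcongr
  have h2 : c * d * μ ≤ |c| * |d| * m := by
    refine (le_abs_self _).trans ?_
    rw [abs_mul, abs_mul]; gcongr
  have h3 : c * d * β ≤ |c| * |d| * m' := by
    refine (le_abs_self _).trans ?_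
    rw [abs_mul, abs_mul]; gcongr
  have h4 : V * c ≤ |V| * |c| := by rw [← abs_mul]; exact le_abs_self _
  have h8 : 0 ≤ 4 - 8 / q := by rw [sub_nonneg, div_le_iff₀ hq0]; linarith
  have h8' : 0 < 8 / q := by positivity
  have h9 : 4 / q ≤ 4 := by rw [div_le_iff₀ hq0]; linarith
  have k1 := mul_le_mul_of_nonneg_left h1 (by linarith : 0 ≤ 2 * (q - 1))
  have k2 := mul_le_mul_of_nonneg_left h4 h8
  have k3 := mul_le_mul_of_nonneg_right h9 (sq_nonneg c)
  have p1 : 0 ≤ |V| * |c| := by positivity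
  have p2 : 0 ≤ |c| * |d| := by positivity
  have p3 : 0 ≤ c ^ 2 := sq_nonneg c
  have p4 : 0 ≤ q * m := by positivity
  have k4 : (4 - 8 / q) * (|V| * |c|) ≤ 4 * (|V| * |c|) := by nlinarith
  have k5 : 2 * (|c| * |d| * m) ≤ 4 * q * m * (|c| * |d|) := by
    have := mul_nonneg hm p2
    nlinarith
  rw [e]
  have k6 : 0 ≤ (4 * q * m + 2 * m') * (|V| * |c|) := by positivity
  have k7 : 0 ≤ (4 * q * m + 2 * m') * c ^ 2 := by positivity
  nlinarith

section EnergyInequality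

variable {φ φ' w w₁ w₂ f h ut : ℝ → ℝ} {q β m m' : ℝ}

/-- The energy inequality at a fixed time. Multiply `u_t = (u_x - (f - β) u)_x - β u_x` by
`φ² q |u|^{q-2} u` and integrate by parts; the function `v = φ |u|^{q/2-1} u` collects the main
terms, and Nash's inequality applies to it since it has compact support. -/
lemma energy_inequality (hq : 2 ≤ q) (hφ : ∀ x, HasDerivAt φ (φ' x) x) (hφ' : Continuous φ')
    (hφs : HasCompactSupport φ) (hφ0 : ∀ x, 0 ≤ φ x)
    (hw : ∀ x, HasDerivAt w (w₁ x) x) (hw₁ : ∀ x, HasDerivAt w₁ (w₂ x) x)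
    (hf : Continuous f) (hfw : ∀ x, HasDerivAt (fun x => f x * w x) (h x) x)
    (hut : Continuous ut) (heq : ∀ x, ut x + h x = w₂ x)
    (hm : ∀ x, |f x - β| ≤ m) (hm' : |β| ≤ m') :
    ∃ X, 0 ≤ X ∧ √(∫ x, φ x ^ 2 * |w x| ^ q) ^ 3 ≤ (∫ x, φ x * |w x| ^ (q / 2)) ^ 2 * X ∧
      ∫ x, φ x ^ 2 * (q * |w x| ^ (q - 2) * w x * ut x)
        ≤ -(4 * (q - 1) / q) * X ^ 2 + 2 * (q - 1) * m * (X * √(∫ x, φ x ^ 2 * |w x| ^ q))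
          + (4 + 4 * q * m + 2 * m') * ((X + √(∫ x, φ x ^ 2 * |w x| ^ q)
            + √(∫ x, φ' x ^ 2 * |w x| ^ q)) * √(∫ x, φ' x ^ 2 * |w x| ^ q)) := by
  have hq0 : 0 < q := by linarith
  have hm0 : 0 ≤ m := (abs_nonneg _).trans (hm 0)
  have hm0' : 0 ≤ m' := (abs_nonneg _).trans hm'
  have hdφ : deriv φ = φ' := funext fun x => (hφ x).deriv
  have hφs' : HasCompactSupport φ' := hdφ ▸ hφs.deriv
  have hφc : Continuous φ := continuous_iff_continuousAt.2 fun x => (hφ x).continuousAt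
  have hwc : Continuous w := continuous_iff_continuousAt.2 fun x => (hw x).continuousAt
  have hw₁c : Continuous w₁ := continuous_iff_continuousAt.2 fun x => (hw₁ x).continuousAt
  have hsupp : ∀ {g : ℝ → ℝ}, (∀ x, φ x = 0 → φ' x = 0 → g x = 0) → HasCompactSupport g :=
    fun hg => HasCompactSupport.intro hφs fun x hx => hg x (image_eq_zero_of_notMem_tsupport hx) <| by
      have := notMem_subset (support_deriv_subset (f := φ)) hx
      rwa [hdφ, Function.notMem_support] at this
  -- the factor `s = |w|^{q/2-1}`
  set s : ℝ → ℝ := fun x => |w x| ^ (q / 2 - 1) with hs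
  have hsc : Continuous s := hwc.abs.rpow_const fun x => Or.inr (by linarith)
  have hs2 : ∀ x, |w x| ^ (q - 2) = s x ^ 2 := fun x => (abs_rpow_half_sq (w x)).symm
  have hsq : ∀ x, |w x| ^ q = s x ^ 2 * w x ^ 2 := fun x => by
    rw [← hs2, abs_rpow_sub_two_mul_sq hq]
  have hsh : ∀ x, |w x| ^ (q / 2) = s x * |w x| := fun x => (abs_rpow_half_mul hq (w x)).symm
  set v : ℝ → ℝ := fun x => φ x * (s x * w x) with hv
  set c : ℝ → ℝ := fun x => φ' x * (s x * w x) with hc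
  set a : ℝ → ℝ := fun x => φ x * (s x * w₁ x) with ha
  set V : ℝ → ℝ := fun x => c x + q / 2 * a x with hV
  have hvd : ∀ x, HasDerivAt v (V x) x := fun x => by
    have h1 := (hasDerivAt_abs_rpow_mul (by linarith : 0 ≤ q / 2 - 1) (w x)).comp x (hw x)
    refine ((hφ x).mul h1).congr_deriv ?_
    simp only [hV, hc, ha, hs, Function.comp]; ring
  have hcc : Continuous c := by fun_prop
  have hac : Continuous a := by fun_prop
  have hvc : Continuous v := by fun_prop
  have hVc : Continuous V := by fun_prop
  have hvs : HasCompactSupport v := hφs.mul_right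
  have hcs : HasCompactSupport c := hφs'.mul_right
  have hVs : HasCompactSupport V := by
    have : deriv v = V := funext fun x => (hvd x).deriv
    exact this ▸ hvs.deriv
  have ev : ∀ x, v x ^ 2 = φ x ^ 2 * |w x| ^ q := fun x => by rw [hsq]; simp only [hv]; ring
  have ec : ∀ x, c x ^ 2 = φ' x ^ 2 * |w x| ^ q := fun x => by rw [hsq]; simp only [hc]; ring
  have eva : ∀ x, |v x| = φ x * |w x| ^ (q / 2) := fun x => by
    rw [hsh]; simp only [hv]
    rw [abs_mul, abs_mul, abs_of_nonneg (hφ0 x),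
      abs_of_nonneg (Real.rpow_nonneg (abs_nonneg (w x)) _)]
  simp_rw [← ev, ← ec, ← eva]
  refine ⟨√(∫ x, V x ^ 2), Real.sqrt_nonneg _, nash_inequality hvd hVc hvs, ?_⟩
  -- integration by parts
  set E : ℝ → ℝ := fun x => -2 * q * (a x * c x) + 2 * q * (c x * v x) * (f x - β)
    - q * (q - 1) * a x ^ 2 + q * (q - 1) * (a x * v x) * (f x - β) + 2 * β * (c x * v x) with hE
  have hEc : Continuous E := by fun_prop
  have hEs : HasCompactSupport E := hsupp fun x h1 h2 => by simp [hE, ha, hc, hv, h1, h2]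
  set Ψ : ℝ → ℝ := fun x => φ x ^ 2 * (q * (|w x| ^ (q - 2) * w x) * (w₁ x - (f x * w x - β * w x))
    - β * |w x| ^ q) with hΨ
  have hΨd : ∀ x, HasDerivAt Ψ (φ x ^ 2 * (q * |w x| ^ (q - 2) * w x * ut x) - E x) x := by
    intro x
    have h1 := (hasDerivAt_abs_rpow_mul (by linarith : 0 ≤ q - 2) (w x)).comp x (hw x)
    have h2 := (hasDerivAt_abs_rpow (w x) (by linarith : 1 < q)).comp x (hw x)
    have h3 := (hw₁ x).sub ((hfw x).sub ((hw x).const_mul β))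
    have h4 := ((hφ x).fun_pow 2).mul (((h1.const_mul q).mul h3).sub (h2.const_mul β))
    refine h4.congr_deriv ?_
    simp only [hE, ha, hc, hv, Function.comp, Pi.sub_apply, ← heq x, Pi.mul_apply]
    rw [hsq x, hs2 x]
    norm_num
    ring
  have hwq : Continuous fun x => |w x| ^ (q - 2) := hwc.abs.rpow_const fun x => Or.inr (by linarith)
  have hwq' : Continuous fun x => |w x| ^ q := hwc.abs.rpow_const fun x => Or.inr (by linarith)
  have hLi : Integrable fun x => φ x ^ 2 * (q * |w x| ^ (q - 2) * w x * ut x) :=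
    (by fun_prop : Continuous fun x => φ x ^ 2 * (q * |w x| ^ (q - 2) * w x * ut x))
      |>.integrable_of_hasCompactSupport (hsupp fun x h1 _ => by simp [h1])
  have hEi : Integrable E := hEc.integrable_of_hasCompactSupport hEs
  have hΨi : ∫ x, (φ x ^ 2 * (q * |w x| ^ (q - 2) * w x * ut x) - E x) = 0 :=
    integral_eq_zero_of_hasDerivAt_of_integrable hΨd (hLi.sub hEi)
      ((by fun_prop : Continuous Ψ).integrable_of_hasCompactSupport
        (hsupp fun x h1 _ => by simp [hΨ, h1]))
  rw [integral_sub hLi hEi, sub_eq_zero] at hΨi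
  rw [hΨi]
  have habs : ∀ {g₁ g₂ : ℝ → ℝ}, Continuous g₁ → Continuous g₂ → HasCompactSupport g₁ →
      Integrable fun x => |g₁ x| * |g₂ x| := fun h1 h2 h3 =>
    (h1.abs.mul h2.abs).integrable_of_hasCompactSupport (h3.abs.mul_right)
  have i1 : Integrable fun x => V x ^ 2 := by simpa [sq] using habs hVc hVc hVs
  have i2 := habs hVc hvc hVs
  have i3 := habs hVc hcc hVs
  have i4 := habs hcc hvc hcs
  have i5 : Integrable fun x => c x ^ 2 := by simpa [sq] using habs hcc hcc hcs
  have i34 : Integrable fun x => |V x| * |c x| + |c x| * |v x| := i3.add i4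
  have j1 : Integrable fun x => -(4 * (q - 1) / q) * V x ^ 2 + 2 * (q - 1) * m * (|V x| * |v x|) :=
    (i1.const_mul _).add (i2.const_mul _)
  have j2 : Integrable fun x => |V x| * |c x| + |c x| * |v x| + c x ^ 2 := i34.add i5
  have hmono : ∫ x, E x ≤ ∫ x, (-(4 * (q - 1) / q) * V x ^ 2 + 2 * (q - 1) * m * (|V x| * |v x|)
      + (4 + 4 * q * m + 2 * m') * (|V x| * |c x| + |c x| * |v x| + c x ^ 2)) :=
    integral_mono hEi (j1.add (j2.const_mul _)) fun x => energy_pointwise hq (hm x) hm' rfl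
  refine hmono.trans ?_
  rw [integral_add j1 (j2.const_mul _), integral_add (i1.const_mul _) (i2.const_mul _),
    integral_const_mul, integral_const_mul, integral_const_mul, integral_add i34 i5,
    integral_add i3 i4]
  have c2 := integral_abs_mul_le_sqrt hVc hVs hvc hvs
  have c3 := integral_abs_mul_le_sqrt hVc hVs hcc hcs
  have c4 := integral_abs_mul_le_sqrt hcc hcs hvc hvs
  have e1 : √(∫ x, V x ^ 2) ^ 2 = ∫ x, V x ^ 2 := Real.sq_sqrt (integral_nonneg fun x => sq_nonneg _)
  have e5 : √(∫ x, c x ^ 2) * √(∫ x, c x ^ 2) = ∫ x, c x ^ 2 :=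
    Real.mul_self_sqrt (integral_nonneg fun x => sq_nonneg _)
  have hq1 : 0 ≤ q - 1 := by linarith
  rw [e1]
  gcongr
  rw [add_mul, add_mul, e5]
  gcongr
  rwa [mul_comm (√(∫ x, v x ^ 2))]

end EnergyInequality

/-! ### Cutoffs and the localized energy -/

section Cutoff

/-- A fixed smooth bump function, equal to `1` on `[-1,1]` and supported in `[-2,2]`. -/
noncomputable def unitBump : ContDiffBump (0 : ℝ) := ⟨1, 2, one_pos, one_lt_two⟩

/-- The smooth cutoff at scale `R`. -/
noncomputable def cutoff (R x : ℝ) : ℝ := unitBump (x / R)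

lemma cutoff_nonneg (R x : ℝ) : 0 ≤ cutoff R x := unitBump.nonneg

lemma cutoff_le_one (R x : ℝ) : cutoff R x ≤ 1 := unitBump.le_one

variable {R : ℝ}

lemma cutoff_eq_one (hR : 0 < R) {x : ℝ} (hx : |x| ≤ R) : cutoff R x = 1 := by
  refine unitBump.one_of_mem_closedBall ?_
  rw [mem_closedBall_zero_iff, Real.norm_eq_abs, abs_div, abs_of_pos hR, div_le_iff₀ hR]
  simpa [unitBump] using hx

lemma contDiff_unitBump : ContDiff ℝ 1 unitBump := by exact_mod_cast unitBump.contDiff (n := 1)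

lemma hasDerivAt_cutoff (R x : ℝ) :
    HasDerivAt (cutoff R) (deriv unitBump (x / R) * (1 / R)) x :=
  (contDiff_unitBump.differentiable one_ne_zero _).hasDerivAt.comp x
    ((hasDerivAt_id x).div_const R)

lemma continuous_deriv_unitBump : Continuous (deriv unitBump) :=
  contDiff_unitBump.continuous_deriv le_rfl

lemma continuous_cutoff (R : ℝ) : Continuous (cutoff R) :=
  continuous_iff_continuousAt.2 fun x => (hasDerivAt_cutoff R x).continuousAt

lemma hasCompactSupport_cutoff (hR : 0 < R) : HasCompactSupport (cutoff R) := by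
  refine HasCompactSupport.intro (isCompact_Icc (a := -(2 * R)) (b := 2 * R)) fun x hx => ?_
  refine unitBump.zero_of_le_dist ?_
  rw [mem_Icc, ← abs_le, not_le] at hx
  rw [dist_zero_right, Real.norm_eq_abs, abs_div, abs_of_pos hR, le_div_iff₀ hR]
  exact hx.le

lemma hasCompactSupport_deriv_unitBump : HasCompactSupport (deriv unitBump) :=
  unitBump.hasCompactSupport.deriv

/-- The cutoffs have small gradients: `∫ (φ_R')² g ≤ C / R` for bounded `g`. -/
lemma exists_integral_deriv_cutoff_sq_le : ∃ D, 0 ≤ D ∧ ∀ (R : ℝ) (g : ℝ → ℝ) (K : ℝ), 0 < R →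
    (∀ x, 0 ≤ g x) → (∀ x, g x ≤ K) →
    ∫ x, (deriv unitBump (x / R) * (1 / R)) ^ 2 * g x ≤ D * K / R := by
  have hcs : HasCompactSupport fun x => deriv unitBump x ^ 2 :=
    HasCompactSupport.intro hasCompactSupport_deriv_unitBump fun x hx => by
      simp [image_eq_zero_of_notMem_tsupport hx]
  have hc : Continuous fun x => deriv unitBump x ^ 2 := continuous_deriv_unitBump.pow 2
  refine ⟨∫ x, deriv unitBump x ^ 2, integral_nonneg fun x => sq_nonneg _, fun R g K hR hg hK => ?_⟩
  have hI : Integrable fun x => deriv unitBump (x / R) ^ 2 :=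
    (hc.integrable_of_hasCompactSupport hcs).comp_div hR.ne'
  have h1 := Measure.integral_comp_div (fun x => deriv unitBump x ^ 2) R
  rw [abs_of_pos hR, smul_eq_mul] at h1
  have h2 : ∫ x, (deriv unitBump (x / R) * (1 / R)) ^ 2 * g x
      ≤ ∫ x, deriv unitBump (x / R) ^ 2 * ((1 / R) ^ 2 * K) := by
    refine integral_mono_of_nonneg (Eventually.of_forall fun x => mul_nonneg (sq_nonneg _) (hg x))
      (hI.mul_const _) (Eventually.of_forall fun x => ?_)
    beta_reduce
    rw [mul_pow, mul_assoc]
    have := hK x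
    gcongr
  refine h2.trans (le_of_eq ?_)
  rw [integral_mul_const, h1]
  field_simp

lemma lintegral_le_of_cutoff {g : ℝ → ℝ} (hg : Continuous g) (hg0 : ∀ x, 0 ≤ g x) {N : ℝ}
    (h : ∀ᶠ n : ℕ in atTop, ∫ x, cutoff n x ^ 2 * g x ≤ N) :
    ∫⁻ x, ENNReal.ofReal (g x) ≤ ENNReal.ofReal N := by
  have hlim : ∀ x, Tendsto (fun n : ℕ => ENNReal.ofReal (cutoff n x ^ 2 * g x)) atTop
      (𝓝 (ENNReal.ofReal (g x))) := by
    intro x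
    refine tendsto_const_nhds.congr' ?_
    filter_upwards [eventually_ge_atTop (⌈|x|⌉₊ + 1)] with n hn
    have h1 : |x| ≤ n := (Nat.le_ceil _).trans (by exact_mod_cast (Nat.le_succ _).trans hn)
    have h2 : (0 : ℝ) < n := by exact_mod_cast (Nat.succ_pos _).trans_le hn
    rw [cutoff_eq_one h2 h1]; simp
  have hm : ∀ n : ℕ, Measurable fun x => ENNReal.ofReal (cutoff n x ^ 2 * g x) := fun n =>
    (((continuous_cutoff n).pow 2).mul hg).measurable.ennreal_ofReal
  have h1 := lintegral_liminf_le (μ := volume) (u := (atTop : Filter ℕ)) hm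
  simp_rw [fun x => (hlim x).liminf_eq] at h1
  refine h1.trans ?_
  refine liminf_le_of_frequently_le' (Eventually.frequently ?_)
  filter_upwards [h, eventually_gt_atTop 0] with n hn hn0
  have hn0' : (0 : ℝ) < n := by exact_mod_cast hn0
  have hcs : HasCompactSupport fun x => cutoff n x ^ 2 * g x :=
    HasCompactSupport.intro (hasCompactSupport_cutoff hn0') fun x hx => by
      simp [image_eq_zero_of_notMem_tsupport hx]
  have hI : Integrable fun x => cutoff n x ^ 2 * g x :=
    (((continuous_cutoff n).pow 2).mul hg).integrable_of_hasCompactSupport hcs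
  rw [← ofReal_integral_eq_lintegral_ofReal hI
    (Eventually.of_forall fun x => mul_nonneg (sq_nonneg _) (hg0 x))]
  exact ENNReal.ofReal_le_ofReal hn

end Cutoff

/-- `u` solves `u_t + (b u)_x = u_xx` classically on `ℝ × (0,T)`. -/
structure IsClassicalSolution (b : ℝ → ℝ → ℝ) (T : EReal) (u : ℝ → ℝ → ℝ) : Prop where
  isC21 : IsC21 T u
  equation : ∀ x t : ℝ, 0 < t → (t : EReal) < T →
    deriv (fun s => u x s) t + deriv (fun y => b y t * u y t) x = deriv (deriv fun y => u y t) x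

section LocalEnergy

variable {b u : ℝ → ℝ → ℝ} {T : EReal} {t : ℝ}

lemma continuous_slice_of_strip {g : ℝ → ℝ → ℝ}
    (hg : ContinuousOn (fun z : ℝ × ℝ => g z.1 z.2) (openStrip T)) (ht : 0 < t)
    (htT : (t : EReal) < T) : Continuous fun y => g y t :=
  hg.comp_continuous (by fun_prop : Continuous fun y : ℝ => ((y, t) : ℝ × ℝ)) fun _ => ⟨ht, htT⟩

/-- The localized energy `∫ φ² |u(·,t)|^q`. -/
noncomputable def localEnergy (φ : ℝ → ℝ) (q : ℝ) (u : ℝ → ℝ → ℝ) (t : ℝ) : ℝ :=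
  ∫ x, φ x ^ 2 * |u x t| ^ q

lemma localEnergy_nonneg (φ : ℝ → ℝ) (q : ℝ) (u : ℝ → ℝ → ℝ) (t : ℝ) :
    0 ≤ localEnergy φ q u t :=
  integral_nonneg fun _ => mul_nonneg (sq_nonneg _) (Real.rpow_nonneg (abs_nonneg _) _)

lemma hasDerivAt_localEnergy (hu : IsC21 T u) {q : ℝ} (hq : 2 ≤ q) {φ : ℝ → ℝ}
    (hφ : Continuous φ) (hφs : HasCompactSupport φ) (ht : 0 < t) (htT : (t : EReal) < T) :
    HasDerivAt (localEnergy φ q u) (∫ x, φ x ^ 2 *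
      (q * |u x t| ^ (q - 2) * u x t * deriv (fun s => u x s) t)) t := by
  obtain ⟨T', htT', hT'⟩ := EReal.lt_iff_exists_real_btwn.1 htT
  have htT' : t < T' := by exact_mod_cast htT'
  have hsub : tsupport φ ×ˢ Icc (t / 2) T' ⊆ openStrip T := fun r hr =>
    ⟨lt_of_lt_of_le (by positivity) hr.2.1, (EReal.coe_le_coe_iff.2 hr.2.2).trans_lt hT'⟩
  have hg : ContinuousOn (fun z : ℝ × ℝ => φ z.1 ^ 2 * |u z.1 z.2| ^ q) (openStrip T) :=
    ((hφ.comp continuous_fst).pow 2).continuousOn.mul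
      (hu.continuousOn.abs.rpow_const fun _ _ => Or.inr (by linarith))
  have hg' : ContinuousOn (fun z : ℝ × ℝ => φ z.1 ^ 2 *
      (q * |u z.1 z.2| ^ (q - 2) * u z.1 z.2 * deriv (fun s => u z.1 s) z.2)) (openStrip T) :=
    ((hφ.comp continuous_fst).pow 2).continuousOn.mul (((continuousOn_const.mul
      (hu.continuousOn.abs.rpow_const fun _ _ => Or.inr (by linarith))).mul hu.continuousOn).mul
      hu.continuousOn_t)
  obtain ⟨C, hC⟩ := (hφs.isCompact.prod isCompact_Icc).exists_bound_of_continuousOn (hg'.mono hsub)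
  have hslice : ∀ s : ℝ, 0 < s → (s : EReal) < T →
      Continuous fun x => φ x ^ 2 * |u x s| ^ q := fun s hs hsT =>
    continuous_slice_of_strip (g := fun x s => φ x ^ 2 * |u x s| ^ q) hg hs hsT
  refine (hasDerivAt_integral_of_dominated_loc_of_deriv_le
    (F := fun s x => φ x ^ 2 * |u x s| ^ q) (F' := fun s x => φ x ^ 2 *
      (q * |u x s| ^ (q - 2) * u x s * deriv (fun s => u x s) s))
    (bound := (tsupport φ).indicator fun _ => C)
    (Icc_mem_nhds (half_lt_self ht) htT') ?_ ?_ ?_ ?_ ?_ ?_).2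
  · filter_upwards [Ioo_mem_nhds ht htT'] with s hs
    exact (hslice s hs.1 ((EReal.coe_lt_coe_iff.2 hs.2).trans hT')).aestronglyMeasurable
  · exact (hslice t ht htT).integrable_of_hasCompactSupport
      (HasCompactSupport.intro hφs fun x hx => by simp [image_eq_zero_of_notMem_tsupport hx])
  · exact (continuous_slice_of_strip (g := fun x s => φ x ^ 2 *
      (q * |u x s| ^ (q - 2) * u x s * deriv (fun s => u x s) s)) hg' ht htT).aestronglyMeasurable
  · refine Eventually.of_forall fun x s hs => ?_
    by_cases hx : x ∈ tsupport φ
    · rw [indicator_of_mem hx]; exact hC (x, s) ⟨hx, hs⟩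
    · rw [indicator_of_notMem hx, image_eq_zero_of_notMem_tsupport hx]; simp
  · exact (integrable_indicator_iff hφs.isCompact.measurableSet).2
      (integrableOn_const hφs.isCompact.measure_lt_top.ne)
  · refine Eventually.of_forall fun x s hs => ?_
    have hd := (hu.differentiableAt_t (x, s) ⟨lt_of_lt_of_le (by positivity) hs.1,
      (EReal.coe_le_coe_iff.2 hs.2).trans_lt hT'⟩).hasDerivAt
    exact ((hasDerivAt_abs_rpow (u x s) (by linarith : 1 < q)).comp s hd).const_mul _

lemma IsAdvectionField.differentiable_slice (hb : IsAdvectionField b) (ht : 0 < t) :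
    Differentiable ℝ fun y => b y t := fun y => by
  have hmem : univ ×ˢ Ici (0 : ℝ) ∈ 𝓝 ((y, t) : ℝ × ℝ) :=
    prod_mem_nhds univ_mem (Ici_mem_nhds ht)
  have h : DifferentiableAt ℝ (fun z : ℝ × ℝ => b z.1 z.2) (y, t) :=
    (hb.contDiffOn.differentiableOn one_ne_zero).differentiableAt hmem
  exact DifferentiableAt.comp (g := fun z : ℝ × ℝ => b z.1 z.2)
    (f := fun y : ℝ => ((y, t) : ℝ × ℝ)) y h (by fun_prop)

/-- The energy inequality for the cutoff at scale `R`, in terms of `Y = √(∫ φ² |u|^q)`, of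
`X = ‖(φ |u|^{q/2-1} u)_x‖₂` and of the cutoff error `ε = O(R^{-1/2})`. -/
lemma IsClassicalSolution.localEnergy_inequality (hb : IsAdvectionField b)
    (hu : IsClassicalSolution b T u) {q β m m' R : ℝ} (hq : 2 ≤ q) (hR : 0 < R) (ht : 0 < t)
    (htT : (t : EReal) < T) (hm : ∀ x, |b x t - β| ≤ m) (hm' : |β| ≤ m') {K D : ℝ}
    (hK : ∀ x, |u x t| ≤ K)
    (hD : ∀ (R : ℝ) (g : ℝ → ℝ) (K : ℝ), 0 < R → (∀ x, 0 ≤ g x) → (∀ x, g x ≤ K) →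
      ∫ x, (deriv unitBump (x / R) * (1 / R)) ^ 2 * g x ≤ D * K / R) :
    ∃ y' X ε, HasDerivAt (localEnergy (cutoff R) q u) y' t ∧ 0 ≤ X ∧ 0 ≤ ε ∧
      ε ^ 2 ≤ D * K ^ q / R ∧
      √(localEnergy (cutoff R) q u t) ^ 3 ≤ (∫ x, cutoff R x * |u x t| ^ (q / 2)) ^ 2 * X ∧
      y' ≤ -(4 * (q - 1) / q) * X ^ 2
        + 2 * (q - 1) * m * (X * √(localEnergy (cutoff R) q u t))
        + (4 + 4 * q * m + 2 * m') * ((X + √(localEnergy (cutoff R) q u t) + ε) * ε) := by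
  have hut := continuous_slice_of_strip (g := fun x s => deriv (fun r => u x r) s)
    hu.isC21.continuousOn_t ht htT
  have hw : ∀ x, HasDerivAt (fun y => u y t) (deriv (fun y => u y t) x) x := fun x =>
    (hu.isC21.differentiableAt_x (x, t) ⟨ht, htT⟩).hasDerivAt
  have hbd := hb.differentiable_slice ht
  obtain ⟨X, hX, h1, h2⟩ := energy_inequality (β := β) hq (hasDerivAt_cutoff R)
    ((continuous_deriv_unitBump.comp (continuous_id.div_const R)).mul continuous_const)
    (hasCompactSupport_cutoff hR) (cutoff_nonneg R) hw
    (fun x => (hu.isC21.differentiableAt_xx (x, t) ⟨ht, htT⟩).hasDerivAt) hbd.continuous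
    (fun x => ((hbd x).mul (hw x).differentiableAt).hasDerivAt) hut
    (fun x => hu.equation x t ht htT) hm hm'
  refine ⟨_, X, _, hasDerivAt_localEnergy hu.isC21 hq (continuous_cutoff R)
    (hasCompactSupport_cutoff hR) ht htT, hX, Real.sqrt_nonneg _, ?_, h1, h2⟩
  rw [Real.sq_sqrt (integral_nonneg fun x =>
    mul_nonneg (sq_nonneg _) (Real.rpow_nonneg (abs_nonneg _) _))]
  exact hD R _ _ hR (fun x => Real.rpow_nonneg (abs_nonneg _) _) fun x => Real.rpow_le_rpow (abs_nonneg _) (hK x) (by linarith)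

end LocalEnergy

/-! ### Uniqueness -/

section Uniqueness

lemma gronwall_from_zero {y y' : ℝ → ℝ} {a c t : ℝ} (ha : 0 < a) (hc : 0 ≤ c) (ht : 0 < t)
    (hy : ∀ s, 0 ≤ y s) (hd : ∀ s ∈ Ioc 0 t, HasDerivAt y (y' s) s) (hle : ∀ s ∈ Ioc 0 t, y' s ≤ a * y s + c)
    (h0 : ∀ δ > 0, ∀ᶠ s in 𝓝[>] 0, y s ≤ δ) : y t ≤ Real.exp (a * t) * (c / a) := by
  have hz : ∀ s ∈ Ioc 0 t, HasDerivAt (fun s => Real.exp (-(a * s)) * (y s + c / a))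
      (Real.exp (-(a * s)) * (y' s - a * y s - c)) s := fun s hs => by
    have h1 : HasDerivAt (fun s => -(a * s)) (-a) s :=
      ((hasDerivAt_id s).const_mul a).fun_neg.congr_deriv (by simp)
    refine (h1.exp.mul ((hd s hs).add_const (c / a))).congr_deriv ?_
    field_simp; ring
  have hmono : ∀ s ∈ Ioo 0 t, y t ≤ Real.exp (a * t) * (y s + c / a) := by
    intro s hs
    have hsub : Icc s t ⊆ Ioc 0 t := fun r hr => ⟨hs.1.trans_le hr.1, hr.2⟩
    have hanti : AntitoneOn (fun s => Real.exp (-(a * s)) * (y s + c / a)) (Icc s t) := by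
      refine antitoneOn_of_deriv_nonpos (convex_Icc s t)
        (fun r hr => (hz r (hsub hr)).continuousAt.continuousWithinAt)
        (fun r hr => (hz r (hsub (interior_subset hr))).differentiableAt.differentiableWithinAt)
        fun r hr => ?_
      have hr' := hsub (interior_subset hr)
      rw [(hz r hr').deriv]
      have := hle r hr'
      exact mul_nonpos_of_nonneg_of_nonpos (Real.exp_pos _).le (by linarith)
    have h1 := hanti (left_mem_Icc.2 hs.2.le) (right_mem_Icc.2 hs.2.le) hs.2.le
    beta_reduce at h1
    have h2 : Real.exp (-(a * s)) ≤ 1 := Real.exp_le_one_iff.2 (by nlinarith [hs.1])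
    have h3 : 0 ≤ y s + c / a := add_nonneg (hy s) (by positivity)
    have h4 : Real.exp (-(a * t)) * (y t + c / a) ≤ y s + c / a :=
      h1.trans (mul_le_of_le_one_left h3 h2)
    rw [Real.exp_neg, inv_mul_le_iff₀ (Real.exp_pos _)] at h4
    exact (le_add_of_nonneg_right (by positivity)).trans h4
  refine le_of_forall_pos_le_add fun δ hδ => ?_
  have hδ' : 0 < δ / Real.exp (a * t) := div_pos hδ (Real.exp_pos _)
  obtain ⟨s, hs, hs'⟩ := ((h0 _ hδ').and (Ioo_mem_nhdsGT ht)).exists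
  refine (hmono s hs').trans ?_
  calc Real.exp (a * t) * (y s + c / a) ≤ Real.exp (a * t) * (δ / Real.exp (a * t) + c / a) := by
        gcongr
    _ = _ := by field_simp; ring

variable {b u v : ℝ → ℝ → ℝ} {T : EReal} {u₀ : ℝ → ℝ}

lemma IsSolution.isClassicalSolution (hu : IsSolution b u₀ T u) : IsClassicalSolution b T u :=
  ⟨hu.isC21, hu.equation⟩

lemma IsClassicalSolution.sub (hb : IsAdvectionField b) (hu : IsClassicalSolution b T u)
    (hv : IsClassicalSolution b T v) : IsClassicalSolution b T fun x t => u x t - v x t := by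
  have hx : ∀ z ∈ openStrip T, (deriv fun y => u y z.2 - v y z.2)
      = fun y => deriv (fun y => u y z.2) y - deriv (fun y => v y z.2) y := fun z hz =>
    funext fun y => deriv_fun_sub (hu.isC21.differentiableAt_x (y, z.2) hz)
      (hv.isC21.differentiableAt_x (y, z.2) hz)
  have ht : ∀ z ∈ openStrip T, deriv (fun s => u z.1 s - v z.1 s) z.2
      = deriv (fun s => u z.1 s) z.2 - deriv (fun s => v z.1 s) z.2 := fun z hz =>
    deriv_fun_sub (hu.isC21.differentiableAt_t z hz) (hv.isC21.differentiableAt_t z hz)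
  have hxx : ∀ z ∈ openStrip T, deriv (deriv fun y => u y z.2 - v y z.2) z.1
      = deriv (deriv fun y => u y z.2) z.1 - deriv (deriv fun y => v y z.2) z.1 := fun z hz => by
    rw [hx z hz]
    exact deriv_fun_sub (hu.isC21.differentiableAt_xx z hz) (hv.isC21.differentiableAt_xx z hz)
  refine ⟨⟨fun z hz => (hu.isC21.differentiableAt_t z hz).sub (hv.isC21.differentiableAt_t z hz),
    fun z hz => (hu.isC21.differentiableAt_x z hz).sub (hv.isC21.differentiableAt_x z hz),
    fun z hz => ?_, hu.isC21.continuousOn.sub hv.isC21.continuousOn,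
    (hu.isC21.continuousOn_t.sub hv.isC21.continuousOn_t).congr ht,
    (hu.isC21.continuousOn_x.sub hv.isC21.continuousOn_x).congr fun z hz => congrFun (hx z hz) z.1,
    (hu.isC21.continuousOn_xx.sub hv.isC21.continuousOn_xx).congr hxx⟩, fun x t h0 hT => ?_⟩
  · rw [hx z hz]
    exact (hu.isC21.differentiableAt_xx z hz).sub (hv.isC21.differentiableAt_xx z hz)
  · have hz : (x, t) ∈ openStrip T := ⟨h0, hT⟩
    have hbd := (hb.differentiable_slice h0) x
    have h1 : deriv (fun y => b y t * (u y t - v y t)) x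
        = deriv (fun y => b y t * u y t) x - deriv (fun y => b y t * v y t) x := by
      simp_rw [mul_sub]
      exact deriv_fun_sub (hbd.mul (hu.isC21.differentiableAt_x (x, t) hz))
        (hbd.mul (hv.isC21.differentiableAt_x (x, t) hz))
    have e1 := ht (x, t) hz
    have e2 := hxx (x, t) hz
    have e3 := hu.equation x t h0 hT
    have e4 := hv.equation x t h0 hT
    simp only at e1 e2
    rw [e1, e2, h1]
    linarith

lemma eventually_localEnergy_sub_le (hu₀ : AEStronglyMeasurable u₀ volume)
    (hu : IsSolution b u₀ T u) (hv : IsSolution b u₀ T v) {S K R : ℝ} (hS : 0 < S)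
    (hST : (S : EReal) < T) (hR : 0 < R) (hK : ∀ x, ∀ t ∈ Icc 0 S, |u x t - v x t| ≤ K) {δ : ℝ}
    (hδ : 0 < δ) :
    ∀ᶠ s in 𝓝[>] 0, localEnergy (cutoff R) 2 (fun x t => u x t - v x t) s ≤ δ := by
  set Q := tsupport (cutoff R) with hQ
  have hQc : IsCompact Q := hasCompactSupport_cutoff hR
  have hlim := (hu.initial_limit Q hQc).add (hv.initial_limit Q hQc)
  rw [add_zero] at hlim
  have hlim' := ENNReal.Tendsto.const_mul (a := ENNReal.ofReal K) hlim (Or.inr ENNReal.ofReal_ne_top)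
  rw [mul_zero] at hlim'
  have hK0 : 0 ≤ K := (abs_nonneg _).trans (hK 0 0 ⟨le_rfl, hS.le⟩)
  filter_upwards [hlim'.eventually_lt_const (ENNReal.ofReal_pos.2 hδ), Ioo_mem_nhdsGT hS]
    with s hs hsS
  have hsT : (s : EReal) < T := (EReal.coe_lt_coe_iff.2 hsS.2).trans hST
  have huc := continuous_slice_of_strip hu.isC21.continuousOn hsS.1 hsT
  have hvc := continuous_slice_of_strip hv.isC21.continuousOn hsS.1 hsT
  have hI : Integrable fun x => cutoff R x ^ 2 * |u x s - v x s| ^ (2 : ℝ) := by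
    have hc := continuous_cutoff R
    have : Continuous fun x => |u x s - v x s| ^ (2 : ℝ) :=
      (huc.sub hvc).abs.rpow_const fun _ => Or.inr (by norm_num)
    exact (by fun_prop : Continuous fun x => cutoff R x ^ 2 * |u x s - v x s| ^ (2 : ℝ))
      |>.integrable_of_hasCompactSupport (HasCompactSupport.intro (hasCompactSupport_cutoff hR)
        fun x hx => by simp [image_eq_zero_of_notMem_tsupport hx])
  refine (ENNReal.ofReal_le_ofReal_iff hδ.le).1 (le_trans ?_ hs.le)
  unfold localEnergy
  rw [ofReal_integral_eq_lintegral_ofReal hI (Eventually.of_forall fun x =>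
    mul_nonneg (sq_nonneg _) (Real.rpow_nonneg (abs_nonneg _) _))]
  calc ∫⁻ x, ENNReal.ofReal (cutoff R x ^ 2 * |u x s - v x s| ^ (2 : ℝ))
      ≤ ∫⁻ x, Q.indicator (fun x => ENNReal.ofReal K * ‖u x s - v x s‖ₑ) x := by
        refine lintegral_mono fun x => ?_
        by_cases hx : x ∈ Q
        · rw [indicator_of_mem hx, ← ofReal_norm, ← ENNReal.ofReal_mul hK0]
          refine ENNReal.ofReal_le_ofReal ?_
          have h1 := hK x s ⟨hsS.1.le, hsS.2.le⟩
          have h2 : cutoff R x ^ 2 ≤ 1 := pow_le_one₀ (cutoff_nonneg R x) (cutoff_le_one R x)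
          rw [Real.norm_eq_abs, Real.rpow_two, sq |u x s - v x s|]
          calc _ ≤ 1 * (|u x s - v x s| * |u x s - v x s|) := by gcongr
            _ ≤ _ := by rw [one_mul]; gcongr
        · rw [indicator_of_notMem hx, image_eq_zero_of_notMem_tsupport hx]; simp
    _ = ENNReal.ofReal K * eLpNorm (fun x => u x s - v x s) 1 (volume.restrict Q) := by
        rw [lintegral_indicator hQc.measurableSet, lintegral_const_mul' _ _ ENNReal.ofReal_ne_top,
          eLpNorm_one_eq_lintegral_enorm]
    _ ≤ _ := by
        gcongr
        have e : (fun x => u x s - v x s) = (fun x => u x s - u₀ x) - fun x => v x s - u₀ x := by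
          funext x; simp
        rw [e]
        exact eLpNorm_sub_le (huc.aestronglyMeasurable.sub hu₀.restrict)
          (hvc.aestronglyMeasurable.sub hu₀.restrict) le_rfl

/-- Bounded solutions with the same initial data agree. -/
theorem IsSolution.unique (hb : IsAdvectionField b) (hu₀ : AEStronglyMeasurable u₀ volume)
    (hu : IsSolution b u₀ T u) (hv : IsSolution b u₀ T v) {x t : ℝ} (ht : 0 < t)
    (htT : (t : EReal) < T) : u x t = v x t := by
  obtain ⟨K₁, hK₁⟩ := hu.bounded t ht htT
  obtain ⟨K₂, hK₂⟩ := hv.bounded t ht htT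
  obtain ⟨m, hm⟩ := hb.bounded
  obtain ⟨D, hD0, hD⟩ := exists_integral_deriv_cutoff_sq_le
  have hm0 : 0 ≤ m := (abs_nonneg _).trans (hm 0 0 le_rfl)
  set K := K₁ + K₂ with hKdef
  set w : ℝ → ℝ → ℝ := fun x t => u x t - v x t with hw
  have hK : ∀ x, ∀ s ∈ Icc 0 t, |w x s| ≤ K := fun x s hs =>
    (abs_sub _ _).trans (add_le_add (hK₁ x s hs) (hK₂ x s hs))
  have hK0 : 0 ≤ K := (abs_nonneg _).trans (hK 0 t ⟨ht.le, le_rfl⟩)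
  have hwc := hu.isClassicalSolution.sub hb hv.isClassicalSolution
  set C₀ := 4 + 4 * 2 * m + 2 * 0 with hC₀
  have hbound : ∀ R : ℝ, 0 < R → localEnergy (cutoff R) 2 w t
      ≤ Real.exp ((m ^ 2 + 1) * t)
        * ((C₀ ^ 2 / 2 + C₀) * (D * K ^ (2 : ℝ) / R) / (m ^ 2 + 1)) := by
    intro R hR
    have key : ∀ s ∈ Ioc 0 t, HasDerivAt (localEnergy (cutoff R) 2 w)
        (deriv (localEnergy (cutoff R) 2 w) s) s ∧ deriv (localEnergy (cutoff R) 2 w) s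
        ≤ (m ^ 2 + 1) * localEnergy (cutoff R) 2 w s
          + (C₀ ^ 2 / 2 + C₀) * (D * K ^ (2 : ℝ) / R) := by
      intro s hs
      have hsT : (s : EReal) < T := (EReal.coe_le_coe_iff.2 hs.2).trans_lt htT
      obtain ⟨y', X, ε, h1, hX, hε, hε2, -, h2⟩ := hwc.localEnergy_inequality (β := 0) (m' := 0) hb
        le_rfl hR hs.1 hsT (fun x => by simpa using hm x s hs.1.le) (by simp)
        (fun x => hK x s ⟨hs.1.le, hs.2⟩) hD
      rw [h1.deriv]
      refine ⟨h1, h2.trans ?_⟩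
      set Y := √(localEnergy (cutoff R) 2 w s) with hY
      have hYY : localEnergy (cutoff R) 2 w s = Y ^ 2 :=
        (Real.sq_sqrt (localEnergy_nonneg _ _ _ _)).symm
      rw [hYY, ← hC₀]
      have hC₀0 : 0 ≤ C₀ := by positivity
      have h3 : (C₀ ^ 2 / 2 + C₀) * ε ^ 2 ≤ (C₀ ^ 2 / 2 + C₀) * (D * K ^ (2 : ℝ) / R) := by gcongr
      nlinarith [sq_nonneg (X - m * Y), sq_nonneg (X - C₀ * ε / 2), sq_nonneg (Y - C₀ * ε / 2)]
    exact gronwall_from_zero (by positivity) (by positivity) ht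
      (localEnergy_nonneg _ _ _) (fun s hs => (key s hs).1) (fun s hs => (key s hs).2)
      fun δ hδ => eventually_localEnergy_sub_le hu₀ hu hv ht htT hR hK hδ
  have hcont : Continuous fun x => w x t := continuous_slice_of_strip hwc.isC21.continuousOn ht htT
  have hzero : ∫⁻ x, ENNReal.ofReal (|w x t| ^ (2 : ℝ)) = 0 := by
    refine le_antisymm (ENNReal.le_of_forall_pos_le_add fun δ hδ _ => ?_) zero_le
    rw [zero_add]
    have h := lintegral_le_of_cutoff (g := fun x => |w x t| ^ (2 : ℝ)) (N := δ)
      (hcont.abs.rpow_const fun _ => Or.inr (by norm_num))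
      (fun x => Real.rpow_nonneg (abs_nonneg _) _) ?_
    · simpa using h
    have hlim : Tendsto (fun n : ℕ => Real.exp ((m ^ 2 + 1) * t)
        * ((C₀ ^ 2 / 2 + C₀) * (D * K ^ (2 : ℝ) / n) / (m ^ 2 + 1))) atTop (𝓝 0) := by
      have h1 := (tendsto_const_div_atTop_nhds_zero_nat (D * K ^ (2 : ℝ)))
      simpa using ((h1.const_mul (C₀ ^ 2 / 2 + C₀)).div_const (m ^ 2 + 1)).const_mul
        (Real.exp ((m ^ 2 + 1) * t))
    filter_upwards [hlim.eventually_lt_const (by exact_mod_cast hδ : (0 : ℝ) < δ),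
      eventually_gt_atTop 0] with n hn hn0
    exact (hbound n (by exact_mod_cast hn0)).trans hn.le
  rw [lintegral_eq_zero_iff (hcont.abs.rpow_const fun _ =>
    Or.inr (by norm_num)).measurable.ennreal_ofReal] at hzero
  have hae : (fun x => w x t) =ᵐ[volume] fun _ => 0 := by
    filter_upwards [hzero] with x hx
    have h1 := ENNReal.ofReal_eq_zero.1 hx
    rw [Real.rpow_two, sq_abs] at h1
    exact pow_eq_zero_iff two_ne_zero |>.1 (le_antisymm h1 (sq_nonneg _))
  have := congrFun ((hcont.ae_eq_iff_eq volume continuous_const).1 hae) x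
  exact sub_eq_zero.1 this

end Uniqueness

/-! ### Propagation of `L^q` bounds from `L^{q/2}` bounds -/

section LqStep

/-- The differential inequality of the localized energy forces it to decrease at the level
`N + δ`, provided the cutoff error `ε` is small. -/
lemma exists_barrier {q m A δ N C₀ : ℝ} (hq : 2 ≤ q) (hm : 0 ≤ m) (hA : 0 ≤ A) (hδ : 0 < δ)
    (hC₀ : 0 ≤ C₀) (hN : q * m / 2 * A ^ 2 ≤ N) :
    ∃ ε₀ > 0, ∀ X ε, 0 ≤ ε → ε ≤ ε₀ → √(N + δ) ^ 3 ≤ A ^ 2 * X →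
      -(4 * (q - 1) / q) * X ^ 2 + 2 * (q - 1) * m * (X * √(N + δ))
        + C₀ * ((X + √(N + δ) + ε) * ε) < 0 := by
  have hq0 : 0 < q := by linarith
  have hN0 : 0 ≤ N := le_trans (by positivity) hN
  have hY : 0 < √(N + δ) := Real.sqrt_pos.2 (by linarith)
  have hY2 : √(N + δ) ^ 2 = N + δ := Real.sq_sqrt (by linarith)
  set Y := √(N + δ) with hYdef
  rcases hA.eq_or_lt with rfl | hA
  · refine ⟨1, one_pos, fun X ε _ _ h => ?_⟩
    have : 0 < Y ^ 3 := by positivity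
    norm_num at h
    linarith
  set X₀ := Y ^ 3 / A ^ 2 with hX₀
  have hX₀0 : 0 < X₀ := by positivity
  have hq1 : 0 < q - 1 := by linarith
  set κ := 4 * (q - 1) / q * (δ * Y / A ^ 2) with hκ
  have hκ0 : 0 < κ := by positivity
  set L := 1 + (Y + 1) / X₀ with hL
  have hL0 : 0 < L := by positivity
  refine ⟨min 1 (κ / (2 * (C₀ + 1) * L)), by positivity, fun X ε hε hεle hX => ?_⟩
  have hε1 := hεle.trans (min_le_left _ _)
  have hε2 := hεle.trans (min_le_right _ _)
  have hXX : X₀ ≤ X := by rw [hX₀, div_le_iff₀ (by positivity)]; linarith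
  have hX0 : 0 < X := hX₀0.trans_le hXX
  have h1 : q * m / 2 * Y ≤ X - δ * Y / A ^ 2 := by
    have e : X - δ * Y / A ^ 2 = (A ^ 2 * X - δ * Y) / A ^ 2 := by field_simp
    rw [e, le_div_iff₀ (by positivity)]
    nlinarith
  have h2 : -(4 * (q - 1) / q) * X ^ 2 + 2 * (q - 1) * m * (X * Y) ≤ -κ * X := by
    have e : -(4 * (q - 1) / q) * X ^ 2 + 2 * (q - 1) * m * (X * Y)
        = 4 * (q - 1) / q * X * (q * m / 2 * Y - X) := by field_simp; ring
    have e' : -κ * X = 4 * (q - 1) / q * X * (-(δ * Y / A ^ 2)) := by rw [hκ]; ring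
    rw [e, e']
    have : 0 ≤ 4 * (q - 1) / q * X := by positivity
    exact mul_le_mul_of_nonneg_left (by linarith) this
  have h3 : X + Y + ε ≤ X * L := by
    have h4 : Y + 1 ≤ X * ((Y + 1) / X₀) := by
      rw [mul_div_assoc', le_div_iff₀ hX₀0]
      nlinarith
    rw [hL, mul_add, mul_one]; linarith
  have h4 : C₀ * ((X + Y + ε) * ε) ≤ X * (κ / 2) := by
    rw [le_div_iff₀ (by positivity)] at hε2
    have h5 : (C₀ + 1) * L * ε ≤ κ / 2 := by nlinarith
    calc C₀ * ((X + Y + ε) * ε) ≤ (C₀ + 1) * ((X * L) * ε) := by gcongr; linarith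
      _ = X * ((C₀ + 1) * L * ε) := by ring
      _ ≤ _ := by gcongr
  have h5 : 0 < κ * X := by positivity
  linarith

lemma integral_le_of_lintegral_ofReal_le {f g : ℝ → ℝ} {A : ℝ} (hA : 0 ≤ A) (hf : Continuous f)
    (hf0 : ∀ x, 0 ≤ f x) (hfg : ∀ x, f x ≤ g x)
    (h : ∫⁻ x, ENNReal.ofReal (g x) ≤ ENNReal.ofReal A) : ∫ x, f x ≤ A := by
  rw [integral_eq_lintegral_of_nonneg_ae (Eventually.of_forall hf0) hf.aestronglyMeasurable]
  exact ENNReal.toReal_le_of_le_ofReal hA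
    ((lintegral_mono fun x => ENNReal.ofReal_le_ofReal (hfg x)).trans h)

variable {b u : ℝ → ℝ → ℝ} {T : EReal}

/-- The basic step of the iteration: a bound `A` for `∫ |u|^{q/2}` on a time interval bounds
`∫ |u|^q` there by the larger of its initial value and `(q B / 2) A²`, where `B` bounds the half
oscillation of the drift. -/
lemma IsClassicalSolution.lintegral_rpow_le (hb : IsAdvectionField b)
    (hu : IsClassicalSolution b T u) {q s t B A K N M : ℝ} (hq : 2 ≤ q) (hs : 0 < s) (hst : s ≤ t)
    (htT : (t : EReal) < T) (hK : ∀ x, ∀ τ ∈ Icc s t, |u x τ| ≤ K)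
    (hB : ∀ τ ∈ Icc s t, ∃ β, |β| ≤ M ∧ ∀ x, |b x τ - β| ≤ B) (hA : 0 ≤ A)
    (hAu : ∀ τ ∈ Icc s t, ∫⁻ x, ENNReal.ofReal (|u x τ| ^ (q / 2)) ≤ ENNReal.ofReal A)
    (hN : q * B / 2 * A ^ 2 ≤ N)
    (hNs : ∫⁻ x, ENNReal.ofReal (|u x s| ^ q) ≤ ENNReal.ofReal N) :
    ∫⁻ x, ENNReal.ofReal (|u x t| ^ q) ≤ ENNReal.ofReal N := by
  obtain ⟨β₀, hβ₀, hB₀⟩ := hB s (left_mem_Icc.2 hst)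
  have hM0 : 0 ≤ M := (abs_nonneg _).trans hβ₀
  have hB0 : 0 ≤ B := (abs_nonneg _).trans (hB₀ 0)
  have hN0 : 0 ≤ N := le_trans (by positivity) hN
  have hmem : ∀ τ ∈ Icc s t, 0 < τ ∧ (τ : EReal) < T := fun τ hτ =>
    ⟨hs.trans_le hτ.1, (EReal.coe_le_coe_iff.2 hτ.2).trans_lt htT⟩
  have hcont : ∀ τ ∈ Icc s t, ∀ r : ℝ, 0 ≤ r → Continuous fun x => |u x τ| ^ r := fun τ hτ r hr =>
    (continuous_slice_of_strip hu.isC21.continuousOn (hmem τ hτ).1 (hmem τ hτ).2).abs.rpow_const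
      fun _ => Or.inr hr
  obtain ⟨D, hD0, hD⟩ := exists_integral_deriv_cutoff_sq_le
  refine ENNReal.le_of_forall_pos_le_add fun δ hδ _ => ?_
  have hδ' : (0 : ℝ) < δ := by exact_mod_cast hδ
  obtain ⟨ε₀, hε₀, hbar⟩ := exists_barrier (C₀ := 4 + 4 * q * B + 2 * M) hq hB0 hA hδ'
    (by positivity) hN
  have e : ENNReal.ofReal N + (δ : ENNReal) = ENNReal.ofReal (N + δ) := by
    rw [ENNReal.ofReal_add hN0 hδ'.le, ENNReal.ofReal_coe_nnreal]
  rw [e]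
  have ht : t ∈ Icc s t := right_mem_Icc.2 hst
  refine lintegral_le_of_cutoff (hcont t ht q (by linarith))
    (fun x => Real.rpow_nonneg (abs_nonneg _) _) ?_
  filter_upwards [(tendsto_const_div_atTop_nhds_zero_nat (D * K ^ q)).eventually_lt_const
    (by positivity : 0 < ε₀ ^ 2), eventually_gt_atTop 0] with n hn hn0
  have hn0' : (0 : ℝ) < n := by exact_mod_cast hn0
  have key : ∀ τ ∈ Icc s t, DifferentiableAt ℝ (localEnergy (cutoff n) q u) τ ∧
      (localEnergy (cutoff n) q u τ = N + δ → deriv (localEnergy (cutoff n) q u) τ < 0) := by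
    intro τ hτ
    obtain ⟨β, hβ, hBβ⟩ := hB τ hτ
    obtain ⟨y', X, ε, h1, hX, hε, hε2, h2, h3⟩ := hu.localEnergy_inequality hb hq hn0' (hmem τ hτ).1
      (hmem τ hτ).2 hBβ hβ (fun x => hK x τ hτ) hD
    refine ⟨h1.differentiableAt, fun hy => ?_⟩
    rw [h1.deriv]
    rw [hy] at h2 h3
    refine h3.trans_lt (hbar X ε hε (abs_le_of_sq_le_sq' ?_ hε₀.le).2 (h2.trans ?_))
    · exact (hε2.trans hn.le)
    · have hφA : ∫ x, cutoff n x * |u x τ| ^ (q / 2) ≤ A :=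
        integral_le_of_lintegral_ofReal_le hA
          ((continuous_cutoff n).mul (hcont τ hτ (q / 2) (by linarith)))
          (fun x => mul_nonneg (cutoff_nonneg _ _) (Real.rpow_nonneg (abs_nonneg _) _))
          (fun x => mul_le_of_le_one_left (Real.rpow_nonneg (abs_nonneg _) _) (cutoff_le_one _ _))
          (hAu τ hτ)
      have hφ0 : 0 ≤ ∫ x, cutoff n x * |u x τ| ^ (q / 2) := integral_nonneg fun x =>
        mul_nonneg (cutoff_nonneg _ _) (Real.rpow_nonneg (abs_nonneg _) _)
      gcongr
  refine image_le_of_deriv_right_lt_deriv_boundary (f := localEnergy (cutoff n) q u)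
    (f' := deriv (localEnergy (cutoff n) q u)) (B := fun _ => N + δ) (B' := fun _ => 0)
    (fun τ hτ => (key τ hτ).1.continuousAt.continuousWithinAt)
    (fun τ hτ => (key τ (Ico_subset_Icc_self hτ)).1.hasDerivAt.hasDerivWithinAt) ?_
    (fun _ => hasDerivAt_const _ _) (fun τ hτ => (key τ (Ico_subset_Icc_self hτ)).2) ht
  have hsm : s ∈ Icc s t := left_mem_Icc.2 hst
  refine le_trans ?_ (le_add_of_nonneg_right hδ'.le : N ≤ N + δ)
  refine integral_le_of_lintegral_ofReal_le hN0
    (((continuous_cutoff n).pow 2).mul (hcont s hsm q (by linarith)))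
    (fun x => mul_nonneg (sq_nonneg _) (Real.rpow_nonneg (abs_nonneg _) _)) (fun x => ?_) hNs
  exact mul_le_of_le_one_left (Real.rpow_nonneg (abs_nonneg _) _)
    (pow_le_one₀ (cutoff_nonneg _ _) (cutoff_le_one _ _))

end LqStep

/-! ### The iteration -/

section Iteration

/-- The constants of the iteration: `∫ |u|^{2^k p} ≤ E_k N^{2^k p} / B`, where `E_0 = 1` and
`E_{k+1} = 2^k p E_k²`. -/
noncomputable def iterConst (p : ℝ) (k : ℕ) : ℝ := (2 * p) ^ (2 ^ k) / (2 ^ (k + 1) * p)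

variable {p : ℝ}

lemma iterConst_succ (hp : 1 ≤ p) (k : ℕ) :
    iterConst p (k + 1) = 2 ^ k * p * iterConst p k ^ 2 := by
  unfold iterConst
  have : p ≠ 0 := by positivity
  rw [pow_succ 2 k, pow_mul, div_pow, pow_succ 2 (k + 1), pow_succ 2 k]
  field_simp

lemma one_le_iterConst (hp : 1 ≤ p) (k : ℕ) : 1 ≤ iterConst p k := by
  induction k with
  | zero => unfold iterConst; rw [le_div_iff₀ (by positivity)]; simp
  | succ k ih =>
    rw [iterConst_succ hp]
    have h1 : (1 : ℝ) ≤ 2 ^ k := one_le_pow₀ one_le_two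
    exact one_le_mul_of_one_le_of_one_le (one_le_mul_of_one_le_of_one_le h1 hp) (one_le_pow₀ ih)

lemma iterConst_le_succ (hp : 1 ≤ p) (k : ℕ) : iterConst p k ≤ iterConst p (k + 1) := by
  rw [iterConst_succ hp]
  have h1 : (1 : ℝ) ≤ 2 ^ k := one_le_pow₀ one_le_two
  have h2 := one_le_mul_of_one_le_of_one_le h1 hp
  have h3 := one_le_iterConst hp k
  nlinarith

lemma lintegral_abs_rpow_add_le {f : ℝ → ℝ} {N r r' : ℝ} (hf : ∀ᵐ x, |f x| ≤ N) (hr : 0 ≤ r)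
    (hr' : 0 ≤ r') : ∫⁻ x, ENNReal.ofReal (|f x| ^ (r + r'))
      ≤ ENNReal.ofReal (N ^ r) * ∫⁻ x, ENNReal.ofReal (|f x| ^ r') := by
  rw [← lintegral_const_mul' _ _ ENNReal.ofReal_ne_top]
  refine lintegral_mono_ae ?_
  filter_upwards [hf] with x hx
  rw [Real.rpow_add_of_nonneg (abs_nonneg _) hr hr',
    ENNReal.ofReal_mul (Real.rpow_nonneg (abs_nonneg _) _)]
  gcongr

variable {b u : ℝ → ℝ → ℝ} {T : EReal} {s t B K M U N : ℝ}

/-- The iterated integral bounds along the exponents `2^k p`. -/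
lemma IsClassicalSolution.lintegral_iterate_le (hb : IsAdvectionField b)
    (hu : IsClassicalSolution b T u) (hp : 1 ≤ p) (hs : 0 < s)
    (htT : (t : EReal) < T) (hK : ∀ x, ∀ τ ∈ Icc s t, |u x τ| ≤ K)
    (hB : ∀ τ ∈ Icc s t, ∃ β, |β| ≤ M ∧ ∀ x, |b x τ - β| ≤ B) (hB0 : 0 < B) (hU0 : 0 ≤ U)
    (hU : ∀ τ ∈ Icc s t, ∫⁻ x, ENNReal.ofReal (|u x τ| ^ p) ≤ ENNReal.ofReal (U ^ p))
    (hN : ∀ᵐ x, |u x s| ≤ N) (hUN : B ^ (1 / p) * U ≤ N) (k : ℕ) :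
    ∀ τ ∈ Icc s t, ∫⁻ x, ENNReal.ofReal (|u x τ| ^ (2 ^ k * p))
      ≤ ENNReal.ofReal (iterConst p k * N ^ (2 ^ k * p) / B) := by
  have hp0 : 0 < p := by linarith
  have hN0 : 0 ≤ N := le_trans (by positivity) hUN
  induction k with
  | zero =>
    intro τ hτ
    have e : iterConst p 0 = 1 := by unfold iterConst; field_simp; norm_num; ring
    rw [e, pow_zero, one_mul, one_mul]
    refine (hU τ hτ).trans (ENNReal.ofReal_le_ofReal ?_)
    have h1 := Real.rpow_le_rpow (by positivity) hUN hp0.le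
    rw [Real.mul_rpow (by positivity) hU0, ← Real.rpow_mul hB0.le, one_div_mul_cancel hp0.ne',
      Real.rpow_one] at h1
    rw [le_div_iff₀ hB0]; linarith
  | succ k ih =>
    intro τ hτ
    have hk1 : (1 : ℝ) ≤ 2 ^ k := one_le_pow₀ one_le_two
    have hkp : 1 ≤ 2 ^ k * p := one_le_mul_of_one_le_of_one_le hk1 hp
    have e1 : (2 : ℝ) ^ (k + 1) * p = 2 ^ k * p + 2 ^ k * p := by rw [pow_succ]; ring
    have e2 : (2 : ℝ) ^ (k + 1) * p / 2 = 2 ^ k * p := by rw [e1]; ring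
    have hE := one_le_iterConst hp k
    have eN : N ^ ((2 : ℝ) ^ (k + 1) * p) = N ^ (2 ^ k * p) * N ^ (2 ^ k * p) := by
      rw [e1, Real.rpow_add_of_nonneg hN0 (by linarith) (by linarith)]
    have hNk : 0 ≤ N ^ (2 ^ k * p) := Real.rpow_nonneg hN0 _
    have hsub : Icc s τ ⊆ Icc s t := Icc_subset_Icc_right hτ.2
    refine hu.lintegral_rpow_le hb (q := 2 ^ (k + 1) * p) (s := s) (B := B) (M := M) (K := K)
      (A := iterConst p k * N ^ (2 ^ k * p) / B) (by linarith) hs hτ.1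
      ((EReal.coe_le_coe_iff.2 hτ.2).trans_lt htT) (fun x r hr => hK x r (hsub hr))
      (fun r hr => hB r (hsub hr)) (by positivity) (fun r hr => ?_) (le_of_eq ?_) ?_
    · rw [e2]; exact ih r (hsub hr)
    · rw [eN, iterConst_succ hp, e1]; field_simp; ring
    · rw [e1, Real.rpow_add_of_nonneg hN0 (by linarith) (by linarith)]
      refine (lintegral_abs_rpow_add_le hN (by linarith) (by linarith)).trans ?_
      refine (mul_le_mul_right (ih s (left_mem_Icc.2 (hτ.1.trans hτ.2))) _).trans ?_
      rw [← ENNReal.ofReal_mul hNk]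
      refine ENNReal.ofReal_le_ofReal ?_
      have h1 := iterConst_le_succ hp k
      calc _ = iterConst p k * (N ^ (2 ^ k * p) * N ^ (2 ^ k * p)) / B := by ring
        _ ≤ _ := by gcongr

/-- The supremum bound, obtained from the bounds for `∫ |u|^{2^k p}` as `k → ∞`: by Chebyshev's
inequality values above `(2p)^{1/p} N` are attained only on a null set, which is open, hence
empty. -/
lemma IsClassicalSolution.abs_le_of_pos (hb : IsAdvectionField b)
    (hu : IsClassicalSolution b T u) (hp : 1 ≤ p) (hs : 0 < s) (hst : s ≤ t)
    (htT : (t : EReal) < T) (hK : ∀ x, ∀ τ ∈ Icc s t, |u x τ| ≤ K)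
    (hB : ∀ τ ∈ Icc s t, ∃ β, |β| ≤ M ∧ ∀ x, |b x τ - β| ≤ B) (hB0 : 0 < B) (hU0 : 0 ≤ U)
    (hU : ∀ τ ∈ Icc s t, ∫⁻ x, ENNReal.ofReal (|u x τ| ^ p) ≤ ENNReal.ofReal (U ^ p))
    (hN : ∀ᵐ x, |u x s| ≤ N) (hUN : B ^ (1 / p) * U ≤ N) (x : ℝ) :
    |u x t| ≤ (2 * p) ^ (1 / p) * N := by
  have hp0 : 0 < p := by linarith
  have hN0 : 0 ≤ N := le_trans (by positivity) hUN
  have huc : Continuous fun x => u x t :=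
    continuous_slice_of_strip hu.isC21.continuousOn (hs.trans_le hst) htT
  by_contra! hlt
  obtain ⟨l, hl1, hl2⟩ := exists_between hlt
  set c := (2 * p) ^ (1 / p) with hc
  have hcN : 0 ≤ c * N := by positivity
  have hl0 : 0 < l := hcN.trans_lt hl1
  set G := {x | l < |u x t|} with hG
  have hGo : IsOpen G := isOpen_lt continuous_const huc.abs
  have hGpos : 0 < volume G := hGo.measure_pos volume ⟨x, hl2⟩
  have hbound : ∀ k : ℕ, volume G ≤ ENNReal.ofReal (((c * N / l) ^ p) ^ (2 ^ k) / B) := by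
    intro k
    have h1 := hu.lintegral_iterate_le hb hp hs htT hK hB hB0 hU0 hU hN hUN k t (right_mem_Icc.2 hst)
    set Q : ℝ := 2 ^ k * p with hQ
    have hQ0 : 0 < Q := by positivity
    have hlQ : 0 < l ^ Q := by positivity
    have h2 : ENNReal.ofReal (l ^ Q) * volume G ≤ ∫⁻ x, ENNReal.ofReal (|u x t| ^ Q) := by
      rw [← lintegral_indicator_const hGo.measurableSet]
      refine lintegral_mono fun y => ?_
      by_cases hy : y ∈ G
      · rw [indicator_of_mem hy]
        exact ENNReal.ofReal_le_ofReal (Real.rpow_le_rpow hl0.le (le_of_lt hy) hQ0.le)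
      · rw [indicator_of_notMem hy]; exact zero_le
    have h3 : iterConst p k * N ^ Q / B ≤ l ^ Q * (((c * N / l) ^ p) ^ (2 ^ k) / B) := by
      have e1 : ((c * N / l) ^ p) ^ (2 ^ k) = (c * N / l) ^ Q := by
        rw [← Real.rpow_natCast, ← Real.rpow_mul (by positivity), hQ]
        rw [mul_comm p]; push_cast; rfl
      have e2 : c ^ Q = (2 * p) ^ (2 ^ k) := by
        rw [hc, ← Real.rpow_mul (by positivity), ← Real.rpow_natCast, hQ]
        congr 1; push_cast; field_simp
      rw [e1, Real.div_rpow hcN hl0.le, Real.mul_rpow (by positivity) hN0, e2]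
      have h4 : iterConst p k ≤ (2 * p) ^ (2 ^ k) :=
        div_le_self (by positivity) (one_le_mul_of_one_le_of_one_le (one_le_pow₀ one_le_two) hp)
      calc iterConst p k * N ^ Q / B ≤ (2 * p) ^ (2 ^ k) * N ^ Q / B := by gcongr
        _ = _ := by field_simp
    have h5 := (h2.trans h1).trans (ENNReal.ofReal_le_ofReal h3)
    rw [ENNReal.ofReal_mul hlQ.le] at h5
    exact (ENNReal.mul_le_mul_iff_right (ENNReal.ofReal_pos.2 hlQ).ne' ENNReal.ofReal_ne_top).1 h5
  have hr : (c * N / l) ^ p < 1 :=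
    Real.rpow_lt_one (by positivity) ((div_lt_one hl0).2 hl1) hp0
  have hlim : Tendsto (fun k : ℕ => ENNReal.ofReal (((c * N / l) ^ p) ^ (2 ^ k) / B)) atTop (𝓝 0) := by
    have h1 := ((tendsto_pow_atTop_nhds_zero_of_lt_one (by positivity) hr).comp
      (tendsto_pow_atTop_atTop_of_one_lt (one_lt_two : (1 : ℕ) < 2))).div_const B
    rw [zero_div] at h1
    have h2 := ENNReal.tendsto_ofReal h1
    rwa [ENNReal.ofReal_zero] at h2
  exact hGpos.not_ge (ge_of_tendsto' hlim hbound)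

/-- The estimate on a time interval away from `0`, allowing vanishing oscillation. -/
lemma IsClassicalSolution.abs_le (hb : IsAdvectionField b)
    (hu : IsClassicalSolution b T u) (hp : 1 ≤ p) (hs : 0 < s) (hst : s ≤ t)
    (htT : (t : EReal) < T) (hK : ∀ x, ∀ τ ∈ Icc s t, |u x τ| ≤ K)
    (hB : ∀ τ ∈ Icc s t, ∃ β, |β| ≤ M ∧ ∀ x, |b x τ - β| ≤ B) (hU0 : 0 ≤ U)
    (hU : ∀ τ ∈ Icc s t, ∫⁻ x, ENNReal.ofReal (|u x τ| ^ p) ≤ ENNReal.ofReal (U ^ p))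
    (hN : ∀ᵐ x, |u x s| ≤ N) (x : ℝ) :
    |u x t| ≤ (2 * p) ^ (1 / p) * max N (B ^ (1 / p) * U) := by
  have hp0 : 0 < p := by linarith
  obtain ⟨β, -, hβ⟩ := hB s (left_mem_Icc.2 hst)
  have hB0 : 0 ≤ B := (abs_nonneg _).trans (hβ 0)
  have hcont : Continuous fun B' : ℝ => (2 * p) ^ (1 / p) * max N (B' ^ (1 / p) * U) :=
    continuous_const.mul (continuous_const.max
      ((Real.continuous_rpow_const (by positivity)).mul continuous_const))
  refine ge_of_tendsto ((hcont.tendsto B).mono_left nhdsWithin_le_nhds : Tendsto _ (𝓝[>] B) _) ?_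
  filter_upwards [self_mem_nhdsWithin] with B' (hB' : B < B')
  refine hu.abs_le_of_pos (M := M) hb hp hs hst htT hK (fun τ hτ => ?_) (hB0.trans_lt hB') hU0 hU
    (hN.mono fun y hy => hy.trans (le_max_left _ _)) (le_max_right _ _) x
  obtain ⟨β, h1, h2⟩ := hB τ hτ
  exact ⟨β, h1, fun y => (h2 y).trans hB'.le⟩

end Iteration

/-! ### Norms, representatives and the oscillation of the drift -/

section Final

lemma lintegral_rpow_le_of_eLpNorm_le {f : ℝ → ℝ} {p U : ℝ} (hp : 0 < p) (hU : 0 ≤ U)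
    (h : eLpNorm f (ENNReal.ofReal p) volume ≤ ENNReal.ofReal U) :
    ∫⁻ x, ENNReal.ofReal (|f x| ^ p) ≤ ENNReal.ofReal (U ^ p) := by
  rw [eLpNorm_eq_lintegral_rpow_enorm_toReal (ENNReal.ofReal_pos.2 hp).ne' ENNReal.ofReal_ne_top,
    ENNReal.toReal_ofReal hp.le, one_div, ENNReal.rpow_inv_le_iff hp,
    ENNReal.ofReal_rpow_of_nonneg hU hp.le] at h
  refine le_trans (le_of_eq (lintegral_congr fun x => ?_)) h
  rw [← ofReal_norm, ENNReal.ofReal_rpow_of_nonneg (norm_nonneg _) hp.le, Real.norm_eq_abs]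

lemma eLpNorm_lt_top_of_bounded {f : ℝ → ℝ} {p₀ p M : ℝ} (hp₀ : 0 < p₀) (hp : p₀ ≤ p)
    (hf : MemLp f (ENNReal.ofReal p₀) volume) (hM : ∀ x, |f x| ≤ M) :
    eLpNorm f (ENNReal.ofReal p) volume < ⊤ := by
  have hp' : 0 < p := hp₀.trans_le hp
  have hfin : eLpNorm f (ENNReal.ofReal p₀) volume
      ≤ ENNReal.ofReal (eLpNorm f (ENNReal.ofReal p₀) volume).toReal :=
    (ENNReal.ofReal_toReal hf.2.ne).ge
  have h1 := lintegral_rpow_le_of_eLpNorm_le hp₀ ENNReal.toReal_nonneg hfin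
  have h2 := lintegral_abs_rpow_add_le (r := p - p₀) (r' := p₀) (Eventually.of_forall hM)
    (by linarith) hp₀.le
  rw [sub_add_cancel] at h2
  rw [eLpNorm_lt_top_iff_lintegral_rpow_enorm_lt_top (ENNReal.ofReal_pos.2 hp').ne'
    ENNReal.ofReal_ne_top, ENNReal.toReal_ofReal hp'.le]
  have e : ∀ x, ‖f x‖ₑ ^ p = ENNReal.ofReal (|f x| ^ p) := fun x => by
    rw [← ofReal_norm, ENNReal.ofReal_rpow_of_nonneg (norm_nonneg _) hp'.le, Real.norm_eq_abs]
  simp_rw [e]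
  exact (h2.trans (mul_le_mul_right h1 _)).trans_lt
    (ENNReal.mul_lt_top ENNReal.ofReal_lt_top ENNReal.ofReal_lt_top)

lemma exists_bounded_representative {u₀ : ℝ → ℝ} (hu : MemLp u₀ ⊤ volume) :
    ∃ w : ℝ → ℝ, Measurable w ∧ w =ᵐ[volume] u₀ ∧ ∀ x, |w x| ≤ (eLpNorm u₀ ⊤ volume).toReal := by
  set M := (eLpNorm u₀ ⊤ volume).toReal with hM
  have hM0 : 0 ≤ M := ENNReal.toReal_nonneg
  have hae : ∀ᵐ x, |u₀ x| ≤ M := by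
    filter_upwards [ae_le_eLpNormEssSup (f := u₀) (μ := volume)] with x hx
    rw [← eLpNorm_exponent_top, ← ENNReal.ofReal_toReal hu.2.ne, ← ofReal_norm,
      ENNReal.ofReal_le_ofReal_iff hM0] at hx
    exact hx
  refine ⟨fun x => max (-M) (min M (hu.1.mk u₀ x)),
    measurable_const.max (measurable_const.min hu.1.stronglyMeasurable_mk.measurable), ?_, fun x =>
    abs_le.2 ⟨le_max_left _ _, max_le (by linarith) (min_le_left _ _)⟩⟩
  filter_upwards [hae, hu.1.ae_eq_mk] with x h1 h2
  rw [← h2, min_eq_right (abs_le.1 h1).2, max_eq_right (abs_le.1 h1).1]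

variable {b : ℝ → ℝ → ℝ}

/-- Up to an additive constant, the drift at a fixed time is bounded by its half oscillation. -/
lemma exists_abs_sub_le_halfOsc {M τ : ℝ} (hM : ∀ x, |b x τ| ≤ M) :
    ∃ β, |β| ≤ M ∧ ∀ x, |b x τ - β| ≤ halfOsc b τ := by
  have h1 : BddAbove (range fun x => b x τ) := ⟨M, by rintro _ ⟨x, rfl⟩; exact (abs_le.1 (hM x)).2⟩
  have h2 : BddBelow (range fun x => b x τ) := ⟨-M, by rintro _ ⟨x, rfl⟩; exact (abs_le.1 (hM x)).1⟩
  have h3 : ⨆ x, b x τ ≤ M := ciSup_le fun x => (abs_le.1 (hM x)).2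
  have h4 : -M ≤ ⨅ x, b x τ := le_ciInf fun x => (abs_le.1 (hM x)).1
  have h5 := ciInf_le h2 0
  have h6 := le_ciSup h1 0
  have h7 := abs_le.1 (hM 0)
  refine ⟨((⨆ x, b x τ) + ⨅ x, b x τ) / 2, abs_le.2 ⟨by linarith, by linarith⟩, fun x => ?_⟩
  have h8 := ciInf_le h2 x
  have h9 := le_ciSup h1 x
  unfold halfOsc
  exact abs_le.2 ⟨by linarith, by linarith⟩

lemma halfOsc_le_supHalfOsc {M t₀ t τ : ℝ} (hM : ∀ x t : ℝ, 0 ≤ t → |b x t| ≤ M) (ht₀ : 0 ≤ t₀)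
    (hτ : τ ∈ Icc t₀ t) : halfOsc b τ ≤ supHalfOsc b t₀ t := by
  refine le_csSup ⟨M, ?_⟩ (mem_image_of_mem _ hτ)
  rintro _ ⟨r, hr, rfl⟩
  have h3 : ⨆ x, b x r ≤ M := ciSup_le fun x => (abs_le.1 (hM x r (ht₀.trans hr.1))).2
  have h4 : -M ≤ ⨅ x, b x r := le_ciInf fun x => (abs_le.1 (hM x r (ht₀.trans hr.1))).1
  unfold halfOsc
  linarith

/-! ### The estimate for global solutions -/

lemma IsSolution.mono {u₀ : ℝ → ℝ} {u : ℝ → ℝ → ℝ} {T : EReal} (h : IsSolution b u₀ ⊤ u) :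
    IsSolution b u₀ T u := by
  have hsub : openStrip T ⊆ openStrip ⊤ := fun z hz => ⟨hz.1, EReal.coe_lt_top _⟩
  have hC := h.isC21
  exact ⟨fun S hS _ => h.bounded S hS (EReal.coe_lt_top _),
    ⟨fun z hz => hC.differentiableAt_t z (hsub hz), fun z hz => hC.differentiableAt_x z (hsub hz),
      fun z hz => hC.differentiableAt_xx z (hsub hz), hC.continuousOn.mono hsub,
      hC.continuousOn_t.mono hsub, hC.continuousOn_x.mono hsub, hC.continuousOn_xx.mono hsub⟩,
    fun x t ht _ => h.equation x t ht (EReal.coe_lt_top _), h.initial_value, h.initial_limit⟩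

/-- The a priori estimate for a global solution whose sup norm exceeds its initial value by a
factor `1 + O(√s)` at most; this lets the case `t₀ = 0` follow from positive initial times. -/
lemma IsSolution.eLpNorm_top_le (hb : IsAdvectionField b) {u₀ : ℝ → ℝ} {v : ℝ → ℝ → ℝ}
    (hv : IsSolution b u₀ ⊤ v) {p t₀ t C : ℝ} (hp : 1 ≤ p) (ht₀ : 0 ≤ t₀) (ht : t₀ ≤ t)
    (hfin : supLpNorm v p t₀ t < ⊤)
    (hsup : ∀ s, 0 ≤ s → s ≤ t → ∀ x,
      |v x s| ≤ (1 + C * √s) * (eLpNorm (fun x => v x 0) ⊤ volume).toReal) :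
    eLpNorm (fun x => v x t) ⊤ volume ≤ ENNReal.ofReal ((2 * p) ^ (1 / p)) *
      max (eLpNorm (fun x => v x t₀) ⊤ volume)
        (ENNReal.ofReal (supHalfOsc b t₀ t ^ (1 / p)) * supLpNorm v p t₀ t) := by
  have hp0 : 0 < p := by linarith
  set c := (2 * p) ^ (1 / p) with hc
  have hc1 : 1 ≤ c := Real.one_le_rpow (by linarith) (by positivity)
  rcases ht.eq_or_lt with rfl | hlt
  · exact (le_max_left _ _).trans (le_mul_of_one_le_left zero_le
      (by rw [← ENNReal.ofReal_one]; exact ENNReal.ofReal_le_ofReal hc1))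
  have htpos : 0 < t := ht₀.trans_lt hlt
  obtain ⟨Mb, hMb⟩ := hb.bounded
  obtain ⟨K, hK⟩ := hv.bounded t htpos (EReal.coe_lt_top _)
  set B := supHalfOsc b t₀ t with hB
  set U := (supLpNorm v p t₀ t).toReal with hUdef
  have hU0 : 0 ≤ U := ENNReal.toReal_nonneg
  have hUeq : supLpNorm v p t₀ t = ENNReal.ofReal U := (ENNReal.ofReal_toReal hfin.ne).symm
  have hU : ∀ τ ∈ Icc t₀ t, ∫⁻ x, ENNReal.ofReal (|v x τ| ^ p) ≤ ENNReal.ofReal (U ^ p) := by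
    intro τ hτ
    refine lintegral_rpow_le_of_eLpNorm_le hp0 hU0 ?_
    rw [← hUeq]
    exact le_iSup₂ (f := fun τ (_ : τ ∈ Icc t₀ t) =>
      eLpNorm (fun x => v x τ) (ENNReal.ofReal p) volume) τ hτ
  have hdrift : ∀ τ ∈ Icc t₀ t, ∃ β, |β| ≤ Mb ∧ ∀ x, |b x τ - β| ≤ B := by
    intro τ hτ
    obtain ⟨β, h1, h2⟩ := exists_abs_sub_le_halfOsc fun x => hMb x τ (ht₀.trans hτ.1)
    exact ⟨β, h1, fun x => (h2 x).trans (halfOsc_le_supHalfOsc hMb ht₀ hτ)⟩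
  have hB0 : 0 ≤ B := by
    obtain ⟨β, -, h⟩ := hdrift t₀ (left_mem_Icc.2 ht)
    exact (abs_nonneg _).trans (h 0)
  set S := (eLpNorm (fun x => v x t₀) ⊤ volume).toReal with hS
  have hSeq : eLpNorm (fun x => v x t₀) ⊤ volume = ENNReal.ofReal S := by
    refine (ENNReal.ofReal_toReal (ne_top_of_le_ne_top (ENNReal.ofReal_ne_top (r := K)) ?_)).symm
    rw [eLpNorm_exponent_top]
    exact eLpNormEssSup_le_of_ae_bound (Eventually.of_forall fun x => hK x t₀ ⟨ht₀, ht⟩)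
  have key : ∀ s ∈ Ioc 0 t, t₀ ≤ s → ∀ N, (∀ᵐ x, |v x s| ≤ N) → ∀ x,
      |v x t| ≤ c * max N (B ^ (1 / p) * U) := fun s hs hs' N hN x =>
    hv.isClassicalSolution.abs_le hb hp hs.1 hs.2 (EReal.coe_lt_top _)
      (fun x τ hτ => hK x τ ⟨hs.1.le.trans hτ.1, hτ.2⟩)
      (fun τ hτ => hdrift τ ⟨hs'.trans hτ.1, hτ.2⟩) hU0
      (fun τ hτ => hU τ ⟨hs'.trans hτ.1, hτ.2⟩) hN x
  have main : ∀ x, |v x t| ≤ c * max S (B ^ (1 / p) * U) := by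
    intro x
    rcases ht₀.eq_or_lt with h0 | h0
    · -- the estimate from positive initial times, in the limit `s → 0`
      subst h0
      have hcont : ContinuousAt (fun s : ℝ => c * max ((1 + C * √s) * S) (B ^ (1 / p) * U)) 0 := by
        fun_prop
      have hlim := hcont.tendsto.mono_left (nhdsWithin_le_nhds (s := Ioi 0))
      simp only [Real.sqrt_zero, mul_zero, add_zero, one_mul] at hlim
      refine ge_of_tendsto hlim ?_
      filter_upwards [Ioo_mem_nhdsGT htpos] with s hs
      exact key s ⟨hs.1, hs.2.le⟩ hs.1.le _
        (Eventually.of_forall fun x => hsup s hs.1.le hs.2.le x) x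
    · refine key t₀ ⟨h0, ht⟩ le_rfl S ?_ x
      filter_upwards [ae_le_eLpNormEssSup (f := fun x => v x t₀) (μ := volume)] with y hy
      rw [← eLpNorm_exponent_top, hSeq, ← ofReal_norm,
        ENNReal.ofReal_le_ofReal_iff ENNReal.toReal_nonneg] at hy
      exact hy
  rw [hSeq, hUeq, ← ENNReal.ofReal_mul (by positivity), ← ENNReal.ofReal_max,
    ← ENNReal.ofReal_mul (by linarith), eLpNorm_exponent_top]
  exact eLpNormEssSup_le_of_ae_bound (Eventually.of_forall main)

end Final

theorem theorem2p4 (b : ℝ → ℝ → ℝ) (hb : IsAdvectionField b)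
    (p₀ : ℝ) (hp₀ : 1 ≤ p₀) (u₀ : ℝ → ℝ)
    (hu₀ : MemLp u₀ (ENNReal.ofReal p₀) volume) (hu₀_bdd : MemLp u₀ ⊤ volume) :
    -- the a priori estimate, for every solution on any time interval `[0,T)`, `0 < T ≤ ∞`
    (∀ (T : EReal) (u : ℝ → ℝ → ℝ), 0 < T → IsSolution b u₀ T u →
      ∀ p t₀ t : ℝ, p₀ ≤ p → 0 ≤ t₀ → t₀ ≤ t → (t : EReal) < T →
        supLpNorm u p t₀ t < ⊤ ∧
        eLpNorm (fun x => u x t) ⊤ volume ≤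
          ENNReal.ofReal ((2 * p) ^ (1 / p)) *
            max (eLpNorm (fun x => u x t₀) ⊤ volume)
              (ENNReal.ofReal (supHalfOsc b t₀ t ^ (1 / p)) * supLpNorm u p t₀ t)) ∧
    -- every solution is globally defined
    (∀ (T : EReal) (u : ℝ → ℝ → ℝ), 0 < T → IsSolution b u₀ T u →
      ∃ v : ℝ → ℝ → ℝ, IsSolution b u₀ ⊤ v ∧
        ∀ x t : ℝ, 0 ≤ t → (t : EReal) < T → v x t = u x t) ∧
    -- a global solution exists
    (∃ v : ℝ → ℝ → ℝ, IsSolution b u₀ ⊤ v) := by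
  -- solutions are insensitive to changing `u₀` on a null set, so `u₀` may be taken measurable and
  -- bounded everywhere by its essential supremum
  obtain ⟨w, hwm, hwu, hwM⟩ := exists_bounded_representative hu₀_bdd
  have hwp : MemLp w (ENNReal.ofReal p₀) volume := (memLp_congr_ae hwu).2 hu₀
  obtain ⟨v, hv, hv0, hvb⟩ := exists_isSolution hb hwm hwM hp₀ hwp
  have hv0' : (fun x => v x 0) =ᵐ[volume] u₀ := by simp_rw [hv0]; exact hwu
  have hvu₀ : IsSolution b u₀ ⊤ v := hv.congr (by simp) (fun _ _ _ _ => rfl)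
    ⟨_, fun x => by rw [hv0]; exact hwM x⟩ hv0' hwu
  have hunique : ∀ (T : EReal) (u : ℝ → ℝ → ℝ), IsSolution b u₀ T u → ∀ x t : ℝ, 0 < t →
      (t : EReal) < T → u x t = v x t := fun T u hu x t ht htT =>
    hu.unique hb hu₀_bdd.1 hvu₀.mono ht htT
  refine ⟨fun T u hT hu p t₀ t hp ht₀ ht htT => ?_, fun T u hT hu => ?_, v, hvu₀⟩
  · have hp1 : 1 ≤ p := hp₀.trans hp
    have hnorm : ∀ τ ∈ Icc 0 t, ∀ r : ENNReal,
        eLpNorm (fun x => u x τ) r volume = eLpNorm (fun x => v x τ) r volume := by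
      intro τ hτ r
      rcases hτ.1.eq_or_lt with rfl | h0
      · exact eLpNorm_congr_ae (hu.initial_value.trans hv0'.symm)
      · congr 1
        funext x
        exact hunique T u hu x τ h0 ((EReal.coe_le_coe_iff.2 hτ.2).trans_lt htT)
    have hsupeq : supLpNorm u p t₀ t = supLpNorm v p t₀ t :=
      iSup_congr fun τ => iSup_congr fun hτ => hnorm τ ⟨ht₀.trans hτ.1, hτ.2⟩ _
    obtain ⟨C, hC0, hC⟩ := hvb t
    have hfin : supLpNorm v p t₀ t < ⊤ := by
      have h1 := eLpNorm_lt_top_of_bounded (by linarith) hp hwp hwM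
      refine lt_of_le_of_lt (iSup₂_le fun τ hτ => ?_) (ENNReal.mul_lt_top
        (ENNReal.ofReal_lt_top (r := 1 + C * √t)) h1)
      have hτ0 := ht₀.trans hτ.1
      refine ((hC τ hτ0 hτ.2).2 p hp1).trans ?_
      have := hτ.2
      gcongr
    rw [hsupeq, hnorm t ⟨ht₀.trans ht, le_rfl⟩, hnorm t₀ ⟨ht₀, ht⟩]
    refine ⟨hfin, hvu₀.eLpNorm_top_le hb (C := C) hp1 ht₀ ht hfin fun s hs hst x => ?_⟩
    rw [eLpNorm_congr_ae hv0']
    exact (hC s hs hst).1 x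
  · refine ⟨fun x t => if t = 0 then u x 0 else v x t, hvu₀.congr (by simp)
      (fun x t ht _ => if_neg ht.ne') ?_ (by simpa using hu.initial_value) (ae_eq_refl _),
      fun x t ht htT => ?_⟩
    · obtain ⟨S, hS, hS'⟩ := EReal.lt_iff_exists_real_btwn.1 hT
      obtain ⟨K, hK⟩ := hu.bounded S (by exact_mod_cast hS) hS'
      exact ⟨K, fun x => by simpa using hK x 0 ⟨le_rfl, by exact_mod_cast hS.le⟩⟩
    · rcases ht.eq_or_lt with rfl | h0
      · simp
      · simp only [if_neg h0.ne', hunique T u hu x t h0 htT]
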